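/- **Setting.** Let $p$ be a prime, $q=p^a$, and let $f\in\mathbf F_q[x_1,\dots,x_n]$ have degree $d$, with homogeneous part $f^{(d)}$ of degree $d$. Work inside $\mathbf C_p$, the completion of an algebraic closure of $\mathbf Q_p$, with $\mathrm{ord}\,p=1$. Let $K$ be the unramified extension of $\mathbf Q_p$ of degree $a$, $\tau$ its automorphism over $\mathbf Q_p$ lifting $x\mapsto x^p$ on the residue field $\mathbf F_q$, $\zeta_p$ a primitive $p$-th root of unity, and $\gamma\in\mathbf Q_p(\zeta_p)$ with $\sum_{i\ge 0}\gamma^{p^i}/p^i=0$ and $\mathrm{ord}\,\gamma=1/(p-1)$. Let $b$ be a rational number with $\frac1{p-1}<b<\frac p{p-1}$, let $M$ be a positive integer such that $Mb/p$ and $Md/(p-1)$ are integers, let $\pi$ satisfy $\pi^{Md}=p$, and put $\tilde\Omega_0=K(\zeta_p,\pi)$ and $\epsilon=Mb(d-1)-Md/(p-1)\in\mathbf Z$. With $|u|=u_1+\cdots+u_n$, let $$C(b)=\Bigl\{\sum_{u\in\mathbf N^n}A_u\pi^{Mb|u|}x^u \;\Big|\; A_u\in\tilde\Omega_0,\ A_u\to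 0 \text{ as } u\to\infty\Bigr\}.$$ Let $\hat f\in K[x_1,\dots,x_n]$ be the Teichmüller lifting of $f$ (its coefficients satisfy $z^q=z$ and reduce to those of $f$), $\hat f_i=\partial\hat f/\partial x_i$, $\gamma_l=\sum_{i=0}^l\gamma^{p^i}/p^i$, and $$D_i=\frac{\partial}{\partial x_i}+H_i,\qquad H_i=\sum_{l=0}^\infty\gamma_l\,p^l\,x_i^{p^l-1}\,\hat f_i^{\tau^l}(x^{p^l}),$$ where $\tau^l$ acts on coefficients and $x^{p^l}=(x_1^{p^l},\dots,x_n^{p^l})$. Let $\Omega^k_{C(b)}=\bigoplus_{i_1<\cdots<i_k}C(b)\,dx_{i_1}\wedge\cdots\wedge dx_{i_k}$ and $D(\xi\,dx_{i_1}\wedge\cdots\wedge dx_{i_k})=\bigl(\sum_{i=1}^nD_i(\xi)\,dx_i\bigr)\wedge dx_{i_1}\wedge\cdots\wedge dx_{i_k}$. **Theorem 3.8.** Suppose that $\partial f^{(d)}/\partial x_1,\dots,\partial f^{(d)}/\partial x_n$ form a regular sequence in $\mathbf F_q[x_1,\dots,x_n]$. Then $(\Omega^{\bullet}_{C(b)},\pi^\epsilon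 D)$ is a complex of $\tilde\Omega_0$-vector spaces, and: 1. $H^i(\Omega^{\bullet}_{C(b)},\pi^\epsilon D)=0$ for all $i\ne n$. 2. There are $(d-1)^n$ monomials $x^{\mu_1},x^{\mu_2},\dots$ whose classes form an $\mathbf F_q$-basis of the Jacobian ring $\mathbf F_q[x_1,\dots,x_n]/(\partial f^{(d)}/\partial x_1,\dots,\partial f^{(d)}/\partial x_n)$, and for every such choice of monomials the classes of $x^{\mu_i}\,dx_1\wedge\cdots\wedge dx_n$, $1\le i\le(d-1)^n$, form a basis of $H^n(\Omega^{\bullet}_{C(b)},\pi^\epsilon D)$ over $\tilde\Omega_0$. In particular $\dim_{\tilde\Omega_0}H^n(\Omega^{\bullet}_{C(b)},\pi^\epsilon D)=(d-1)^n$. -/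

import Mathlib

namespace Dwork

/-! ### The `p`-adic fields

All fields live in `ℂ_p`, the completion of an algebraic closure of `ℚ_p`, with `‖p‖ = 1 / p`. -/

section Fields

variable (p : ℕ) [Fact p.Prime]

/-- `K`, the unramified extension of `ℚ_p` of degree `a` (for `1 ≤ a`): it is generated by the
roots of `z ^ q = z`, where `q = p ^ a`. -/
noncomputable def unramifiedField (a : ℕ) : IntermediateField ℚ_[p] (PadicComplex p) :=
  IntermediateField.adjoin ℚ_[p] {z : PadicComplex p | z ^ (p ^ a) = z}

/-- `Ω₁ = ℚ_p(ζ_p)`. -/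
noncomputable def OmegaOne (ζ : PadicComplex p) : IntermediateField ℚ_[p] (PadicComplex p) :=
  IntermediateField.adjoin ℚ_[p] {ζ}

/-- `Ω₀ = K(ζ_p)`. -/
noncomputable def OmegaZero (a : ℕ) (ζ : PadicComplex p) :
    IntermediateField ℚ_[p] (PadicComplex p) :=
  unramifiedField p a ⊔ OmegaOne p ζ

/-- `Ω̃₀ = Ω₀(π)`. -/
noncomputable def OmegaTilde (a : ℕ) (ζ π : PadicComplex p) :
    IntermediateField ℚ_[p] (PadicComplex p) :=
  OmegaZero p a ζ ⊔ IntermediateField.adjoin ℚ_[p] {π}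

variable {p}

theorem unramifiedField_le (a : ℕ) (ζ π : PadicComplex p) :
    unramifiedField p a ≤ OmegaTilde p a ζ π :=
  le_sup_left.trans le_sup_left

theorem OmegaOne_le (a : ℕ) (ζ π : PadicComplex p) :
    OmegaOne p ζ ≤ OmegaTilde p a ζ π :=
  le_sup_right.trans le_sup_left

/-- `π` as an element of `Ω̃₀`. -/
noncomputable def piTilde (a : ℕ) (ζ π : PadicComplex p) : OmegaTilde p a ζ π :=
  ⟨π, (le_sup_right : _ ≤ OmegaTilde p a ζ π)
    (IntermediateField.mem_adjoin_simple_self ℚ_[p] π)⟩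

theorem piTilde_ne_zero {a N : ℕ} {ζ π : PadicComplex p} (h : π ^ N = (p : PadicComplex p)) :
    piTilde a ζ π ≠ 0 := by
  intro h0
  have hp : Nat.Prime p := Fact.out
  have h1 : π = 0 := congrArg Subtype.val h0
  rcases Nat.eq_zero_or_pos N with hN | hN
  · rw [hN, pow_zero] at h
    exact hp.one_lt.ne (by exact_mod_cast h)
  · rw [h1, zero_pow hN.ne'] at h
    exact hp.ne_zero (by exact_mod_cast h.symm)

/-- `τ` is the automorphism of `K` over `ℚ_p` that lifts the Frobenius `x ↦ x ^ p` of the residue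
field. -/
def IsFrobenius {a : ℕ} (τ : unramifiedField p a ≃ₐ[ℚ_[p]] unramifiedField p a) : Prop :=
  ∀ x : unramifiedField p a, ‖x‖ ≤ 1 → ‖τ x - x ^ p‖ < 1

/-- The ring of integers of `K`, i.e. the elements of norm at most one. -/
noncomputable def unramifiedIntegers (p : ℕ) [Fact p.Prime] (a : ℕ) :
    Subring (unramifiedField p a) :=
  (NormedField.valuation (K := unramifiedField p a)).integer

/-- `fhat` is the Teichmüller lifting of `f`: its coefficients are integral, satisfy `z ^ q = z`,
and reduce to those of `f`. Here `red` is the reduction map from the ring of integers of `K` to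
the field `F` of `q = p ^ a` elements. -/
def IsTeichmullerLift {a n : ℕ} {F : Type*} [Field F] (red : unramifiedIntegers p a →+* F)
    (f : MvPolynomial (Fin n) F) (fhat : MvPolynomial (Fin n) (unramifiedField p a)) : Prop :=
  ∀ u : Fin n →₀ ℕ, (fhat.coeff u) ^ (p ^ a) = fhat.coeff u ∧
    ∃ h : fhat.coeff u ∈ unramifiedIntegers p a, red ⟨fhat.coeff u, h⟩ = f.coeff u

end Fields

/-! ### The space `C(b)` and the operators `D_i` -/

section Complex

variable {n : ℕ} {K L : Type*} [Field K] [NormedField L]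

/-- The space `C(b)` of the power series `∑ A_u π ^ (m |u|) x ^ u` with `A_u → 0`; here `m` is the
integer `M b`. -/
def CSpace (n : ℕ) (π : L) (m : ℕ) : Submodule L (MvPowerSeries (Fin n) L) where
  carrier := {ξ | ∃ A : (Fin n →₀ ℕ) → L, Filter.Tendsto A Filter.cofinite (nhds 0) ∧
    ∀ u, MvPowerSeries.coeff u ξ = A u * π ^ (m * u.degree)}
  add_mem' := by
    rintro ξ η ⟨A, hA, hA'⟩ ⟨B, hB, hB'⟩
    refine ⟨fun u => A u + B u, by simpa using hA.add hB, fun u => ?_⟩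
    rw [map_add, hA', hB', add_mul]
  zero_mem' := ⟨fun _ => 0, tendsto_const_nhds, fun u => by simp⟩
  smul_mem' := by
    rintro c ξ ⟨A, hA, hA'⟩
    refine ⟨fun u => c * A u, by simpa using hA.const_mul c, fun u => ?_⟩
    rw [MvPowerSeries.coeff_smul, hA', mul_assoc]

/-- `γ_l = ∑_{i ≤ l} γ ^ (p ^ i) / p ^ i`. -/
def gammaTrunc (p : ℕ) (γ : L) (l : ℕ) : L :=
  ∑ i ∈ Finset.range (l + 1), γ ^ (p ^ i) / (p : L) ^ i

/-- The `l`-th term `γ_l p ^ l x_i ^ (p ^ l - 1) f̂_i ^ (τ ^ l) (x ^ (p ^ l))` of `H_i`, where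
`f̂_i = ∂f̂ / ∂x_i`, `τ ^ l` acts on the coefficients, and `j : K → L` is the inclusion. -/
noncomputable def HTerm (p : ℕ) (j : K →+* L) (τ : K ≃+* K) (γ : L)
    (fhat : MvPolynomial (Fin n) K) (i : Fin n) (l : ℕ) : MvPolynomial (Fin n) L :=
  MvPolynomial.C (gammaTrunc p γ l * (p : L) ^ l) * MvPolynomial.X i ^ (p ^ l - 1) *
    MvPolynomial.expand (p ^ l)
      (MvPolynomial.map (j.comp ((τ ^ l : K ≃+* K) : K →+* K)) (MvPolynomial.pderiv i fhat))

/-- `H_i = ∑_l γ_l p ^ l x_i ^ (p ^ l - 1) f̂_i ^ (τ ^ l) (x ^ (p ^ l))` as a formal power series.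
The `l`-th term is divisible by `x_i ^ (p ^ l - 1)`, so (for `2 ≤ p`) every coefficient is a sum
with finitely many nonzero terms. -/
noncomputable def HSeries (p : ℕ) (j : K →+* L) (τ : K ≃+* K) (γ : L)
    (fhat : MvPolynomial (Fin n) K) (i : Fin n) : MvPowerSeries (Fin n) L :=
  fun u => ∑ᶠ l : ℕ, (HTerm p j τ γ fhat i l).coeff u

/-- The differential operator `D_i = ∂ / ∂x_i + H_i`. -/
noncomputable def DOp (p : ℕ) (j : K →+* L) (τ : K ≃+* K) (γ : L)
    (fhat : MvPolynomial (Fin n) K) (i : Fin n) :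
    MvPowerSeries (Fin n) L →ₗ[L] MvPowerSeries (Fin n) L :=
  (MvPowerSeries.pderiv L i).toLinearMap + LinearMap.mulLeft L (HSeries p j τ γ fhat i)

/-! ### The de Rham-type complex -/

/-- Differential forms (of mixed degree) with formal power series coefficients: the form
`∑_s ω_s dx_s` is the family `s ↦ ω_s`, where `dx_s = dx_{i_1} ∧ ⋯ ∧ dx_{i_k}` for
`s = {i_1 < ⋯ < i_k}`. -/
abbrev Form (n : ℕ) (L : Type*) : Type _ := Finset (Fin n) → MvPowerSeries (Fin n) L

/-- `Ω^k_{C(b)}`: the forms of degree `k` with coefficients in `C(b)`. -/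
def OmegaC (n : ℕ) (π : L) (m k : ℕ) : Submodule L (Form n L) where
  carrier := {ω | ∀ s, ω s ∈ CSpace n π m ∧ (s.card ≠ k → ω s = 0)}
  add_mem' := by
    intro ω η hω hη s
    refine ⟨Submodule.add_mem _ (hω s).1 (hη s).1, fun h => ?_⟩
    rw [Pi.add_apply, (hω s).2 h, (hη s).2 h, add_zero]
  zero_mem' := fun s => ⟨Submodule.zero_mem _, fun _ => rfl⟩
  smul_mem' := by
    intro c ω hω s
    refine ⟨Submodule.smul_mem _ c (hω s).1, fun h => ?_⟩
    rw [Pi.smul_apply, (hω s).2 h, smul_zero]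

/-- The operator `D (ξ dx_s) = (∑_i D_i(ξ) dx_i) ∧ dx_s`. The coefficient of `dx_t` in `D ω` is
the sum over `i ∈ t` of `± D_i (ω_{t \ {i}})`, the sign being that of
`dx_i ∧ dx_{t \ {i}} = ± dx_t`. -/
noncomputable def DForm (p : ℕ) (j : K →+* L) (τ : K ≃+* K) (γ : L)
    (fhat : MvPolynomial (Fin n) K) : Form n L →ₗ[L] Form n L :=
  LinearMap.pi fun t => ∑ i ∈ t, ((-1 : L) ^ (t.filter (· < i)).card) •
    (DOp p j τ γ fhat i ∘ₗ LinearMap.proj (t.erase i))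

/-- The differential `π ^ ε D`. -/
noncomputable def piD (p : ℕ) (j : K →+* L) (τ : K ≃+* K) (γ π : L) (ε : ℤ)
    (fhat : MvPolynomial (Fin n) K) : Form n L →ₗ[L] Form n L :=
  π ^ ε • DForm p j τ γ fhat

/-- The `k`-cocycles of the complex `(Ω^•_{C(b)}, ∂)`. -/
def cocycles (π : L) (m : ℕ) (d : Form n L →ₗ[L] Form n L) (k : ℕ) :
    Submodule L (Form n L) :=
  OmegaC n π m k ⊓ LinearMap.ker d

/-- The `k`-coboundaries of the complex `(Ω^•_{C(b)}, ∂)`. -/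
def coboundaries (π : L) (m : ℕ) (d : Form n L →ₗ[L] Form n L) :
    ℕ → Submodule L (Form n L)
  | 0 => ⊥
  | k + 1 => (OmegaC n π m k).map d

/-- The cohomology `H^k(Ω^•_{C(b)}, ∂)`: cocycles modulo coboundaries. -/
abbrev Cohomology (π : L) (m : ℕ) (d : Form n L →ₗ[L] Form n L) (k : ℕ) : Type _ :=
  cocycles π m d k ⧸ (coboundaries π m d k).submoduleOf (cocycles π m d k)

/-- The form `x ^ μ dx_1 ∧ ⋯ ∧ dx_n`. -/
noncomputable def topForm (μ : Fin n →₀ ℕ) : Form n L :=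
  Pi.single Finset.univ (MvPowerSeries.monomial μ 1)

theorem topForm_mem_OmegaC {π : L} (hπ : π ≠ 0) (m : ℕ) (μ : Fin n →₀ ℕ) :
    topForm μ ∈ OmegaC n π m n := by
  intro s
  by_cases hs : s = Finset.univ
  · subst hs
    refine ⟨?_, fun h => absurd (by simp) h⟩
    classical
    refine ⟨(Pi.single μ ((π ^ (m * μ.degree))⁻¹) : (Fin n →₀ ℕ) → L), ?_, fun u => ?_⟩
    · refine tendsto_const_nhds.congr' ?_
      filter_upwards [(Set.finite_singleton μ).compl_mem_cofinite] with u hu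
      have hu' : u ≠ μ := by simpa using hu
      exact (Pi.single_eq_of_ne (M := fun _ => L) hu' _).symm
    · rw [topForm, Pi.single_eq_same, MvPowerSeries.coeff_monomial]
      by_cases hu : u = μ
      · subst hu
        simp [inv_mul_cancel₀ (pow_ne_zero _ hπ)]
      · simp [hu]
  · rw [topForm, Pi.single_eq_of_ne hs]
    exact ⟨Submodule.zero_mem _, fun _ => rfl⟩

theorem DForm_topForm (p : ℕ) (j : K →+* L) (τ : K ≃+* K) (γ : L)
    (fhat : MvPolynomial (Fin n) K) (μ : Fin n →₀ ℕ) :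
    DForm p j τ γ fhat (topForm μ) = 0 := by
  funext t
  simp only [DForm, LinearMap.pi_apply, LinearMap.sum_apply, LinearMap.smul_apply,
    LinearMap.comp_apply, LinearMap.proj_apply, Pi.zero_apply]
  refine Finset.sum_eq_zero fun i _ => ?_
  have h : t.erase i ≠ Finset.univ := fun h => by
    have := Finset.mem_univ i
    rw [← h] at this
    simp at this
  rw [topForm, Pi.single_eq_of_ne h, map_zero, smul_zero]

theorem topForm_mem_cocycles {π : L} (hπ : π ≠ 0) (m p : ℕ) (j : K →+* L) (τ : K ≃+* K) (γ : L)
    (ε : ℤ) (fhat : MvPolynomial (Fin n) K) (μ : Fin n →₀ ℕ) :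
    topForm μ ∈ cocycles π m (piD p j τ γ π ε fhat) n := by
  refine Submodule.mem_inf.2 ⟨topForm_mem_OmegaC hπ m μ, ?_⟩
  rw [LinearMap.mem_ker, piD, LinearMap.smul_apply, DForm_topForm, smul_zero]

/-- The class of `x ^ μ dx_1 ∧ ⋯ ∧ dx_n` in `H^n(Ω^•_{C(b)}, π ^ ε D)`. -/
noncomputable def topClass {π : L} (hπ : π ≠ 0) (m p : ℕ) (j : K →+* L) (τ : K ≃+* K) (γ : L)
    (ε : ℤ) (fhat : MvPolynomial (Fin n) K) (μ : Fin n →₀ ℕ) :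
    Cohomology π m (piD p j τ γ π ε fhat) n :=
  Submodule.Quotient.mk ⟨topForm μ, topForm_mem_cocycles hπ m p j τ γ ε fhat μ⟩

end Complex

/-! ### The Jacobian ring of the leading form -/

section Jacobian

variable {n : ℕ} {F : Type*} [Field F]

/-- `∂f^{(d)} / ∂x_i`, where `f^{(d)}` is the homogeneous component of `f` of degree `d`. -/
noncomputable def leadingPartial (d : ℕ) (f : MvPolynomial (Fin n) F) (i : Fin n) :
    MvPolynomial (Fin n) F :=
  MvPolynomial.pderiv i (MvPolynomial.homogeneousComponent d f)

/-- The Jacobian ring `F[x_1, …, x_n] / (∂f^{(d)} / ∂x_1, …, ∂f^{(d)} / ∂x_n)`. -/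
abbrev JacobianRing (d : ℕ) (f : MvPolynomial (Fin n) F) : Type _ :=
  MvPolynomial (Fin n) F ⧸ Ideal.span (Set.range (leadingPartial d f))

/-- The classes of the monomials `x ^ (μ i)` form a basis of the Jacobian ring over `F`. -/
def IsMonomialBasis (d : ℕ) (f : MvPolynomial (Fin n) F) {ι : Type*}
    (μ : ι → Fin n →₀ ℕ) : Prop :=
  let v : ι → JacobianRing d f := fun i =>
    Ideal.Quotient.mk (Ideal.span (Set.range (leadingPartial d f)))
      (MvPolynomial.monomial (μ i) 1)
  LinearIndependent F v ∧ Submodule.span F (Set.range v) = ⊤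

end Jacobian

end Dwork

/-! Let O be the valuation ring of `L` = Ω̃₀, with uniformizer ϖ and residue field k. Substituting
π^m x for x (`scaleSeries`) identifies C(b), up to powers of ϖ in the denominators, with the power
series over O whose coefficients tend to zero (`restrictedSeries`), and turns π^ε D_i into s ∂/∂x_i
+ G_i with s = π^(ε+m). Everything rests on what remains of these operators modulo ϖ.

Write ‖γ‖ = ‖π‖^e with e = Md/(p-1); the two inequalities on b say e < md < pe. The first gives ‖s‖
= ‖π‖^(md-e) < 1, so the derivative disappears modulo ϖ. For the second, γ_l is minus a tail of a
series with sum zero, hence no larger than the first omitted term (`norm_gammaTrunc_mul_le`); the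
l-th term of G_i then has norm at most ‖π‖^((p^l-1)(pe-md)), which is below 1 for l ≥ 1. In the term
l = 0 the choice of ε leaves exactly the part of degree d-1, multiplied by a unit. So G_i reduces to
a nonzero constant times ∂f^(d)/∂x_i, and the reduced complex is a Koszul complex over k[x]
(`Bounds.integralModel`).

A regular sequence remains regular over k by flatness, so that Koszul complex is exact outside the
top degree (`koszul_exact_of_isRegularFamily`), and its top cohomology is the Jacobian ring with
scalars extended to k. Since the modules are ϖ-adically complete, separated and torsion-free,
exactness and bases lift from the reduction by successive approximation (`KoszulReduction.exact`,
`KoszulReduction.exists_eq_sum_add_diff_univ`, `KoszulReduction.eq_zero_of_sum_eq_diff_univ`);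
inverting ϖ gives the statement for C(b). The rank (d-1)^n comes from the Hilbert series
(1-t^(d-1))^n / (1-t)^(n+1) of the degree filtration of the Jacobian ring
(`finrank_quotient_of_regular`). -/

namespace Dwork

/-! ### Koszul differentials of commuting operators on mixed forms. -/

section Koszul

variable {ι V W : Type*} [LinearOrder ι] [AddCommGroup V] [AddCommGroup W]

/-- The sign of `dx_i ∧ dx_{t \ {i}} = ± dx_t`. -/
def wedgeSign (t : Finset ι) (i : ι) : ℤ := (-1) ^ (t.filter (· < i)).card

theorem wedgeSign_mul_self (t : Finset ι) (i : ι) : wedgeSign t i * wedgeSign t i = 1 := by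
  rw [wedgeSign, ← mul_pow]; simp

theorem wedgeSign_erase_of_lt {t : Finset ι} {i j : ι} (hi : i ∈ t) (hij : i < j) :
    wedgeSign (t.erase i) j = -wedgeSign t j := by
  have h : (t.erase i).filter (· < j) = (t.filter (· < j)).erase i := by
    ext x; simp only [Finset.mem_filter, Finset.mem_erase]; tauto
  have hmem : i ∈ t.filter (· < j) := by simp [hi, hij]
  have hc := Finset.card_erase_add_one hmem
  rw [wedgeSign, wedgeSign, h, ← hc, pow_succ]; ring

theorem wedgeSign_erase_of_le {t : Finset ι} {i j : ι} (hij : j ≤ i) :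
    wedgeSign (t.erase i) j = wedgeSign t j := by
  have h : (t.erase i).filter (· < j) = t.filter (· < j) := by
    ext x; simp only [Finset.mem_filter, Finset.mem_erase]
    constructor
    · tauto
    · rintro ⟨h1, h2⟩; exact ⟨⟨(h2.trans_le hij).ne, h1⟩, h2⟩
  rw [wedgeSign, wedgeSign, h]

/-- The rule dx_i ∧ dx_j = -dx_j ∧ dx_i, the only fact about signs behind d² = 0. -/
theorem wedgeSign_swap {t : Finset ι} {i j : ι} (hi : i ∈ t) (hj : j ∈ t) (hij : i ≠ j) :
    wedgeSign t i * wedgeSign (t.erase i) j + wedgeSign t j * wedgeSign (t.erase j) i = 0 := by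
  rcases lt_or_gt_of_ne hij with h | h
  · rw [wedgeSign_erase_of_lt hi h, wedgeSign_erase_of_le h.le]; ring
  · rw [wedgeSign_erase_of_lt hj h, wedgeSign_erase_of_le h.le]; ring

theorem wedgeSign_insert_of_lt {t : Finset ι} {i a : ι} (h : i < a) :
    wedgeSign (insert a t) i = wedgeSign t i := by
  rw [wedgeSign, wedgeSign, Finset.filter_insert, if_neg h.not_gt]

theorem wedgeSign_insert_self {t : Finset ι} {a : ι} (h : ∀ i ∈ t, i < a) :
    wedgeSign (insert a t) a = (-1) ^ t.card := by
  rw [wedgeSign, Finset.filter_insert, if_neg (lt_irrefl a), Finset.filter_true_of_mem h]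

/-- The Koszul differential of a family of additive operators `T i`, acting on mixed forms. -/
def koszul (T : ι → V →+ V) : (Finset ι → V) →+ (Finset ι → V) where
  toFun ω t := ∑ i ∈ t, wedgeSign t i • T i (ω (t.erase i))
  map_zero' := by ext; simp
  map_add' ω η := by ext; simp [Finset.sum_add_distrib]

theorem koszul_apply (T : ι → V →+ V) (ω : Finset ι → V) (t : Finset ι) :
    koszul T ω t = ∑ i ∈ t, wedgeSign t i • T i (ω (t.erase i)) := rfl

theorem koszul_congr {T : ι → V →+ V} {ω η : Finset ι → V} {t : Finset ι}
    (h : ∀ i ∈ t, ω (t.erase i) = η (t.erase i)) : koszul T ω t = koszul T η t :=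
  Finset.sum_congr rfl fun i hi => by rw [h i hi]

theorem koszul_map {T : ι → V →+ V} {S : ι → W →+ W} (φ : V →+ W)
    (h : ∀ i v, φ (T i v) = S i (φ v)) (ω : Finset ι → V) (t : Finset ι) :
    φ (koszul T ω t) = koszul S (fun s => φ (ω s)) t := by
  simp only [koszul_apply, map_sum, map_zsmul, h]

theorem koszul_koszul {T : ι → V →+ V} (hT : ∀ i j v, T i (T j v) = T j (T i v))
    (ω : Finset ι → V) : koszul T (koszul T ω) = 0 := by
  funext t
  simp only [koszul_apply, map_sum, map_zsmul, Finset.smul_sum, smul_smul, Pi.zero_apply]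
  rw [Finset.sum_sigma']
  -- Terms cancel in pairs under exchanging the two removed indices.
  refine Finset.sum_involution (fun x _ => ⟨x.2, x.1⟩) ?_ ?_ ?_ ?_
  · rintro ⟨i, j⟩ hx
    obtain ⟨hi, hj⟩ := Finset.mem_sigma.1 hx
    obtain ⟨hji, hj⟩ := Finset.mem_erase.1 hj
    simp only
    rw [hT j i, Finset.erase_right_comm (a := j), ← add_smul,
      wedgeSign_swap hi hj (Ne.symm hji), zero_smul]
  · rintro ⟨i, j⟩ hx _ h
    have hj := (Finset.mem_erase.1 (Finset.mem_sigma.1 hx).2).1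
    exact hj (congrArg Sigma.fst h)
  · rintro ⟨i, j⟩ hx
    obtain ⟨hi, hj⟩ := Finset.mem_sigma.1 hx
    obtain ⟨hji, hj⟩ := Finset.mem_erase.1 hj
    exact Finset.mem_sigma.2 ⟨hj, Finset.mem_erase.2 ⟨Ne.symm hji, hi⟩⟩
  · rintro ⟨i, j⟩ _
    rfl

/-- Splitting off the largest index presents the complex as a mapping cone of `T a`, which is what
an induction on the number of operators needs. -/
theorem koszul_insert (T : ι → V →+ V) (ω : Finset ι → V) {t : Finset ι} {a : ι}
    (h : ∀ i ∈ t, i < a) :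
    koszul T ω (insert a t)
      = koszul T (fun s => ω (insert a s)) t + (-1 : ℤ) ^ t.card • T a (ω t) := by
  have ha : a ∉ t := fun h' => lt_irrefl a (h a h')
  rw [koszul_apply, Finset.sum_insert ha, wedgeSign_insert_self h, Finset.erase_insert ha,
    add_comm, koszul_apply]
  congr 1
  refine Finset.sum_congr rfl fun i hi => ?_
  rw [wedgeSign_insert_of_lt (h i hi), Finset.erase_insert_of_ne (h i hi).ne']

/-- The differential raises degree by one, so selecting degrees commutes with it up to a shift. This
lets the arguments run on mixed forms, with degrees imposed afterwards. -/
theorem koszul_filter_card (T : ι → V →+ V) (P : ℕ → Prop) [DecidablePred P] (ω : Finset ι → V)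
    (t : Finset ι) :
    koszul T (fun s => if P (s.card + 1) then ω s else 0) t
      = if P t.card then koszul T ω t else 0 := by
  have h : ∀ i ∈ t, (if P ((t.erase i).card + 1) then ω (t.erase i) else 0)
      = if P t.card then ω (t.erase i) else 0 := fun i hi => by
    rw [Finset.card_erase_add_one hi]
  rw [koszul_apply, koszul_apply, Finset.sum_congr rfl fun i hi => by rw [h i hi]]
  split_ifs <;> simp

theorem exists_koszul_eq_sum (T : ι → V →+ V) (s : Finset ι) (w : ι → V) :
    ∃ η, koszul T η s = ∑ i ∈ s, T i (w i) := by
  -- At t = `s.erase i` the sum has the single index i, and the two equal signs cancel.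
  refine ⟨fun t => ∑ j ∈ s \ t, wedgeSign s j • w j, Finset.sum_congr rfl fun i hi => ?_⟩
  have h : s \ s.erase i = {i} := by
    ext x; simp only [Finset.mem_sdiff, Finset.mem_erase, Finset.mem_singleton]
    constructor
    · tauto
    · rintro rfl; tauto
  simp only [h, Finset.sum_singleton, map_zsmul, smul_smul, wedgeSign_mul_self, one_smul]

end Koszul

/-! ### Exactness of the Koszul complex of a regular family. -/

section Exactness

variable {V : Type*} [AddCommGroup V] {n : ℕ}

/-- A family of operators `T 0, …, T (n - 1)` is a weakly regular sequence on `V`: whenever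
`T i v` lies in `∑_{j < i} T j V`, so does `v`. -/
def IsRegularFamily (T : Fin n → V →+ V) : Prop :=
  ∀ i v, (∃ w : Fin n → V, T i v = ∑ j with j < i, T j (w j)) →
    ∃ w : Fin n → V, v = ∑ j with j < i, T j (w j)

/-- Induction on the number m of indices in play, through the mapping cone. The part of a cocycle
without the new index a has a coefficient at the full smaller set which regularity of `T a` makes a
boundary value; after that correction both parts fall under the induction hypothesis. -/
theorem koszul_exact_of_isRegularFamily {T : Fin n → V →+ V}
    (hT : ∀ i j v, T i (T j v) = T j (T i v)) (hreg : IsRegularFamily T)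
    {ω : Finset (Fin n) → V} (hω : koszul T ω = 0) (htop : ω Finset.univ = 0) :
    ∃ η, ω = koszul T η := by
  have key : ∀ m ≤ n, ∀ ω : Finset (Fin n) → V,
      (∀ t ⊆ Finset.univ.filter (fun j : Fin n => j.val < m), koszul T ω t = 0) →
      ω (Finset.univ.filter (fun j : Fin n => j.val < m)) = 0 →
      ∃ η, ∀ t ⊆ Finset.univ.filter (fun j : Fin n => j.val < m), ω t = koszul T η t := by
    intro m
    induction m with
    | zero =>
      intro _ ω _ h0
      refine ⟨0, fun t ht => ?_⟩
      have hs : (Finset.univ.filter (fun j : Fin n => j.val < 0)) = ∅ := by simp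
      rw [hs] at ht h0
      rw [Finset.subset_empty.1 ht, h0, map_zero, Pi.zero_apply]
    | succ m ih =>
      intro hm ω hω h0
      set s := Finset.univ.filter (fun j : Fin n => j.val < m) with hs
      set a : Fin n := ⟨m, hm⟩ with ha
      have hsa : Finset.univ.filter (fun j : Fin n => j.val < m + 1) = insert a s := by
        ext j
        simp only [Finset.mem_filter, Finset.mem_univ, true_and, Finset.mem_insert, hs, ha,
          Fin.ext_iff]
        omega
      rw [hsa] at hω h0 ⊢
      have hlt : ∀ i ∈ s, i < a := fun i hi => by
        simpa [hs, Fin.lt_def, ha] using hi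
      have hsf : (Finset.univ.filter (· < a)) = s := by
        ext j; simp [hs, ha, Fin.lt_def]
      have hlt' : ∀ t ⊆ s, ∀ i ∈ t, i < a := fun t ht i hi => hlt i (ht hi)
      have hnot : ∀ t ⊆ s, a ∉ t := fun t ht h => lt_irrefl a (hlt' t ht a h)
      set β : Finset (Fin n) → V := fun t => ω (insert a t) with hβ
      have hβ' : ∀ t ⊆ s, koszul T β t + (-1 : ℤ) ^ t.card • T a (ω t) = 0 := fun t ht => by
        rw [← koszul_insert T ω (hlt' t ht)]
        exact hω _ (Finset.insert_subset_insert a ht)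
      have hωs : ∀ t ⊆ s, koszul T ω t = 0 := fun t ht =>
        hω t (ht.trans (Finset.subset_insert a s))
      -- the top coefficient of `ω` on `s`
      obtain ⟨w, hw⟩ := hreg a (ω s) ⟨fun i => (-1 : ℤ) ^ (s.card + 1) • wedgeSign s i •
        β (s.erase i), by
          have h1 := hβ' s subset_rfl
          have h2 : T a (ω s) = (-1 : ℤ) ^ (s.card + 1) • koszul T β s := by
            rw [eq_neg_of_add_eq_zero_left h1, pow_succ, smul_neg, smul_smul, ← neg_smul]
            have : (-((-1 : ℤ) ^ s.card * -1 * (-1) ^ s.card)) = 1 := by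
              rw [mul_right_comm, ← pow_add, ← two_mul, pow_mul]; simp
            rw [this, one_smul]
          rw [h2, koszul_apply, hsf, Finset.smul_sum]
          refine Finset.sum_congr rfl fun i _ => ?_
          rw [map_zsmul, map_zsmul]⟩
      rw [hsf] at hw
      obtain ⟨η₀, hη₀⟩ := exists_koszul_eq_sum T s w
      obtain ⟨η₁, hη₁⟩ := ih (by omega) (ω - koszul T η₀) (fun t ht => by
        rw [map_sub, koszul_koszul hT, sub_zero, hωs t ht]) (by
        rw [Pi.sub_apply, hη₀, hw, sub_self])
      -- On subsets of s the differential only reads η at proper subsets of s, so its value at s is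
      -- free. Zero is chosen so that the cocycle handled next has top coefficient `ω (insert a s)`,
      -- which vanishes.
      set η : Finset (Fin n) → V := fun t => if t = s then 0 else η₀ t + η₁ t with hη
      have hηω : ∀ t ⊆ s, ω t = koszul T η t := fun t ht => by
        have h1 : koszul T η t = koszul T (η₀ + η₁) t := koszul_congr fun i hi => by
          have : t.erase i ≠ s := fun h => by
            have := Finset.notMem_erase i t
            rw [h] at this
            exact this (ht hi)
          simp [hη, this]
        rw [h1, map_add, Pi.add_apply, ← hη₁ t ht, Pi.sub_apply]; abel
      have hηs : η s = 0 := by simp [hη]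
      -- With the part without a equal to dη, the cone relation makes the part containing a closed
      -- once ± `T a` η is subtracted.
      obtain ⟨θ, hθ⟩ := ih (by omega) (fun t => β t - (-1 : ℤ) ^ t.card • T a (η t))
        (fun t ht => by
          have h1 : koszul T (fun t => β t - (-1 : ℤ) ^ t.card • T a (η t)) t
              = koszul T β t + (-1 : ℤ) ^ t.card • T a (koszul T η t) := by
            rw [koszul_apply, koszul_apply, koszul_apply, map_sum, Finset.smul_sum,
              ← Finset.sum_add_distrib]
            refine Finset.sum_congr rfl fun i hi => ?_
            have hc : t.card = (t.erase i).card + 1 := (Finset.card_erase_add_one hi).symm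
            rw [map_sub, smul_sub, map_zsmul, map_zsmul, hT i a, hc, pow_succ, sub_eq_add_neg,
              smul_smul, smul_smul, ← neg_smul]
            congr 2
            ring
          rw [h1, ← hηω t ht, hβ' t ht]) (by
          simp only [hηs, map_zero, smul_zero, sub_zero, hβ, h0])
      refine ⟨fun t => if a ∈ t then θ (t.erase a) else η t, fun t ht => ?_⟩
      by_cases hat : a ∈ t
      · have ht' : t.erase a ⊆ s := by
          intro x hx
          rcases Finset.mem_erase.1 hx with ⟨hxa, hxt⟩
          exact (Finset.mem_insert.1 (ht hxt)).resolve_left hxa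
        rw [← Finset.insert_erase hat, koszul_insert T _ (hlt' _ ht'), if_neg (hnot _ ht')]
        have h1 : koszul T (fun r => if a ∈ insert a r then θ ((insert a r).erase a)
            else η (insert a r)) (t.erase a) = koszul T θ (t.erase a) := koszul_congr fun i hi => by
          rw [if_pos (Finset.mem_insert_self _ _), Finset.erase_insert]
          exact fun h => hnot _ ht' (Finset.mem_of_mem_erase h)
        rw [h1, ← hθ _ ht', sub_add_cancel]
      · have ht' : t ⊆ s := fun x hx =>
          (Finset.mem_insert.1 (ht hx)).resolve_left fun h => hat (h ▸ hx)
        rw [hηω t ht']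
        refine koszul_congr fun i _ => ?_
        rw [if_neg fun h => hat (Finset.mem_of_mem_erase h)]
  obtain ⟨η, hη⟩ := key n le_rfl ω (fun t _ => by rw [hω, Pi.zero_apply]) (by
    have : (Finset.univ.filter (fun j : Fin n => j.val < n)) = Finset.univ := by
      ext j; simp
    rw [this, htop])
  refine ⟨η, funext fun t => hη t fun j _ => by simp⟩

end Exactness

/-! ### Lifting exactness and bases from the reduction modulo ϖ. -/

section Lifting

variable {O : Type*} [CommRing O] (ϖ : O)

/-- Every series `∑ ϖ ^ s x_s` has a `ϖ`-adic sum in `M`. -/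
def AdicPrecomplete (M : Type*) [AddCommGroup M] [Module O M] : Prop :=
  ∀ x : ℕ → M, ∃ y, ∀ N, ∃ z, y = ∑ s ∈ Finset.range N, ϖ ^ s • x s + ϖ ^ N • z

/-- The `ϖ`-adic topology of `M` is separated. -/
def AdicSeparated (M : Type*) [AddCommGroup M] [Module O M] : Prop :=
  ∀ y : M, (∀ N, ∃ z, y = ϖ ^ N • z) → y = 0

variable {ϖ} {M N : Type*} [AddCommGroup M] [Module O M] [AddCommGroup N] [Module O N]

theorem AdicPrecomplete.pi {κ : Type*} (h : AdicPrecomplete ϖ M) :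
    AdicPrecomplete ϖ (κ → M) := by
  intro x
  choose y hy using fun k => h fun s => x s k
  choose z hz using hy
  refine ⟨y, fun N => ⟨fun k => z k N, funext fun k => ?_⟩⟩
  simp [← hz]

theorem AdicSeparated.pi {κ : Type*} (h : AdicSeparated ϖ M) : AdicSeparated ϖ (κ → M) := by
  intro y hy
  choose z hz using hy
  exact funext fun k => h _ fun N => ⟨z N k, congrFun (hz N) k⟩

theorem AdicPrecomplete.prod (hM : AdicPrecomplete ϖ M) (hN : AdicPrecomplete ϖ N) :
    AdicPrecomplete ϖ (M × N) := by
  intro x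
  obtain ⟨y, hy⟩ := hM fun s => (x s).1
  obtain ⟨y', hy'⟩ := hN fun s => (x s).2
  refine ⟨(y, y'), fun k => ?_⟩
  obtain ⟨z, hz⟩ := hy k
  obtain ⟨z', hz'⟩ := hy' k
  exact ⟨(z, z'), by ext <;> simp [Prod.fst_sum, Prod.snd_sum, ← hz, ← hz']⟩

/-- Successive approximation: if every element of `S` is in the image of `A` up to `ϖ S`, then
`S` lies in the image of `A`. -/
theorem exists_preimage_of_approx (hM : AdicPrecomplete ϖ M) (hN : AdicSeparated ϖ N)
    (A : M →+ N) (hA : ∀ x, A (ϖ • x) = ϖ • A x) (S : Set N)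
    (h : ∀ y ∈ S, ∃ x, ∃ y' ∈ S, y = A x + ϖ • y') {y : N} (hy : y ∈ S) : ∃ x, y = A x := by
  choose! f g hg hfg using h
  have hA' : ∀ (k : ℕ) x, A (ϖ ^ k • x) = ϖ ^ k • A x := by
    intro k
    induction k with
    | zero => simp
    | succ k ih => intro x; rw [pow_succ', mul_smul, hA, ih, ← mul_smul]
  have hS : ∀ k, g^[k] y ∈ S := by
    intro k
    induction k with
    | zero => exact hy
    | succ k ih => rw [Function.iterate_succ_apply']; exact hg _ ih
  have hsum : ∀ k, y = A (∑ s ∈ Finset.range k, ϖ ^ s • f (g^[s] y)) + ϖ ^ k • g^[k] y := by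
    intro k
    induction k with
    | zero => simp
    | succ k ih =>
      have h1 := hfg _ (hS k)
      rw [Finset.sum_range_succ, map_add, hA', add_assoc, Function.iterate_succ_apply', pow_succ,
        mul_smul, ← smul_add, ← h1]
      exact ih
  -- Summing all corrections gives x; y and `A x` agree modulo every power of ϖ, so separatedness of
  -- the target concludes.
  obtain ⟨x, hx⟩ := hM fun s => f (g^[s] y)
  refine ⟨x, sub_eq_zero.1 (hN _ fun k => ?_)⟩
  obtain ⟨z, hz⟩ := hx k
  refine ⟨g^[k] y - A z, ?_⟩
  conv_lhs => rw [hsum k, hz]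
  rw [map_add, hA', smul_sub]
  abel

/-- A module `M` with commuting operators `T i`, together with its reduction `V` modulo `ϖ`. -/
structure KoszulReduction {n : ℕ} (ϖ : O) (T : Fin n → M →ₗ[O] M) {V : Type*} [AddCommGroup V]
    (S : Fin n → V →+ V) (ρ : M →+ V) : Prop where
  comm : ∀ i j v, T i (T j v) = T j (T i v)
  surj : Function.Surjective ρ
  ker : ∀ v, ρ v = 0 → ∃ w, v = ϖ • w
  map_smul : ∀ v, ρ (ϖ • v) = 0
  map_op : ∀ i v, ρ (T i v) = S i (ρ v)
  torsionFree : ∀ v : M, ϖ • v = 0 → v = 0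
  precomplete : AdicPrecomplete ϖ M
  separated : AdicSeparated ϖ M
  exact_reduction : ∀ ω : Finset (Fin n) → V, koszul S ω = 0 → ω Finset.univ = 0 →
    ∃ η, ω = koszul S η

namespace KoszulReduction

variable {n : ℕ} {T : Fin n → M →ₗ[O] M} {V : Type*} [AddCommGroup V]
    {S : Fin n → V →+ V} {ρ : M →+ V}

/-- The Koszul differential of the operators `T i`. -/
abbrev diff (T : Fin n → M →ₗ[O] M) : (Finset (Fin n) → M) →+ (Finset (Fin n) → M) :=
  koszul fun i => (T i).toAddMonoidHom

theorem diff_smul (T : Fin n → M →ₗ[O] M) (c : O) (ω : Finset (Fin n) → M) :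
    diff T (c • ω) = c • diff T ω := by
  funext t
  simp only [koszul_apply, Pi.smul_apply, Finset.smul_sum]
  exact Finset.sum_congr rfl fun i _ =>
    (congrArg _ ((T i).map_smul c _)).trans (smul_comm _ _ _)

theorem map_diff (h : KoszulReduction ϖ T S ρ) (ω : Finset (Fin n) → M) (t : Finset (Fin n)) :
    ρ (diff T ω t) = koszul S (fun s => ρ (ω s)) t :=
  koszul_map ρ h.map_op ω t

/-- Exactness of the reduction is applied and the primitive lifted arbitrarily. Both hypotheses are
congruences modulo ϖ rather than equalities; the proof of independence needs this generality. -/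
theorem exists_approx (h : KoszulReduction ϖ T S ρ) {ω : Finset (Fin n) → M}
    (hω : ∀ t, ρ (diff T ω t) = 0) (htop : ρ (ω Finset.univ) = 0) :
    ∃ η ω', ω = diff T η + ϖ • ω' := by
  obtain ⟨η', hη'⟩ := h.exact_reduction (fun t => ρ (ω t))
    (funext fun t => by rw [← h.map_diff]; exact hω t) htop
  choose η hη using fun t => h.surj (η' t)
  obtain rfl : (fun t => ρ (η t)) = η' := funext hη
  choose ω' hω' using fun t => h.ker (ω t - diff T η t) (by
    rw [map_sub, h.map_diff, ← hη', sub_self])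
  exact ⟨η, ω', funext fun t => by
    rw [Pi.add_apply, Pi.smul_apply, ← hω' t, add_sub_cancel]⟩

theorem exact (h : KoszulReduction ϖ T S ρ) {ω : Finset (Fin n) → M} (hω : diff T ω = 0)
    (htop : ω Finset.univ = 0) : ∃ η, ω = diff T η := by
  refine exists_preimage_of_approx h.precomplete.pi h.separated.pi (diff T)
    (diff_smul T ϖ) {ω | diff T ω = 0 ∧ ω Finset.univ = 0} ?_ ⟨hω, htop⟩
  rintro ω ⟨hω, htop⟩
  obtain ⟨η, ω', hω'⟩ := h.exists_approx (ω := ω) (fun t => by rw [hω, Pi.zero_apply, map_zero])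
    (by rw [htop, map_zero])
  -- Removing degree n-1 from η and degree n from ω' makes both terms vanish at `univ`, as ω does
  -- there, and alters nothing in other degrees. The remainder then has zero top coefficient and is
  -- closed by torsion-freeness, so the approximation can be iterated.
  have key : ∀ t : Finset (Fin n), t.card ≠ n →
      diff T (fun s => if s.card + 1 ≠ n then η s else 0) t = diff T η t := fun t ht => by
    rw [diff, koszul_filter_card _ (fun c => c ≠ n), if_pos ht]
  refine ⟨fun s => if s.card + 1 ≠ n then η s else 0, fun t => if t.card ≠ n then ω' t else 0,
    ?_, ?_⟩
  · have hc : ω = diff T (fun s => if s.card + 1 ≠ n then η s else 0)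
        + ϖ • fun t => if t.card ≠ n then ω' t else 0 := ?_
    · refine ⟨?_, by simp⟩
      have h1 := congrArg (diff T) hc
      rw [hω, map_add, koszul_koszul h.comm, zero_add, diff_smul] at h1
      exact funext fun t => h.torsionFree _ (congrFun h1 t).symm
    · funext t
      rw [Pi.add_apply, Pi.smul_apply]
      by_cases ht : t.card = n
      · have hu : t = Finset.univ := (Finset.card_eq_iff_eq_univ t).1 (by simpa using ht)
        rw [diff, koszul_filter_card _ (fun c => c ≠ n), if_neg (by simpa using ht), hu, htop]
        simp
      · rw [key t ht, if_pos ht]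
        exact congrFun hω' t
  · funext t
    rw [Pi.add_apply, Pi.smul_apply]
    by_cases ht : t.card = n
    · have hu : t = Finset.univ := (Finset.card_eq_iff_eq_univ t).1 (by simpa using ht)
      rw [diff, koszul_filter_card _ (fun c => c ≠ n), if_neg (by simpa using ht), hu, htop]
      simp
    · rw [key t ht, if_pos ht]
      exact congrFun hω' t

variable {κ : Type*} [Fintype κ]

/-- A Nakayama argument in a complete setting: generators of the top cohomology modulo ϖ generate
it, by approximating the coefficients and the primitive simultaneously. -/
theorem exists_eq_sum_add_diff_univ (h : KoszulReduction ϖ T S ρ) (hO : AdicPrecomplete ϖ O)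
    (x : κ → M) (hx : ∀ v : V, ∃ (c : κ → O) (w : Finset (Fin n) → V),
      v = ρ (∑ i, c i • x i) + koszul S w Finset.univ) (v : M) :
    ∃ (c : κ → O) (w : Finset (Fin n) → M), v = ∑ i, c i • x i + diff T w Finset.univ := by
  let A : (κ → O) × (Finset (Fin n) → M) →+ M :=
    { toFun := fun z => ∑ i, z.1 i • x i + diff T z.2 Finset.univ
      map_zero' := by simp
      map_add' := fun z z' => by
        simp only [Prod.fst_add, Prod.snd_add, map_add, Pi.add_apply, add_smul,
          Finset.sum_add_distrib]
        abel }
  obtain ⟨⟨c, w⟩, hcw⟩ := exists_preimage_of_approx (hO.pi.prod h.precomplete.pi) h.separated A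
    (fun z => by
      change ∑ i, (ϖ • z.1) i • x i + diff T (ϖ • z.2) Finset.univ = ϖ • (_ + _)
      rw [diff_smul, smul_add, Finset.smul_sum]
      simp [mul_smul]) Set.univ (fun v _ => by
      obtain ⟨c, w, hw⟩ := hx (ρ v)
      choose w' hw' using fun t => h.surj (w t)
      obtain rfl : (fun t => ρ (w' t)) = w := funext hw'
      obtain ⟨y, hy⟩ := h.ker (v - A (c, w')) (by
        change ρ (v - (_ + _)) = 0
        rw [map_sub, map_add, h.map_diff, hw, sub_self])
      exact ⟨(c, w'), y, trivial, by rw [← hy, add_sub_cancel]⟩) (Set.mem_univ v)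
  exact ⟨c, w, hcw⟩

/-- Descent: independence modulo ϖ makes every coefficient of a relation divisible by ϖ, and the
quotients satisfy a relation of the same kind. All coefficients are thus divisible by every power of
ϖ. -/
theorem eq_zero_of_sum_eq_diff_univ (h : KoszulReduction ϖ T S ρ) (hO : AdicSeparated ϖ O)
    (x : κ → M) (hx : ∀ (c : κ → O) (w : Finset (Fin n) → V),
      ρ (∑ i, c i • x i) = koszul S w Finset.univ → ∀ i, ∃ c', c i = ϖ * c')
    {c : κ → O} {w : Finset (Fin n) → M} (hc : ∑ i, c i • x i = diff T w Finset.univ) :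
    c = 0 := by
  have step : ∀ (c : κ → O) (w : Finset (Fin n) → M), ∑ i, c i • x i = diff T w Finset.univ →
      ∃ (c' : κ → O) (w' : Finset (Fin n) → M), c = ϖ • c' ∧
        ∑ i, c' i • x i = diff T w' Finset.univ := by
    intro c w hc
    choose c' hc' using hx c (fun t => ρ (w t)) (by rw [hc, h.map_diff])
    have hcc : c = ϖ • c' := funext hc'
    have hsum : ∑ i, c i • x i = ϖ • ∑ i, c' i • x i := by
      rw [Finset.smul_sum]
      exact Finset.sum_congr rfl fun i _ => by rw [hc' i, mul_smul]
    -- Only degree n-1 contributes to the top coefficient. This part of w is closed modulo ϖ, so it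
    -- equals dη + ϖ w'; applying d removes dη, and ϖ can be cancelled from the relation.
    set w₁ : Finset (Fin n) → M := fun s => if s.card + 1 = n then w s else 0 with hw₁
    have hdw : ∀ t, diff T w₁ t = if t.card = n then diff T w t else 0 := fun t =>
      koszul_filter_card _ (fun c => c = n) w t
    obtain ⟨η, w', hw'⟩ := h.exists_approx (ω := w₁) (fun t => by
      rw [hdw]
      split_ifs with ht
      · have hu : t = Finset.univ := (Finset.card_eq_iff_eq_univ t).1 (by simpa using ht)
        rw [hu, ← hc, hsum, h.map_smul]
      · exact map_zero ρ) (by simp [hw₁])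
    refine ⟨c', w', hcc, sub_eq_zero.1 (h.torsionFree _ ?_)⟩
    have h1 : diff T w₁ Finset.univ = ϖ • diff T w' Finset.univ := by
      rw [hw', map_add, koszul_koszul h.comm, zero_add, diff_smul, Pi.smul_apply]
    rw [smul_sub, ← hsum, ← h1, hdw, if_pos (by simp), hc, sub_self]
  refine hO.pi c fun N => ?_
  suffices H : ∃ (c' : κ → O) (w' : Finset (Fin n) → M), c = ϖ ^ N • c' ∧
      ∑ i, c' i • x i = diff T w' Finset.univ by
    obtain ⟨c', _, hc', _⟩ := H
    exact ⟨c', hc'⟩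
  induction N with
  | zero => exact ⟨c, w, by simp, hc⟩
  | succ N ih =>
    obtain ⟨c', w', hc', hw'⟩ := ih
    obtain ⟨c'', w'', hc'', hw''⟩ := step c' w' hw'
    exact ⟨c'', w'', by rw [hc', hc'', smul_smul, pow_succ], hw''⟩

end KoszulReduction

end Lifting

/-! ### Dimension of the quotient by a homogeneous regular sequence. -/

section Hilbert

open MvPolynomial

variable {F : Type*} [Field F] {n : ℕ}

/-- The ideal generated by the first `m` members of a family. -/
def initialIdeal {R : Type*} [CommRing R] (g : Fin n → R) (m : ℕ) : Ideal R :=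
  Ideal.span (g '' {j | j.val < m})

theorem mem_of_isWeaklyRegular {R : Type*} [CommRing R] {g : Fin n → R}
    (h : RingTheory.Sequence.IsWeaklyRegular R (List.ofFn g)) (i : Fin n) {v : R}
    (hv : g i * v ∈ initialIdeal g i) : v ∈ initialIdeal g i := by
  have h1 := h.regular_mod_prev i (by simp)
  rw [isSMulRegular_quotient_iff_mem_of_smul_mem] at h1
  have h2 : Ideal.ofList ((List.ofFn g).take i) • (⊤ : Submodule R R) = initialIdeal g i := by
    rw [Ideal.smul_eq_mul, Ideal.mul_top, initialIdeal, Ideal.ofList]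
    congr 1
    ext x
    simp only [Set.mem_ofPred_eq, List.mem_take_iff_getElem, Set.mem_image]
    constructor
    · rintro ⟨j, hj, rfl⟩
      simp only [List.length_ofFn, lt_min_iff] at hj
      exact ⟨⟨j, hj.2⟩, hj.1, by simp⟩
    · rintro ⟨j, hj, rfl⟩
      exact ⟨j, by simpa using hj, by simp⟩
  rw [h2] at h1
  exact h1 v (by simpa using hv)

theorem mem_initialIdeal_succ {R : Type*} [CommRing R] {g : Fin n → R} {m : ℕ} (hm : m < n)
    {x : R} : x ∈ initialIdeal g (m + 1) ↔ ∃ a, ∃ z ∈ initialIdeal g m, x = a * g ⟨m, hm⟩ + z := by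
  have : g '' {j | j.val < m + 1} = insert (g ⟨m, hm⟩) (g '' {j | j.val < m}) := by
    rw [← Set.image_insert_eq]
    congr 1
    ext j
    simp only [Set.mem_ofPred_eq, Set.mem_insert_iff, Fin.ext_iff]
    omega
  rw [initialIdeal, this, Ideal.mem_span_insert, initialIdeal]

/-- The part of degree at most `k` of a polynomial. -/
noncomputable def truncDegree (k : ℕ) : MvPolynomial (Fin n) F →ₗ[F] MvPolynomial (Fin n) F :=
  ∑ j ∈ Finset.range (k + 1), homogeneousComponent j

theorem coeff_truncDegree (k : ℕ) (v : MvPolynomial (Fin n) F) (u : Fin n →₀ ℕ) :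
    coeff u (truncDegree k v) = if u.degree ≤ k then coeff u v else 0 := by
  simp only [truncDegree, LinearMap.sum_apply, coeff_sum, coeff_homogeneousComponent]
  rw [Finset.sum_ite_eq]
  simp

theorem truncDegree_eq_self {k : ℕ} {v : MvPolynomial (Fin n) F}
    (hv : v ∈ restrictTotalDegree (Fin n) F k) : truncDegree k v = v := by
  ext u
  rw [coeff_truncDegree]
  split_ifs with h
  · rfl
  · by_contra hne
    exact h ((le_totalDegree (mem_support_iff.2 (Ne.symm hne))).trans
      ((mem_restrictTotalDegree _ _ _).1 hv))

theorem truncDegree_mem (k : ℕ) (v : MvPolynomial (Fin n) F) :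
    truncDegree k v ∈ restrictTotalDegree (Fin n) F k := by
  rw [mem_restrictTotalDegree, totalDegree]
  refine Finset.sup_le fun u hu => ?_
  rw [mem_support_iff, coeff_truncDegree] at hu
  by_contra h
  exact hu (if_neg h)

theorem truncDegree_mul {e : ℕ} {g : MvPolynomial (Fin n) F} (hg : g.IsHomogeneous e) (k : ℕ)
    (v : MvPolynomial (Fin n) F) : truncDegree (k + e) (g * v) = g * truncDegree k v := by
  ext u
  rw [coeff_truncDegree, coeff_mul, coeff_mul,
    show (if u.degree ≤ k + e then ∑ x ∈ Finset.HasAntidiagonal.antidiagonal u,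
      coeff x.1 g * coeff x.2 v else 0) = ∑ x ∈ Finset.HasAntidiagonal.antidiagonal u,
      if u.degree ≤ k + e then coeff x.1 g * coeff x.2 v else 0 by split_ifs <;> simp]
  refine Finset.sum_congr rfl fun x hx => ?_
  have hx : x.1 + x.2 = u := Finset.HasAntidiagonal.mem_antidiagonal.1 hx
  by_cases hd : x.1.degree = e
  · have : u.degree ≤ k + e ↔ x.2.degree ≤ k := by rw [← hx, map_add]; omega
    simp only [this, coeff_truncDegree]
    split_ifs <;> simp
  · simp [hg.coeff_eq_zero hd]

theorem truncDegree_mul_of_lt {e : ℕ} {g : MvPolynomial (Fin n) F} (hg : g.IsHomogeneous e)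
    {k : ℕ} (hk : k < e) (v : MvPolynomial (Fin n) F) : truncDegree k (g * v) = 0 := by
  ext u
  rw [coeff_truncDegree, coeff_zero]
  split_ifs with h
  · rw [coeff_mul]
    refine Finset.sum_eq_zero fun x hx => ?_
    rw [hg.coeff_eq_zero, zero_mul]
    have := Finset.HasAntidiagonal.mem_antidiagonal.1 hx
    rw [← this, map_add] at h
    omega
  · rfl

variable {g : Fin n → MvPolynomial (Fin n) F} {e : ℕ}

/-- By homogeneity, truncating a multiple of a generator amounts to truncating the cofactor in
degree lower by e. -/
theorem truncDegree_mem_initialIdeal (hg : ∀ i, (g i).IsHomogeneous e) {m : ℕ} (hm : m ≤ n)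
    (k : ℕ) {v : MvPolynomial (Fin n) F} (hv : v ∈ initialIdeal g m) :
    truncDegree k v ∈ initialIdeal g m := by
  induction m generalizing v with
  | zero =>
    have h : initialIdeal g 0 = ⊥ := by simp [initialIdeal]
    rw [h, Ideal.mem_bot] at hv
    rw [hv, map_zero]
    exact zero_mem _
  | succ m ih =>
    obtain ⟨a, z, hz, rfl⟩ := (mem_initialIdeal_succ hm).1 hv
    rw [map_add, mul_comm]
    by_cases hk : k < e
    · rw [truncDegree_mul_of_lt (hg _) hk, zero_add]
      exact (mem_initialIdeal_succ hm).2 ⟨0, _, ih (by omega) hz, by simp⟩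
    · obtain ⟨k, rfl⟩ := Nat.exists_eq_add_of_le' (not_lt.1 hk)
      rw [truncDegree_mul (hg _), mul_comm]
      exact (mem_initialIdeal_succ hm).2 ⟨_, _, ih (by omega) hz, rfl⟩

/-- The elements of degree at most `k` of the ideal of the first `m` members. -/
noncomputable def idealDegreeLE (g : Fin n → MvPolynomial (Fin n) F) (m k : ℕ) :
    Submodule F (MvPolynomial (Fin n) F) :=
  (initialIdeal g m).restrictScalars F ⊓ restrictTotalDegree (Fin n) F k

theorem setOf_sum_le_eq (n k : ℕ) : {u : Fin n →₀ ℕ | (u.sum fun _ e => e) ≤ k} =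
    ((Finset.range (k + 1)).biUnion fun j =>
      Finset.finsuppAntidiag (Finset.univ : Finset (Fin n)) j : Finset (Fin n →₀ ℕ)) := by
  ext u
  simp only [Set.mem_ofPred_eq, Finset.coe_biUnion, Set.mem_iUnion, Finset.mem_coe,
    Finset.mem_finsuppAntidiag, Finset.mem_range, Finset.subset_univ, and_true, exists_prop]
  rw [Finsupp.sum_fintype _ _ fun _ => rfl]
  constructor
  · intro h; exact ⟨_, Nat.lt_succ_of_le h, rfl⟩
  · rintro ⟨j, hj, h⟩; rw [h]; omega

/-- Stars and bars in each degree, then the hockey-stick identity. -/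
theorem card_setOf_sum_le (n k : ℕ) :
    Nat.card {u : Fin n →₀ ℕ | (u.sum fun _ e => e) ≤ k} = (n + k).choose n := by
  rw [setOf_sum_le_eq, Nat.card_eq_card_toFinset, Finset.toFinset_coe, Finset.card_biUnion]
  · simp only [Finset.card_finsuppAntidiag_nat_eq_multichoose, Finset.card_univ, Fintype.card_fin]
    have h : ∑ j ∈ Finset.range (k + 1), n.multichoose j = (n + 1).multichoose k := by
      induction k with
      | zero => simp
      | succ k ih => rw [Finset.sum_range_succ, ih, Nat.multichoose_succ_succ, add_comm]
    rw [h, Nat.multichoose_eq, Nat.add_right_comm, Nat.add_sub_cancel, Nat.choose_symm_add]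
  · intro i _ j _ hij
    rw [Function.onFun, Finset.disjoint_left]
    intro u hu hu'
    rw [Finset.mem_finsuppAntidiag] at hu hu'
    exact hij (hu.1.symm.trans hu'.1)

instance (k : ℕ) : FiniteDimensional F (restrictTotalDegree (Fin n) F k) := by
  have : Finite {u : Fin n →₀ ℕ | (u.sum fun _ e => e) ≤ k} := by
    rw [setOf_sum_le_eq]; infer_instance
  exact Module.Finite.of_basis (basisRestrictSupport F _)

instance (m k : ℕ) : FiniteDimensional F (idealDegreeLE g m k) :=
  Submodule.finiteDimensional_of_le inf_le_right

theorem mul_mem_restrictTotalDegree (hg : ∀ i, (g i).IsHomogeneous e) (i : Fin n) {k : ℕ}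
    {v : MvPolynomial (Fin n) F} (hv : v ∈ restrictTotalDegree (Fin n) F k) :
    g i * v ∈ restrictTotalDegree (Fin n) F (k + e) := by
  rw [mem_restrictTotalDegree] at hv ⊢
  have := totalDegree_mul (g i) v
  have := (hg i).totalDegree_le
  omega

/-- Rank count in the exact sequence 0 → I_m(k) → I_m(k+e) × P(k) → I_(m+1)(k+e) → 0, where (k)
means degree at most k, P is the polynomial ring and the maps are v ↦ (-gv, v) and (x, v) ↦ x + gv.
Regularity of g identifies the kernel; truncation gives surjectivity within the degree bounds. -/
theorem finrank_idealDegreeLE_succ (hg : ∀ i, (g i).IsHomogeneous e) {m : ℕ} (hm : m < n)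
    (hreg : ∀ v, g ⟨m, hm⟩ * v ∈ initialIdeal g m → v ∈ initialIdeal g m) (k : ℕ) :
    Module.finrank F (idealDegreeLE g (m + 1) (k + e)) + Module.finrank F (idealDegreeLE g m k)
      = Module.finrank F (idealDegreeLE g m (k + e))
        + Module.finrank F (restrictTotalDegree (Fin n) F k) := by
  set a : MvPolynomial (Fin n) F := g ⟨m, hm⟩ with ha
  let ψ : idealDegreeLE g m (k + e) × restrictTotalDegree (Fin n) F k →ₗ[F]
      MvPolynomial (Fin n) F :=
    (Submodule.subtype _).coprod (LinearMap.mulLeft F a ∘ₗ Submodule.subtype _)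
  have hψ : ∀ x, ψ x = (x.1 : MvPolynomial (Fin n) F) + a * x.2 := fun x => rfl
  have hrange : LinearMap.range ψ = idealDegreeLE g (m + 1) (k + e) := by
    ext f
    simp only [LinearMap.mem_range, hψ]
    constructor
    · rintro ⟨⟨⟨x, hx⟩, v, hv⟩, rfl⟩
      refine ⟨(mem_initialIdeal_succ hm).2 ⟨v, x, hx.1, ?_⟩, ?_⟩
      · simp only [← ha]; ring
      · exact add_mem hx.2 (mul_mem_restrictTotalDegree hg _ hv)
    · rintro ⟨hf1, hf2⟩
      obtain ⟨v, z, hz, rfl⟩ := (mem_initialIdeal_succ hm).1 hf1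
      refine ⟨⟨⟨truncDegree (k + e) z, truncDegree_mem_initialIdeal hg hm.le _ hz,
        truncDegree_mem _ _⟩, truncDegree k v, truncDegree_mem _ _⟩, ?_⟩
      simp only
      rw [ha, ← truncDegree_mul (hg _), ← map_add, add_comm z, mul_comm (g _),
        truncDegree_eq_self hf2]
  let χ : idealDegreeLE g m k →ₗ[F] idealDegreeLE g m (k + e) × restrictTotalDegree (Fin n) F k :=
    LinearMap.prod
      (LinearMap.codRestrict _ (-(LinearMap.mulLeft F a ∘ₗ Submodule.subtype _)) fun v =>
        neg_mem ⟨Ideal.mul_mem_left _ _ v.2.1, mul_mem_restrictTotalDegree hg _ v.2.2⟩)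
      (Submodule.inclusion inf_le_right)
  have hker : LinearMap.range χ = LinearMap.ker ψ := by
    ext ⟨⟨x, hx⟩, v, hv⟩
    rw [LinearMap.mem_range, LinearMap.mem_ker, hψ]
    constructor
    · rintro ⟨⟨w, hw⟩, h⟩
      obtain ⟨h1, h2⟩ := Prod.ext_iff.1 h
      have h1' : -(a * w) = x := congrArg Subtype.val h1
      have h2' : w = v := congrArg Subtype.val h2
      simp only
      rw [← h1', h2', neg_add_cancel]
    · intro h
      have h' : x = -(a * v) := eq_neg_of_add_eq_zero_left h
      refine ⟨⟨v, hreg v ?_, hv⟩, ?_⟩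
      · have : a * v = -x := by rw [h', neg_neg]
        rw [this]
        exact neg_mem hx.1
      · refine Prod.ext (Subtype.ext ?_) rfl
        exact h'.symm
  have hinj : Function.Injective χ := fun v w h =>
    Subtype.ext (congrArg (fun y => (y.2 : MvPolynomial (Fin n) F)) h)
  rw [← hrange, ← LinearMap.finrank_range_of_inj hinj, hker,
    LinearMap.finrank_range_add_finrank_ker, Module.finrank_prod]

theorem idealDegreeLE_succ_of_lt (hg : ∀ i, (g i).IsHomogeneous e) {m k : ℕ} (hm : m < n)
    (hk : k < e) : idealDegreeLE g (m + 1) k = idealDegreeLE g m k := by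
  refine le_antisymm ?_ (inf_le_inf_right _ fun x hx => ?_)
  · rintro f ⟨hf1, hf2⟩
    obtain ⟨v, z, hz, rfl⟩ := (mem_initialIdeal_succ hm).1 hf1
    refine ⟨?_, hf2⟩
    rw [← truncDegree_eq_self hf2, map_add, mul_comm, truncDegree_mul_of_lt (hg _) hk, zero_add]
    exact truncDegree_mem_initialIdeal hg hm.le _ hz
  · exact (mem_initialIdeal_succ hm).2 ⟨0, x, hx, by simp⟩

theorem finrank_restrictTotalDegree (k : ℕ) :
    Module.finrank F (restrictTotalDegree (Fin n) F k) = (n + k).choose n := by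
  rw [← card_setOf_sum_le]
  exact Module.finrank_eq_nat_card_basis (basisRestrictSupport F _)

/-- The generating series of the dimensions of the parts of degree at most `k` of the quotient by
the first `m` members. -/
noncomputable def hilbertSeries (g : Fin n → MvPolynomial (Fin n) F) (m : ℕ) : PowerSeries ℤ :=
  PowerSeries.mk fun k => (Module.finrank F (restrictTotalDegree (Fin n) F k) : ℤ)
    - Module.finrank F (idealDegreeLE g m k)

theorem hilbertSeries_eq (hg : ∀ i, (g i).IsHomogeneous e)
    (hreg : ∀ i v, g i * v ∈ initialIdeal g i.val → v ∈ initialIdeal g i.val) {m : ℕ} (hm : m ≤ n) :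
    hilbertSeries g m = (PowerSeries.mk fun k => ((n + k).choose n : ℤ))
      * (1 - PowerSeries.X ^ e) ^ m := by
  induction m with
  | zero =>
    rw [pow_zero, mul_one, hilbertSeries]
    congr 1
    funext k
    have : idealDegreeLE g 0 k = ⊥ := by
      simp [idealDegreeLE, initialIdeal]
    rw [this, finrank_restrictTotalDegree, finrank_bot]
    simp
  | succ m ih =>
    rw [pow_succ, ← mul_assoc, ← ih (by omega), mul_sub, mul_one]
    ext k
    rw [map_sub, PowerSeries.coeff_mul_X_pow']
    simp only [hilbertSeries, PowerSeries.coeff_mk]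
    split_ifs with hk
    · obtain ⟨k, rfl⟩ := Nat.exists_eq_add_of_le' hk
      have := finrank_idealDegreeLE_succ hg hm (hreg ⟨m, hm⟩) k
      rw [Nat.add_sub_cancel]
      omega
    · rw [idealDegreeLE_succ_of_lt hg hm (by omega)]
      ring

/-- The series is G(t)/(1-t) with G = (1 + t + ⋯ + t^(e-1))^n, so its coefficients are partial sums
of those of G and eventually equal G(1) = e^n. -/
theorem hilbertSeries_stable (hg : ∀ i, (g i).IsHomogeneous e)
    (hreg : ∀ i v, g i * v ∈ initialIdeal g i.val → v ∈ initialIdeal g i.val) :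
    ∃ N, ∀ k ≥ N, (Module.finrank F (restrictTotalDegree (Fin n) F k) : ℤ)
      - Module.finrank F (idealDegreeLE g n k) = (e : ℤ) ^ n := by
  set G : Polynomial ℤ := (∑ i ∈ Finset.range e, Polynomial.X ^ i) ^ n with hG
  have h1 : hilbertSeries g n = PowerSeries.mk 1 * (G : PowerSeries ℤ) := by
    rw [hilbertSeries_eq hg hreg le_rfl]
    have h2 : (1 - PowerSeries.X ^ e : PowerSeries ℤ) =
        (1 - PowerSeries.X) * ((∑ i ∈ Finset.range e, Polynomial.X ^ i : Polynomial ℤ) :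
          PowerSeries ℤ) := by
      have h := congrArg (Polynomial.coeToPowerSeries.ringHom (R := ℤ))
        (mul_neg_geom_sum (Polynomial.X : Polynomial ℤ) e)
      simp only [map_mul, map_sub, map_one, map_pow,
        Polynomial.coeToPowerSeries.ringHom_apply, Polynomial.coe_X] at h
      exact h.symm
    have h3 := PowerSeries.mk_add_choose_mul_one_sub_pow_eq_one ℤ n
    have h4 := PowerSeries.mk_one_mul_one_sub_eq_one ℤ
    have h5 : (PowerSeries.mk fun k => ((n + k).choose n : ℤ)) * (1 - PowerSeries.X) ^ n
        = PowerSeries.mk 1 := by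
      calc _ = (PowerSeries.mk fun k => ((n + k).choose n : ℤ)) * (1 - PowerSeries.X) ^ n
            * (PowerSeries.mk 1 * (1 - PowerSeries.X)) := by rw [h4, mul_one]
        _ = (PowerSeries.mk fun k => ((n + k).choose n : ℤ)) * (1 - PowerSeries.X) ^ (n + 1)
            * PowerSeries.mk 1 := by ring
        _ = _ := by rw [h3, one_mul]
    rw [h2, mul_pow, ← mul_assoc, h5, hG, Polynomial.coe_pow]
  refine ⟨G.natDegree, fun k hk => ?_⟩
  have h2 := congrArg (PowerSeries.coeff k) h1
  rw [hilbertSeries, PowerSeries.coeff_mk] at h2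
  rw [h2, mul_comm, PowerSeries.coeff_mul, Finset.Nat.sum_antidiagonal_eq_sum_range_succ_mk]
  have h3 : G.eval 1 = (e : ℤ) ^ n := by
    rw [hG, Polynomial.eval_pow, Polynomial.eval_finsetSum]; simp
  rw [← h3, Polynomial.eval_eq_sum_range' (Nat.lt_succ_of_le hk)]
  refine Finset.sum_congr rfl fun i _ => ?_
  simp

/-- The images of the polynomials of bounded degree form an increasing chain exhausting the
quotient; its dimension is eventually e^n, so the chain is stationary. -/
theorem finrank_quotient_of_regular (hg : ∀ i, (g i).IsHomogeneous e)
    (hreg : ∀ i v, g i * v ∈ initialIdeal g i.val → v ∈ initialIdeal g i.val) :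
    Module.Finite F (MvPolynomial (Fin n) F ⧸ Ideal.span (Set.range g)) ∧
    Module.finrank F (MvPolynomial (Fin n) F ⧸ Ideal.span (Set.range g)) = e ^ n := by
  obtain ⟨N, hN⟩ := hilbertSeries_stable hg hreg
  have hI : initialIdeal g n = Ideal.span (Set.range g) := by
    rw [initialIdeal, ← Set.image_univ]
    congr 2
    ext j; simp
  set q := (Ideal.Quotient.mkₐ F (Ideal.span (Set.range g))).toLinearMap with hq
  have hdim : ∀ k ≥ N, Module.finrank F ((restrictTotalDegree (Fin n) F k).map q) = e ^ n := by
    intro k hk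
    set P := restrictTotalDegree (Fin n) F k
    have h1 : LinearMap.range (q ∘ₗ P.subtype) = P.map q := by
      rw [LinearMap.range_comp, Submodule.range_subtype]
    have h2 : (LinearMap.ker (q ∘ₗ P.subtype)).map P.subtype = idealDegreeLE g n k := by
      ext x
      simp only [Submodule.mem_map, LinearMap.mem_ker, idealDegreeLE, Submodule.mem_inf,
        Submodule.restrictScalars_mem, hI]
      constructor
      · rintro ⟨y, hy, rfl⟩
        exact ⟨Ideal.Quotient.eq_zero_iff_mem.1 hy, y.2⟩
      · rintro ⟨hx, hxP⟩
        exact ⟨⟨x, hxP⟩, Ideal.Quotient.eq_zero_iff_mem.2 hx, rfl⟩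
    have h3 := LinearMap.finrank_range_add_finrank_ker (q ∘ₗ P.subtype)
    rw [h1, ← Submodule.finrank_map_subtype_eq, h2] at h3
    have h4 := hN k hk
    have h5 : (Module.finrank F (P.map q) : ℤ) = (e : ℤ) ^ n := by
      rw [← h4, ← h3]; push_cast; ring
    exact_mod_cast h5
  have hfin : ∀ k, FiniteDimensional F ((restrictTotalDegree (Fin n) F k).map q) := fun k =>
    inferInstance
  have htop : (restrictTotalDegree (Fin n) F N).map q = ⊤ := by
    refine eq_top_iff.2 fun x _ => ?_
    obtain ⟨v, rfl⟩ := Ideal.Quotient.mk_surjective x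
    have hle : (restrictTotalDegree (Fin n) F N).map q
        ≤ (restrictTotalDegree (Fin n) F (max N v.totalDegree)).map q :=
      Submodule.map_mono fun y hy => by
        rw [mem_restrictTotalDegree] at hy ⊢
        exact hy.trans (le_max_left _ _)
    rw [Submodule.eq_of_le_of_finrank_eq hle
      ((hdim N le_rfl).trans (hdim _ (le_max_left _ _)).symm)]
    exact ⟨v, (mem_restrictTotalDegree _ _ _).2 (le_max_right _ _), rfl⟩
  constructor
  · have := hfin N
    rw [htop] at this
    exact Module.finite_def.2 (Module.Finite.iff_fg.1 this)
  · rw [← hdim N le_rfl, htop, finrank_top]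

theorem leadingPartial_isHomogeneous (d : ℕ) (f : MvPolynomial (Fin n) F) (i : Fin n) :
    (leadingPartial d f i).IsHomogeneous (d - 1) :=
  (homogeneousComponent_isHomogeneous d f).pderiv

theorem exists_isMonomialBasis {d : ℕ} {f : MvPolynomial (Fin n) F}
    (hreg : RingTheory.Sequence.IsWeaklyRegular (MvPolynomial (Fin n) F)
      (List.ofFn (leadingPartial d f))) :
    ∃ μ : Fin ((d - 1) ^ n) → Fin n →₀ ℕ, IsMonomialBasis d f μ := by
  obtain ⟨hfin, hrank⟩ := finrank_quotient_of_regular (leadingPartial_isHomogeneous d f)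
    fun i v => mem_of_isWeaklyRegular hreg i
  have hfin' : Module.Finite F (JacobianRing d f) := hfin
  have hrank' : Module.finrank F (JacobianRing d f) = (d - 1) ^ n := hrank
  -- Monomials span the quotient, so a maximal independent subfamily is a basis, whose size is
  -- already known.
  obtain ⟨κ, b, -, hspan, hli⟩ := exists_linearIndependent' F
    (fun u : Fin n →₀ ℕ => (Ideal.Quotient.mk (Ideal.span (Set.range (leadingPartial d f)))
      (monomial u 1) : JacobianRing d f))
  have htop : Submodule.span F (Set.range (fun u : Fin n →₀ ℕ =>
      (Ideal.Quotient.mk (Ideal.span (Set.range (leadingPartial d f)))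
        (monomial u 1) : JacobianRing d f))) = ⊤ := by
    refine eq_top_iff.2 fun x _ => ?_
    obtain ⟨v, rfl⟩ := Ideal.Quotient.mk_surjective x
    induction v using MvPolynomial.induction_on' with
    | monomial u c =>
      have h : (monomial u c : MvPolynomial (Fin n) F) = c • monomial u 1 := by
        rw [smul_monomial, smul_eq_mul, mul_one]
      rw [h]
      exact Submodule.smul_mem _ c (Submodule.subset_span (Set.mem_range_self u))
    | add p q hp hq =>
      rw [map_add]
      exact add_mem (hp trivial) (hq trivial)
  rw [htop] at hspan
  let B := Module.Basis.mk hli hspan.ge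
  have : Finite κ := Module.Finite.finite_basis B
  have hc : Nat.card κ = (d - 1) ^ n := by
    rw [← hrank', Module.finrank_eq_nat_card_basis B]
  let σ : Fin ((d - 1) ^ n) ≃ κ := (Finite.equivFinOfCardEq hc).symm
  refine ⟨fun i => b (σ i), hli.comp σ σ.injective, ?_⟩
  rw [← hspan]
  congr 1
  exact σ.surjective.range_comp ((fun u : Fin n →₀ ℕ =>
    (Ideal.Quotient.mk (Ideal.span (Set.range (leadingPartial d f)))
      (monomial u 1) : JacobianRing d f)) ∘ b)

end Hilbert

/-! ### Extension of scalars from the finite field to the residue field. -/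

section BaseChange

open MvPolynomial

theorem mem_span_image_iff_exists_sum {R ι : Type*} [CommRing R] (g : ι → R) (s : Finset ι)
    (x : R) : x ∈ Ideal.span (g '' s) ↔ ∃ w : ι → R, x = ∑ i ∈ s, g i * w i := by
  classical
  rw [Ideal.span, Submodule.mem_span_image_finset_iff_exists_fun]
  constructor
  · rintro ⟨c, rfl⟩
    refine ⟨fun i => if h : i ∈ s then c ⟨i, h⟩ else 0, ?_⟩
    rw [← Finset.sum_attach s]
    refine Finset.sum_congr rfl fun i _ => ?_
    simp only [Finset.coe_mem, dif_pos, smul_eq_mul, mul_comm]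
  · rintro ⟨w, rfl⟩
    refine ⟨fun i => w i, ?_⟩
    rw [← Finset.sum_attach s]
    refine Finset.sum_congr rfl fun i _ => ?_
    rw [smul_eq_mul, mul_comm]

variable {F k : Type*} [Field F] [Field k] [Algebra F k] {n : ℕ}

-- The polynomial ring over k is the base change of the one over F along a field extension, hence
-- flat, and flat extensions preserve weak regularity.
attribute [local instance] MvPolynomial.algebraMvPolynomial in
theorem isWeaklyRegular_map {g : Fin n → MvPolynomial (Fin n) F}
    (h : RingTheory.Sequence.IsWeaklyRegular (MvPolynomial (Fin n) F) (List.ofFn g)) :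
    RingTheory.Sequence.IsWeaklyRegular (MvPolynomial (Fin n) k)
      (List.ofFn fun i => map (algebraMap F k) (g i)) := by
  have : Module.Flat (MvPolynomial (Fin n) F) (MvPolynomial (Fin n) k) :=
    Module.Flat.isBaseChange F (MvPolynomial (Fin n) F) k _
      (Algebra.IsPushout.out (R := F) (S := MvPolynomial (Fin n) F) (R' := k)
        (S' := MvPolynomial (Fin n) k))
  have h1 := h.of_flat (S := MvPolynomial (Fin n) k)
  rw [List.map_ofFn] at h1
  exact h1

theorem initialIdeal_eq_span {R : Type*} [CommRing R] (g : Fin n → R) (i : Fin n) :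
    initialIdeal g i = Ideal.span (g '' (Finset.univ.filter (· < i) : Finset (Fin n))) := by
  rw [initialIdeal]
  congr 2
  ext j
  simp

theorem isRegularFamily_mulLeft {g : Fin n → MvPolynomial (Fin n) F}
    (h : RingTheory.Sequence.IsWeaklyRegular (MvPolynomial (Fin n) F) (List.ofFn g))
    {c : k} (hc : c ≠ 0) :
    IsRegularFamily fun i => AddMonoidHom.mulLeft (C c * map (algebraMap F k) (g i)) := by
  rintro i v ⟨w, hw⟩
  have hu : (C c⁻¹ * C c : MvPolynomial (Fin n) k) = 1 := by
    rw [← C_mul, inv_mul_cancel₀ hc, C_1]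
  simp only [AddMonoidHom.coe_mulLeft] at hw ⊢
  have h1 : v ∈ initialIdeal (fun i => map (algebraMap F k) (g i)) i := by
    refine mem_of_isWeaklyRegular (isWeaklyRegular_map h) i ?_
    rw [initialIdeal_eq_span, mem_span_image_iff_exists_sum]
    refine ⟨w, ?_⟩
    calc _ = C c⁻¹ * (C c * map (algebraMap F k) (g i) * v) := by
          rw [← mul_assoc, ← mul_assoc, hu, one_mul]
      _ = _ := by
          rw [hw, Finset.mul_sum]
          refine Finset.sum_congr rfl fun j _ => ?_
          rw [← mul_assoc, ← mul_assoc, hu, one_mul]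
  rw [initialIdeal_eq_span, mem_span_image_iff_exists_sum] at h1
  obtain ⟨w, hw⟩ := h1
  refine ⟨fun j => C c⁻¹ * w j, hw.trans (Finset.sum_congr rfl fun j _ => ?_)⟩
  calc _ = (C c⁻¹ * C c) * (map (algebraMap F k) (g j) * w j) := by rw [hu, one_mul]
    _ = _ := by ring

theorem exists_coeff_eq_map (ℓ : k →ₗ[F] F) (v : MvPolynomial (Fin n) k) :
    ∃ v' : MvPolynomial (Fin n) F, ∀ u, coeff u v' = ℓ (coeff u v) := by
  classical
  refine ⟨∑ u ∈ v.support, monomial u (ℓ (coeff u v)), fun u => ?_⟩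
  simp only [coeff_sum, coeff_monomial, Finset.sum_ite_eq', mem_support_iff]
  split_ifs with h
  · rfl
  · rw [not_not.1 h, map_zero]

/-- Functionals k → F detect zero. Applied coefficientwise they are linear over polynomials with
coefficients in F, so a relation over k becomes one over F. -/
theorem eq_zero_of_sum_mem_span_map {κ : Type*} [Fintype κ] {g : Fin n → MvPolynomial (Fin n) F}
    {μ : κ → Fin n →₀ ℕ}
    (hμ : ∀ c : κ → F, ∑ i, monomial (μ i) (c i) ∈ Ideal.span (Set.range g) → c = 0)
    {c : κ → k} (hc : ∑ i, monomial (μ i) (c i)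
      ∈ Ideal.span (Set.range fun i => map (algebraMap F k) (g i))) : c = 0 := by
  funext i
  rw [Pi.zero_apply, ← Module.forall_dual_apply_eq_zero_iff F]
  intro ℓ
  refine congrFun (hμ (fun i => ℓ (c i)) ?_) i
  rw [← Set.image_univ, ← Finset.coe_univ, mem_span_image_iff_exists_sum] at hc ⊢
  obtain ⟨w, hw⟩ := hc
  choose w' hw' using fun j => exists_coeff_eq_map ℓ (w j)
  refine ⟨w', ?_⟩
  ext u
  have h := congrArg (fun v => ℓ (coeff u v)) hw
  simp only [coeff_sum, map_sum, coeff_mul, coeff_map, ← Algebra.smul_def, map_smul,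
    coeff_monomial, apply_ite ℓ, map_zero] at h ⊢
  simpa only [hw', smul_eq_mul] using h

theorem exists_sub_mem_span_map {κ : Type*} [Fintype κ] {g : Fin n → MvPolynomial (Fin n) F}
    {μ : κ → Fin n →₀ ℕ}
    (hμ : ∀ v, ∃ c : κ → F, v - ∑ i, monomial (μ i) (c i) ∈ Ideal.span (Set.range g))
    (v : MvPolynomial (Fin n) k) : ∃ c : κ → k, v - ∑ i, monomial (μ i) (c i)
      ∈ Ideal.span (Set.range fun i => map (algebraMap F k) (g i)) := by
  induction v using MvPolynomial.induction_on' with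
  | monomial u b =>
    obtain ⟨c, hc⟩ := hμ (monomial u 1)
    refine ⟨fun i => b * algebraMap F k (c i), ?_⟩
    have h := Ideal.mul_mem_left _ (C b) (Ideal.mem_map_of_mem (map (algebraMap F k)) hc)
    rw [Ideal.map_span, ← Set.range_comp] at h
    have e : C b * map (algebraMap F k) (monomial u 1 - ∑ i, monomial (μ i) (c i))
        = monomial u b - ∑ i, monomial (μ i) (b * algebraMap F k (c i)) := by
      simp only [map_sub, map_sum, map_monomial, map_one, mul_sub, Finset.mul_sum,
        C_mul_monomial, mul_one]
    rw [e] at h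
    exact h
  | add p q hp hq =>
    obtain ⟨c, hc⟩ := hp
    obtain ⟨c', hc'⟩ := hq
    refine ⟨c + c', ?_⟩
    convert add_mem hc hc' using 1
    simp only [Pi.add_apply, map_add, Finset.sum_add_distrib]
    abel

theorem IsMonomialBasis.eq_zero {κ : Type*} [Fintype κ] {d : ℕ} {f : MvPolynomial (Fin n) F}
    {μ : κ → Fin n →₀ ℕ} (h : IsMonomialBasis d f μ) (c : κ → F)
    (hc : ∑ i, monomial (μ i) (c i) ∈ Ideal.span (Set.range (leadingPartial d f))) : c = 0 := by
  funext i
  refine Fintype.linearIndependent_iff.1 h.1 c ?_ i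
  rw [← Ideal.Quotient.eq_zero_iff_mem, map_sum] at hc
  rw [← hc]
  refine Finset.sum_congr rfl fun i _ => ?_
  have : (monomial (μ i) (c i) : MvPolynomial (Fin n) F) = c i • monomial (μ i) 1 := by
    rw [smul_monomial, smul_eq_mul, mul_one]
  rw [this]
  rfl

theorem IsMonomialBasis.exists_sub_mem {κ : Type*} [Fintype κ] {d : ℕ}
    {f : MvPolynomial (Fin n) F} {μ : κ → Fin n →₀ ℕ} (h : IsMonomialBasis d f μ)
    (v : MvPolynomial (Fin n) F) : ∃ c : κ → F, v - ∑ i, monomial (μ i) (c i)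
      ∈ Ideal.span (Set.range (leadingPartial d f)) := by
  have h1 : (Ideal.Quotient.mk (Ideal.span (Set.range (leadingPartial d f))) v
      : JacobianRing d f) ∈ (⊤ : Submodule F (JacobianRing d f)) := trivial
  rw [← h.2] at h1
  obtain ⟨c, hc⟩ := (Submodule.mem_span_range_iff_exists_fun F).1 h1
  refine ⟨c, ?_⟩
  rw [← Ideal.Quotient.eq_zero_iff_mem, map_sub, ← hc, map_sum, sub_eq_zero]
  refine Finset.sum_congr rfl fun i _ => ?_
  have : (monomial (μ i) (c i) : MvPolynomial (Fin n) F) = c i • monomial (μ i) 1 := by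
    rw [smul_monomial, smul_eq_mul, mul_one]
  rw [this]
  rfl

/-- Links top Koszul cohomology with the Jacobian ring; the signs and the unit are absorbed in the
cofactors. -/
theorem exists_koszul_univ_iff {n : ℕ} {R : Type*} [CommRing R] (g : Fin n → R) {c : R}
    (hc : IsUnit c) (x : R) :
    (∃ w, x = koszul (fun i => AddMonoidHom.mulLeft (c * g i)) w Finset.univ) ↔
      x ∈ Ideal.span (Set.range g) := by
  rw [← Set.image_univ, ← Finset.coe_univ, mem_span_image_iff_exists_sum]
  constructor
  · rintro ⟨w, rfl⟩
    refine ⟨fun i => wedgeSign Finset.univ i • (c * w (Finset.univ.erase i)), ?_⟩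
    rw [koszul_apply]
    refine Finset.sum_congr rfl fun i _ => ?_
    rw [AddMonoidHom.coe_mulLeft, mul_smul_comm]
    ring_nf
  · rintro ⟨w, rfl⟩
    obtain ⟨b, hb⟩ := hc.exists_left_inv
    obtain ⟨η, hη⟩ := exists_koszul_eq_sum (fun i => AddMonoidHom.mulLeft (c * g i)) Finset.univ
      (fun i => b * w i)
    refine ⟨η, hη.symm ▸ Finset.sum_congr rfl fun i _ => ?_⟩
    rw [AddMonoidHom.coe_mulLeft]
    linear_combination (-g i * w i) * hb

end BaseChange

/-! ### Power series with coefficients tending to zero, and their reduction to polynomials. -/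

section Restricted

variable {O : Type*} [CommRing O] {n : ℕ}

/-- The power series with integral coefficients that tend to zero `ϖ`-adically. -/
def restrictedSeries (n : ℕ) (ϖ : O) : Submodule O (MvPowerSeries (Fin n) O) where
  carrier := {A | ∀ N, {u | ¬ϖ ^ N ∣ MvPowerSeries.coeff u A}.Finite}
  add_mem' := by
    intro A B hA hB N
    refine ((hA N).union (hB N)).subset fun u hu => ?_
    by_contra h
    simp only [Set.mem_union, Set.mem_ofPred_eq, not_or, not_not] at h
    exact hu (by rw [map_add]; exact dvd_add h.1 h.2)
  zero_mem' := by
    intro N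
    simp
  smul_mem' := by
    intro c A hA N
    refine (hA N).subset fun u hu h => hu ?_
    rw [MvPowerSeries.coeff_smul]
    exact h.mul_left c

variable {ϖ : O}

theorem mul_mem_restrictedSeries {A B : MvPowerSeries (Fin n) O} (hA : A ∈ restrictedSeries n ϖ)
    (hB : B ∈ restrictedSeries n ϖ) : A * B ∈ restrictedSeries n ϖ := by
  classical
  intro N
  refine (((hA N).prod (hB N)).image fun x => x.1 + x.2).subset fun u hu => ?_
  by_contra h
  refine hu ?_
  rw [MvPowerSeries.coeff_mul]
  refine Finset.dvd_sum fun x hx => ?_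
  have hx' : x.1 + x.2 = u := Finset.HasAntidiagonal.mem_antidiagonal.1 hx
  by_cases h1 : ϖ ^ N ∣ MvPowerSeries.coeff x.1 A
  · exact h1.mul_right _
  · by_cases h2 : ϖ ^ N ∣ MvPowerSeries.coeff x.2 B
    · exact h2.mul_left _
    · exact absurd ⟨x, ⟨h1, h2⟩, hx'⟩ h

theorem pderiv_mem_restrictedSeries {A : MvPowerSeries (Fin n) O}
    (hA : A ∈ restrictedSeries n ϖ) (i : Fin n) :
    MvPowerSeries.pderiv O i A ∈ restrictedSeries n ϖ := by
  intro N
  refine ((hA N).preimage (f := fun u => u + Finsupp.single i 1)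
    (add_left_injective _).injOn).subset fun u hu h => hu ?_
  rw [MvPowerSeries.coeff_pderiv]
  exact h.mul_right _

theorem monomial_mem_restrictedSeries (ϖ : O) (u : Fin n →₀ ℕ) (c : O) :
    MvPowerSeries.monomial u c ∈ restrictedSeries n ϖ := by
  classical
  intro N
  refine (Set.finite_singleton u).subset fun v hv => ?_
  by_contra h
  refine hv ?_
  rw [MvPowerSeries.coeff_monomial, if_neg (show v ≠ u from fun h' => h h')]
  exact dvd_zero _

theorem mem_restrictedSeries_of_smul [IsDomain O] (hϖ : ϖ ≠ 0) {N : ℕ}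
    {A : MvPowerSeries (Fin n) O} (h : ϖ ^ N • A ∈ restrictedSeries n ϖ) :
    A ∈ restrictedSeries n ϖ := by
  intro k
  refine (h (N + k)).subset fun u hu hd => hu ?_
  rw [MvPowerSeries.coeff_smul, pow_add] at hd
  exact (mul_dvd_mul_iff_left (pow_ne_zero N hϖ)).1 hd

theorem restrictedSeries_separated (hO : AdicSeparated ϖ O) :
    AdicSeparated ϖ (restrictedSeries n ϖ) := by
  intro y hy
  refine Subtype.ext (MvPowerSeries.ext fun u => hO _ fun N => ?_)
  obtain ⟨z, hz⟩ := hy N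
  exact ⟨MvPowerSeries.coeff u z.1, by rw [hz]; rfl⟩

theorem restrictedSeries_precomplete [IsDomain O] (hϖ : ϖ ≠ 0) (hO : AdicPrecomplete ϖ O) :
    AdicPrecomplete ϖ (restrictedSeries n ϖ) := by
  intro x
  choose y hy using fun u : Fin n →₀ ℕ => hO fun s => MvPowerSeries.coeff u (x s).1
  choose z hz using hy
  let y' : MvPowerSeries (Fin n) O := y
  let z' : ℕ → MvPowerSeries (Fin n) O := fun N u => z u N
  have h : ∀ N, y' = ((∑ s ∈ Finset.range N, ϖ ^ s • x s : restrictedSeries n ϖ) :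
      MvPowerSeries (Fin n) O) + ϖ ^ N • z' N := fun N => by
    ext u
    rw [map_add, MvPowerSeries.coeff_smul, Submodule.coe_sum, map_sum]
    simp only [Submodule.coe_smul, MvPowerSeries.coeff_smul]
    exact hz u N
  -- Modulo ϖ^N the coefficientwise limit agrees with a finite sum of restricted series, which
  -- suffices for each N.
  have hy' : y' ∈ restrictedSeries n ϖ := by
    intro N
    refine ((∑ s ∈ Finset.range N, ϖ ^ s • x s : restrictedSeries n ϖ).2 N).subset
      fun u hu hd => hu ?_
    rw [h N, map_add, MvPowerSeries.coeff_smul]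
    exact dvd_add hd (Dvd.intro _ rfl)
  refine ⟨⟨y', hy'⟩, fun N => ⟨⟨z' N, mem_restrictedSeries_of_smul hϖ (N := N) ?_⟩,
    Subtype.ext (h N)⟩⟩
  rw [← sub_eq_of_eq_add' (h N)]
  exact sub_mem hy' (Subtype.mem _)

variable {k : Type*} [Field k] (res : O →+* k) (hres : ∀ x, res x = 0 ↔ ϖ ∣ x)

/-- The reduction of a restricted power series is a polynomial. -/
noncomputable def reduction : restrictedSeries n ϖ →+ MvPolynomial (Fin n) k :=
  have key : ∀ A : restrictedSeries n ϖ, {u | res (MvPowerSeries.coeff u A.1) ≠ 0}.Finite :=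
    fun A => (A.2 1).subset fun u hu hd => hu ((hres _).2 (by simpa using hd))
  have coeff_eq : ∀ (A : restrictedSeries n ϖ) u, MvPolynomial.coeff u
      (∑ u ∈ (key A).toFinset, MvPolynomial.monomial u (res (MvPowerSeries.coeff u A.1)))
        = res (MvPowerSeries.coeff u A.1) := fun A u => by
    simp only [MvPolynomial.coeff_sum, MvPolynomial.coeff_monomial, Finset.sum_ite_eq']
    split_ifs with h
    · rfl
    · simpa using Eq.symm (by simpa using h)
  { toFun := fun A =>
      ∑ u ∈ (key A).toFinset, MvPolynomial.monomial u (res (MvPowerSeries.coeff u A.1))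
    map_zero' := by ext u; rw [coeff_eq]; simp
    map_add' := fun A B => by
      ext u; rw [MvPolynomial.coeff_add, coeff_eq, coeff_eq, coeff_eq]; simp }

theorem coeff_reduction (A : restrictedSeries n ϖ) (u : Fin n →₀ ℕ) :
    MvPolynomial.coeff u (reduction res hres A) = res (MvPowerSeries.coeff u A.1) := by
  have key : ∀ A : restrictedSeries n ϖ, {u | res (MvPowerSeries.coeff u A.1) ≠ 0}.Finite :=
    fun A => (A.2 1).subset fun u hu hd => hu ((hres _).2 (by simpa using hd))
  change MvPolynomial.coeff u
    (∑ u ∈ (key A).toFinset, MvPolynomial.monomial u (res (MvPowerSeries.coeff u A.1))) = _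
  simp only [MvPolynomial.coeff_sum, MvPolynomial.coeff_monomial, Finset.sum_ite_eq']
  split_ifs with h
  · rfl
  · simpa using Eq.symm (by simpa using h)

theorem reduction_mul (A B : restrictedSeries n ϖ) :
    reduction res hres ⟨A.1 * B.1, mul_mem_restrictedSeries A.2 B.2⟩
      = reduction res hres A * reduction res hres B := by
  classical
  ext u
  rw [coeff_reduction, MvPowerSeries.coeff_mul, MvPolynomial.coeff_mul, map_sum]
  simp only [map_mul, coeff_reduction]

theorem reduction_smul (c : O) (A : restrictedSeries n ϖ) :
    reduction res hres (c • A) = res c • reduction res hres A := by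
  ext u
  rw [coeff_reduction, MvPolynomial.coeff_smul, coeff_reduction, Submodule.coe_smul,
    MvPowerSeries.coeff_smul, map_mul, smul_eq_mul]

theorem reduction_monomial (u : Fin n →₀ ℕ) (c : O) :
    reduction res hres ⟨_, monomial_mem_restrictedSeries ϖ u c⟩
      = MvPolynomial.monomial u (res c) := by
  classical
  ext v
  rw [coeff_reduction, MvPowerSeries.coeff_monomial, MvPolynomial.coeff_monomial]
  simp only [eq_comm (a := u)]
  split_ifs <;> simp

theorem reduction_surjective (hs : Function.Surjective res) :
    Function.Surjective (reduction (n := n) res hres) := by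
  intro v
  induction v using MvPolynomial.induction_on' with
  | monomial u c =>
    obtain ⟨c, rfl⟩ := hs c
    exact ⟨_, reduction_monomial res hres u c⟩
  | add p q hp hq =>
    obtain ⟨A, rfl⟩ := hp
    obtain ⟨B, rfl⟩ := hq
    exact ⟨A + B, map_add _ _ _⟩

theorem exists_smul_of_reduction_eq_zero [IsDomain O] (hϖ : ϖ ≠ 0) {A : restrictedSeries n ϖ}
    (h : reduction res hres A = 0) : ∃ B : restrictedSeries n ϖ, A = ϖ • B := by
  choose b hb using fun u => (hres (MvPowerSeries.coeff u A.1)).1 (by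
    rw [← coeff_reduction res hres, h, MvPolynomial.coeff_zero])
  let B : MvPowerSeries (Fin n) O := b
  have hA : A.1 = ϖ • B := MvPowerSeries.ext hb
  exact ⟨⟨B, mem_restrictedSeries_of_smul hϖ (N := 1) (by rw [pow_one, ← hA]; exact A.2)⟩,
    Subtype.ext hA⟩

/-- The operator `s ∂ / ∂x_i + G_i` on restricted power series. -/
noncomputable def restrictedOp (s : O) (G : Fin n → restrictedSeries n ϖ) (i : Fin n) :
    restrictedSeries n ϖ →ₗ[O] restrictedSeries n ϖ :=
  ((s • (MvPowerSeries.pderiv O i).toLinearMap + LinearMap.mulLeft O (G i).1) ∘ₗ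
    Submodule.subtype _).codRestrict _ fun A =>
      add_mem (Submodule.smul_mem _ _ (pderiv_mem_restrictedSeries A.2 i))
        (mul_mem_restrictedSeries (G i).2 A.2)

theorem coe_restrictedOp (s : O) (G : Fin n → restrictedSeries n ϖ) (i : Fin n)
    (A : restrictedSeries n ϖ) : (restrictedOp s G i A : MvPowerSeries (Fin n) O)
      = s • MvPowerSeries.pderiv O i A.1 + (G i).1 * A.1 := rfl

/-- Since ϖ divides s, the derivative dies and the reduced operator is a multiplication:
differential operators become a Koszul complex. -/
theorem reduction_restrictedOp {s : O} (hs : ϖ ∣ s) (G : Fin n → restrictedSeries n ϖ)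
    (i : Fin n) (A : restrictedSeries n ϖ) :
    reduction res hres (restrictedOp s G i A)
      = reduction res hres (G i) * reduction res hres A := by
  have h : restrictedOp s G i A = s • ⟨_, pderiv_mem_restrictedSeries A.2 i⟩
      + ⟨(G i).1 * A.1, mul_mem_restrictedSeries (G i).2 A.2⟩ := rfl
  rw [h, map_add, reduction_smul, (hres s).2 hs, zero_smul, zero_add, reduction_mul]

theorem koszulReduction_restrictedOp [IsDomain O] (hϖ : ϖ ≠ 0) (hsep : AdicSeparated ϖ O)
    (hcomp : AdicPrecomplete ϖ O) (hsurj : Function.Surjective res)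
    {s : O} (hs : ϖ ∣ s) {G : Fin n → restrictedSeries n ϖ}
    (hcomm : ∀ i j A, restrictedOp s G i (restrictedOp s G j A)
      = restrictedOp s G j (restrictedOp s G i A))
    {F : Type*} [Field F] [Algebra F k] {g : Fin n → MvPolynomial (Fin n) F}
    (hreg : RingTheory.Sequence.IsWeaklyRegular (MvPolynomial (Fin n) F) (List.ofFn g))
    {c : k} (hc : c ≠ 0) (hG : ∀ i, reduction res hres (G i)
      = MvPolynomial.C c * MvPolynomial.map (algebraMap F k) (g i)) :
    KoszulReduction ϖ (restrictedOp s G)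
      (fun i => AddMonoidHom.mulLeft
        (MvPolynomial.C c * MvPolynomial.map (algebraMap F k) (g i))) (reduction res hres) where
  comm := hcomm
  surj := reduction_surjective res hres hsurj
  ker _ h := exists_smul_of_reduction_eq_zero res hres hϖ h
  map_smul v := by rw [reduction_smul, (hres ϖ).2 dvd_rfl, zero_smul]
  map_op i v := by rw [reduction_restrictedOp res hres hs, hG]; rfl
  torsionFree v h := Subtype.ext <| MvPowerSeries.ext fun u => by
    have h1 := congrArg (fun A : restrictedSeries n ϖ => MvPowerSeries.coeff u A.1) h
    simp only [Submodule.coe_smul, MvPowerSeries.coeff_smul, Submodule.coe_zero, map_zero] at h1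
    exact (mul_eq_zero.1 h1).resolve_left hϖ
  precomplete := restrictedSeries_precomplete hϖ hcomp
  separated := restrictedSeries_separated hsep
  exact_reduction _ h h0 := koszul_exact_of_isRegularFamily
    (fun i j v => by simp only [AddMonoidHom.coe_mulLeft]; ring)
    (isRegularFamily_mulLeft hreg hc) h h0

variable {κ : Type*} [Fintype κ]

theorem reduction_sum_smul_monomial (c : κ → O) (μ : κ → Fin n →₀ ℕ) :
    reduction res hres (∑ i, c i • (⟨_, monomial_mem_restrictedSeries ϖ (μ i) 1⟩ :
      restrictedSeries n ϖ)) = ∑ i, MvPolynomial.monomial (μ i) (res (c i)) := by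
  rw [map_sum]
  refine Finset.sum_congr rfl fun i _ => ?_
  rw [reduction_smul, reduction_monomial, map_one, MvPolynomial.smul_monomial, smul_eq_mul,
    mul_one]

end Restricted

/-! ### Valuation rings: divisibility, residues and adic completeness. -/

section Integers

variable (L : Type*) [NormedField L] [IsUltrametricDist L]

/-- The valuation ring of a nonarchimedean normed field. -/
noncomputable abbrev integers : ValuationSubring L :=
  (NormedField.valuation (K := L)).valuationSubring

variable {L}

theorem mem_integers {x : L} : x ∈ integers L ↔ ‖x‖ ≤ 1 := Iff.rfl

theorem integers_dvd_iff {ϖ x : integers L} (hϖ : ϖ ≠ 0) : ϖ ∣ x ↔ ‖(x : L)‖ ≤ ‖(ϖ : L)‖ := by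
  have h0 : (ϖ : L) ≠ 0 := fun h => hϖ (Subtype.ext h)
  have hpos : 0 < ‖(ϖ : L)‖ := norm_pos_iff.2 h0
  constructor
  · rintro ⟨y, rfl⟩
    rw [MulMemClass.coe_mul, norm_mul]
    exact mul_le_of_le_one_right hpos.le (mem_integers.1 y.2)
  · intro h
    refine ⟨⟨x / ϖ, mem_integers.2 ?_⟩, Subtype.ext ?_⟩
    · rw [norm_div]
      exact div_le_one_of_le₀ h hpos.le
    · exact (mul_div_cancel₀ _ h0).symm

theorem isUnit_integers_iff {x : integers L} : IsUnit x ↔ ‖(x : L)‖ = 1 := by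
  constructor
  · rintro ⟨u, rfl⟩
    have h1 := mem_integers.1 (u : integers L).2
    have h2 := mem_integers.1 (↑u⁻¹ : integers L).2
    have h3 : ‖((u : integers L) : L)‖ * ‖((↑u⁻¹ : integers L) : L)‖ = 1 := by
      rw [← norm_mul, ← MulMemClass.coe_mul, Units.mul_inv, OneMemClass.coe_one, norm_one]
    nlinarith [norm_nonneg ((u : integers L) : L)]
  · intro h
    have h0 : x ≠ 0 := fun h0 => by rw [h0] at h; simp at h
    exact isUnit_of_dvd_one ((integers_dvd_iff h0).2 (by simp [h]))

theorem residue_eq_zero_iff {x : integers L} :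
    IsLocalRing.residue (integers L) x = 0 ↔ ‖(x : L)‖ < 1 := by
  rw [IsLocalRing.residue_eq_zero_iff, IsLocalRing.mem_maximalIdeal, mem_nonunits_iff,
    isUnit_integers_iff]
  exact (mem_integers.1 x.2).lt_iff_ne.symm

/-- The hypothesis `hmax` says that ‖ϖ‖ is the largest norm below 1, so ϖ generates the maximal
ideal. -/
theorem residue_eq_zero_iff_dvd {ϖ : integers L} (hϖ : ϖ ≠ 0) (hϖ1 : ‖(ϖ : L)‖ < 1)
    (hmax : ∀ x : L, ‖x‖ < 1 → ‖x‖ ≤ ‖(ϖ : L)‖) (x : integers L) :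
    IsLocalRing.residue (integers L) x = 0 ↔ ϖ ∣ x := by
  rw [residue_eq_zero_iff, integers_dvd_iff hϖ]
  exact ⟨hmax _, fun h => h.trans_lt hϖ1⟩

theorem integers_separated {ϖ : integers L} (hϖ1 : ‖(ϖ : L)‖ < 1) :
    AdicSeparated ϖ (integers L) := by
  intro y hy
  refine Subtype.ext (norm_le_zero_iff.1 ?_)
  refine ge_of_tendsto' (tendsto_pow_atTop_nhds_zero_of_lt_one (norm_nonneg _) hϖ1) fun N => ?_
  obtain ⟨z, hz⟩ := hy N
  rw [hz, smul_eq_mul, MulMemClass.coe_mul, norm_mul, SubmonoidClass.coe_pow, norm_pow]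
  exact mul_le_of_le_one_right (pow_nonneg (norm_nonneg _) _) (mem_integers.1 z.2)

theorem integers_precomplete [CompleteSpace L] {ϖ : integers L} (hϖ : ϖ ≠ 0)
    (hϖ1 : ‖(ϖ : L)‖ < 1) : AdicPrecomplete ϖ (integers L) := by
  intro x
  have hx : ∀ s, ‖(ϖ : L) ^ s * x s‖ ≤ ‖(ϖ : L)‖ ^ s := fun s => by
    rw [norm_mul, norm_pow]
    exact mul_le_of_le_one_right (pow_nonneg (norm_nonneg _) _) (mem_integers.1 (x s).2)
  have hsum : Summable fun s => (ϖ : L) ^ s * x s :=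
    Summable.of_norm_bounded (summable_geometric_of_lt_one (norm_nonneg _) hϖ1) hx
  have htail : ∀ N, ‖∑' s, (ϖ : L) ^ s * x s - ∑ s ∈ Finset.range N, (ϖ : L) ^ s * x s‖
      ≤ ‖(ϖ : L)‖ ^ N := fun N => by
    have h1 : Filter.Tendsto (fun k => ‖∑ s ∈ Finset.range k, (ϖ : L) ^ s * x s
        - ∑ s ∈ Finset.range N, (ϖ : L) ^ s * x s‖) Filter.atTop
        (nhds ‖∑' s, (ϖ : L) ^ s * x s - ∑ s ∈ Finset.range N, (ϖ : L) ^ s * x s‖) :=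
      (hsum.hasSum.tendsto_sum_nat.sub_const _).norm
    refine le_of_tendsto h1 (Filter.eventually_atTop.2 ⟨N, fun k hk => ?_⟩)
    rw [← Finset.sum_Ico_eq_sub _ hk]
    refine IsUltrametricDist.norm_sum_le_of_forall_le_of_nonneg (pow_nonneg (norm_nonneg _) _)
      fun s hs => (hx s).trans ?_
    exact pow_le_pow_of_le_one (norm_nonneg _) hϖ1.le (Finset.mem_Ico.1 hs).1
  have hy : ‖∑' s, (ϖ : L) ^ s * x s‖ ≤ 1 := by simpa using htail 0
  refine ⟨⟨_, mem_integers.2 hy⟩, fun N => ?_⟩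
  have h2 : ϖ ^ N ∣ (⟨_, mem_integers.2 hy⟩ : integers L)
      - ∑ s ∈ Finset.range N, ϖ ^ s • x s := by
    rw [integers_dvd_iff (pow_ne_zero N hϖ)]
    simpa using htail N
  obtain ⟨z, hz⟩ := h2
  exact ⟨z, by rw [smul_eq_mul, ← hz, add_sub_cancel]⟩

end Integers

/-! ### Rescaling the variables: C(b) against restricted power series. -/

section Scaling

variable {L : Type*} [NormedField L] [IsUltrametricDist L] {n : ℕ}

/-- The power series `∑ A_u w ^ |u| x ^ u`. -/
noncomputable def scaleSeries (w : L) :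
    MvPowerSeries (Fin n) (integers L) →+ MvPowerSeries (Fin n) L where
  toFun A u := ((MvPowerSeries.coeff u A : integers L) : L) * w ^ u.degree
  map_zero' := MvPowerSeries.ext fun u => by
    change ((MvPowerSeries.coeff u (0 : MvPowerSeries (Fin n) (integers L)) : integers L) : L) * _
      = _
    simp
  map_add' A B := MvPowerSeries.ext fun u => by
    change ((MvPowerSeries.coeff u (A + B) : integers L) : L) * _
      = (MvPowerSeries.coeff u A : integers L) * w ^ u.degree
        + (MvPowerSeries.coeff u B : integers L) * w ^ u.degree
    rw [map_add, AddMemClass.coe_add, add_mul]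

theorem coeff_scaleSeries (w : L) (A : MvPowerSeries (Fin n) (integers L)) (u : Fin n →₀ ℕ) :
    MvPowerSeries.coeff u (scaleSeries w A)
      = ((MvPowerSeries.coeff u A : integers L) : L) * w ^ u.degree := rfl

theorem scaleSeries_injective {w : L} (hw : w ≠ 0) :
    Function.Injective (scaleSeries (n := n) w) := by
  intro A B h
  ext u
  have h1 := congrArg (MvPowerSeries.coeff u) h
  rw [coeff_scaleSeries, coeff_scaleSeries] at h1
  exact mul_right_cancel₀ (pow_ne_zero _ hw) h1

theorem scaleSeries_smul (w : L) (c : integers L) (A : MvPowerSeries (Fin n) (integers L)) :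
    scaleSeries w (c • A) = (c : L) • scaleSeries w A := by
  ext u
  rw [coeff_scaleSeries, MvPowerSeries.coeff_smul, MvPowerSeries.coeff_smul, coeff_scaleSeries,
    MulMemClass.coe_mul, mul_assoc]

theorem scaleSeries_mul (w : L) (A B : MvPowerSeries (Fin n) (integers L)) :
    scaleSeries w (A * B) = scaleSeries w A * scaleSeries w B := by
  classical
  ext u
  rw [coeff_scaleSeries, MvPowerSeries.coeff_mul, MvPowerSeries.coeff_mul,
    AddSubmonoidClass.coe_finsetSum, Finset.sum_mul]
  refine Finset.sum_congr rfl fun x hx => ?_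
  rw [← Finset.HasAntidiagonal.mem_antidiagonal.1 hx, map_add, pow_add, coeff_scaleSeries,
    coeff_scaleSeries, MulMemClass.coe_mul]
  ring

theorem pderiv_scaleSeries (w : L) (i : Fin n) (A : MvPowerSeries (Fin n) (integers L)) :
    MvPowerSeries.pderiv L i (scaleSeries w A)
      = w • scaleSeries w (MvPowerSeries.pderiv (integers L) i A) := by
  ext u
  rw [MvPowerSeries.coeff_pderiv, coeff_scaleSeries, MvPowerSeries.coeff_smul, coeff_scaleSeries,
    MvPowerSeries.coeff_pderiv, map_add, Finsupp.degree_single, pow_succ]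
  push_cast
  ring

theorem scaleSeries_monomial (w : L) (u : Fin n →₀ ℕ) :
    scaleSeries w (MvPowerSeries.monomial u 1) = w ^ u.degree • MvPowerSeries.monomial u 1 := by
  classical
  ext v
  rw [coeff_scaleSeries, MvPowerSeries.coeff_smul, MvPowerSeries.coeff_monomial,
    MvPowerSeries.coeff_monomial]
  split_ifs with h <;> simp [h]

variable {ϖ : integers L} {π : L} {m : ℕ}

theorem scaleSeries_mem_CSpace (hϖ : ϖ ≠ 0) (hϖ1 : ‖(ϖ : L)‖ < 1)
    {A : MvPowerSeries (Fin n) (integers L)} (hA : A ∈ restrictedSeries n ϖ) :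
    scaleSeries (π ^ m) A ∈ CSpace n π m := by
  refine ⟨fun u => ((MvPowerSeries.coeff u A : integers L) : L), ?_, fun u => by
    rw [coeff_scaleSeries, pow_mul]⟩
  rw [Metric.tendsto_nhds]
  intro r hr
  obtain ⟨N, hN⟩ := exists_pow_lt_of_lt_one hr hϖ1
  rw [Filter.eventually_cofinite]
  refine (hA N).subset fun u hu hd => hu ?_
  rw [dist_zero_right]
  refine ((integers_dvd_iff (pow_ne_zero N hϖ)).1 hd).trans_lt ?_
  rwa [SubmonoidClass.coe_pow, norm_pow]

/-- Coefficients tending to zero are bounded, so one power of ϖ makes them all integral. -/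
theorem exists_pow_smul_eq_scaleSeries (hϖ : ϖ ≠ 0) (hϖ1 : ‖(ϖ : L)‖ < 1)
    {ξ : MvPowerSeries (Fin n) L} (hξ : ξ ∈ CSpace n π m) :
    ∃ N, ∃ A : restrictedSeries n ϖ, (ϖ : L) ^ N • ξ = scaleSeries (π ^ m) A := by
  obtain ⟨A, hA, hA'⟩ := hξ
  have hpos : 0 < ‖(ϖ : L)‖ := norm_pos_iff.2 fun h => hϖ (Subtype.ext h)
  have hfin : ∀ r > 0, {u | ¬‖A u‖ < r}.Finite := fun r hr => by
    have := Filter.eventually_cofinite.1 (Metric.tendsto_nhds.1 hA r hr)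
    simpa only [dist_zero_right] using this
  obtain ⟨C, hC⟩ : ∃ C, ∀ u, ‖A u‖ ≤ C := by
    obtain ⟨C, hC⟩ := ((hfin 1 one_pos).image fun u => ‖A u‖).bddAbove
    refine ⟨max C 1, fun u => ?_⟩
    by_cases h : ‖A u‖ < 1
    · exact h.le.trans (le_max_right _ _)
    · exact (hC ⟨u, h, rfl⟩).trans (le_max_left _ _)
  obtain ⟨N, hN⟩ := exists_pow_lt_of_lt_one (inv_pos.2 (lt_max_of_lt_right one_pos :
    0 < max C 1)) hϖ1
  have hint : ∀ u, (ϖ : L) ^ N * A u ∈ integers L := fun u => by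
    rw [mem_integers, norm_mul, norm_pow]
    have h1 : (0 : ℝ) < max C 1 := lt_max_of_lt_right one_pos
    calc _ ≤ (max C 1)⁻¹ * max C 1 :=
          mul_le_mul hN.le ((hC u).trans (le_max_left _ _)) (norm_nonneg _) (inv_pos.2 h1).le
      _ = 1 := inv_mul_cancel₀ h1.ne'
  let B : MvPowerSeries (Fin n) (integers L) := fun u => ⟨_, hint u⟩
  refine ⟨N, ⟨B, fun k => (hfin _ (pow_pos hpos k)).subset fun u hu hlt => hu ?_⟩, ?_⟩
  · rw [integers_dvd_iff (pow_ne_zero k hϖ)]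
    change ‖(ϖ : L) ^ N * A u‖ ≤ _
    rw [norm_mul, norm_pow, SubmonoidClass.coe_pow, norm_pow]
    exact (mul_le_of_le_one_left (norm_nonneg _) (pow_le_one₀ hpos.le hϖ1.le)).trans hlt.le
  · ext u
    rw [MvPowerSeries.coeff_smul, hA', coeff_scaleSeries, pow_mul, ← mul_assoc]
    rfl

theorem exists_pow_smul_form_eq_scaleSeries (hϖ : ϖ ≠ 0) (hϖ1 : ‖(ϖ : L)‖ < 1)
    {ω : Form n L} (hω : ∀ t, ω t ∈ CSpace n π m) :
    ∃ N, ∃ A : Finset (Fin n) → restrictedSeries n ϖ,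
      ∀ t, (ϖ : L) ^ N • ω t = scaleSeries (π ^ m) (A t) := by
  choose N A hA using fun t => exists_pow_smul_eq_scaleSeries hϖ hϖ1 (hω t)
  refine ⟨Finset.univ.sup N, fun t => ϖ ^ (Finset.univ.sup N - N t) • A t, fun t => ?_⟩
  rw [Submodule.coe_smul, scaleSeries_smul, ← hA, smul_smul, SubmonoidClass.coe_pow, ← pow_add,
    Nat.sub_add_cancel (Finset.le_sup (Finset.mem_univ t))]

theorem exists_pow_smul_mem_integers {κ : Type*} [Fintype κ] (hϖ1 : ‖(ϖ : L)‖ < 1)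
    (c : κ → L) :
    ∃ N, ∀ i, (ϖ : L) ^ N * c i ∈ integers L := by
  have hsum : ∀ i, ‖c i‖ ≤ ∑ i, ‖c i‖ := fun i =>
    Finset.single_le_sum (f := fun i => ‖c i‖) (fun _ _ => norm_nonneg _) (Finset.mem_univ i)
  have hnn : 0 ≤ ∑ i, ‖c i‖ := Finset.sum_nonneg fun _ _ => norm_nonneg _
  obtain ⟨N, hN⟩ := exists_pow_lt_of_lt_one (inv_pos.2 (by linarith :
    0 < ∑ i, ‖c i‖ + 1)) hϖ1
  refine ⟨N, fun i => ?_⟩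
  rw [mem_integers, norm_mul, norm_pow]
  calc _ ≤ (∑ i, ‖c i‖ + 1)⁻¹ * (∑ i, ‖c i‖ + 1) :=
        mul_le_mul hN.le ((hsum i).trans (by linarith)) (norm_nonneg _)
          (inv_pos.2 (by linarith)).le
    _ = 1 := inv_mul_cancel₀ (by linarith)

end Scaling

/-! ### From the integral model to the cohomology over `L`. -/

section Cohomology

variable {L : Type*} [NormedField L] [IsUltrametricDist L] {n : ℕ}

/-- The scaling map on restricted power series. -/
noncomputable def scaleRestricted (ϖ : integers L) (w : L) :
    restrictedSeries n ϖ →+ MvPowerSeries (Fin n) L :=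
  (scaleSeries w).comp (restrictedSeries n ϖ).subtype.toAddMonoidHom

theorem scaleRestricted_apply (ϖ : integers L) (w : L) (A : restrictedSeries n ϖ) :
    scaleRestricted ϖ w A = scaleSeries w A.1 := rfl

/-- Operators `D i` on power series over `L` that come, after scaling, from operators on restricted
power series with a good reduction. -/
structure IntegralModel (ϖ : integers L) (π : L) (m : ℕ)
    (D : Fin n → MvPowerSeries (Fin n) L →ₗ[L] MvPowerSeries (Fin n) L)
    (T : Fin n → restrictedSeries n ϖ →ₗ[integers L] restrictedSeries n ϖ)
    {V : Type*} [AddCommGroup V] (S : Fin n → V →+ V) (ρ : restrictedSeries n ϖ →+ V) :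
    Prop where
  unif_ne_zero : ϖ ≠ 0
  unif_norm : ‖(ϖ : L)‖ < 1
  scale_ne_zero : π ≠ 0
  comm : ∀ i j ξ, D i (D j ξ) = D j (D i ξ)
  map_scale : ∀ i A, D i (scaleRestricted ϖ (π ^ m) A) = scaleRestricted ϖ (π ^ m) (T i A)
  reduction : KoszulReduction ϖ T S ρ

namespace IntegralModel

variable {ϖ : integers L} {π : L} {m : ℕ}
    {D : Fin n → MvPowerSeries (Fin n) L →ₗ[L] MvPowerSeries (Fin n) L}
    {T : Fin n → restrictedSeries n ϖ →ₗ[integers L] restrictedSeries n ϖ}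
    {V : Type*} [AddCommGroup V] {S : Fin n → V →+ V} {ρ : restrictedSeries n ϖ →+ V}
    {d : Form n L →ₗ[L] Form n L}

theorem unif_pow_ne_zero (h : IntegralModel ϖ π m D T S ρ) (N : ℕ) : (ϖ : L) ^ N ≠ 0 :=
  pow_ne_zero N fun h0 => h.unif_ne_zero (Subtype.ext h0)

theorem scaleRestricted_injective (h : IntegralModel ϖ π m D T S ρ) :
    Function.Injective (scaleRestricted (n := n) ϖ (π ^ m)) := fun _ _ hAB =>
  Subtype.ext (scaleSeries_injective (pow_ne_zero m h.scale_ne_zero) hAB)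

theorem mem_CSpace_of_smul (h : IntegralModel ϖ π m D T S ρ) {N : ℕ}
    {ξ : MvPowerSeries (Fin n) L} {A : restrictedSeries n ϖ}
    (hξ : (ϖ : L) ^ N • ξ = scaleRestricted ϖ (π ^ m) A) : ξ ∈ CSpace n π m := by
  rw [← inv_smul_smul₀ (h.unif_pow_ne_zero N) ξ, hξ]
  exact Submodule.smul_mem _ _ (scaleSeries_mem_CSpace h.unif_ne_zero h.unif_norm A.2)

theorem map_mem_CSpace (h : IntegralModel ϖ π m D T S ρ) (i : Fin n)
    {ξ : MvPowerSeries (Fin n) L} (hξ : ξ ∈ CSpace n π m) : D i ξ ∈ CSpace n π m := by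
  obtain ⟨N, A, hA⟩ := exists_pow_smul_eq_scaleSeries h.unif_ne_zero h.unif_norm hξ
  refine h.mem_CSpace_of_smul (N := N) (A := T i A) ?_
  rw [← map_smul, hA]
  exact h.map_scale i A

section Differential

variable (h : IntegralModel ϖ π m D T S ρ)
  (hd : ∀ ω t, d ω t = koszul (fun i => (D i).toAddMonoidHom) ω t)
include h hd

theorem d_mem_CSpace {ω : Form n L} (hω : ∀ t, ω t ∈ CSpace n π m) (t : Finset (Fin n)) :
    d ω t ∈ CSpace n π m := by
  rw [hd, koszul_apply]
  exact sum_mem fun i _ => zsmul_mem (h.map_mem_CSpace i (hω _)) _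

theorem d_d (ω : Form n L) : d (d ω) = 0 := by
  have h1 : ∀ ω, d ω = koszul (fun i => (D i).toAddMonoidHom) ω := fun ω => funext (hd ω)
  rw [h1, h1, koszul_koszul h.comm]

theorem d_scale (A : Finset (Fin n) → restrictedSeries n ϖ) (t : Finset (Fin n)) :
    d (fun t => scaleRestricted ϖ (π ^ m) (A t)) t
      = scaleRestricted ϖ (π ^ m) (KoszulReduction.diff T A t) := by
  rw [hd]
  exact (koszul_map _ (fun i A => (h.map_scale i A).symm) A t).symm

/-- Clear denominators, solve over O, and divide by the same power of ϖ. -/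
theorem exists_eq_d {ω : Form n L} (hω : ∀ t, ω t ∈ CSpace n π m) (hdω : d ω = 0)
    (htop : ω Finset.univ = 0) : ∃ η : Form n L, (∀ t, η t ∈ CSpace n π m) ∧ ω = d η := by
  obtain ⟨N, A, hA⟩ := exists_pow_smul_form_eq_scaleSeries h.unif_ne_zero h.unif_norm hω
  have hA' : (ϖ : L) ^ N • ω = fun t => scaleRestricted ϖ (π ^ m) (A t) := funext hA
  obtain ⟨B, hB⟩ := h.reduction.exact (ω := A)
    (funext fun t => h.scaleRestricted_injective (by
      rw [← h.d_scale hd, ← hA', map_smul, hdω, smul_zero, Pi.zero_apply, Pi.zero_apply, map_zero]))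
    (h.scaleRestricted_injective (by
      rw [← congrFun hA' Finset.univ, Pi.smul_apply, htop, smul_zero, map_zero]))
  refine ⟨((ϖ : L) ^ N)⁻¹ • fun t => scaleRestricted ϖ (π ^ m) (B t), fun t =>
    Submodule.smul_mem _ _ (scaleSeries_mem_CSpace h.unif_ne_zero h.unif_norm (B t).2), ?_⟩
  rw [map_smul, eq_inv_smul_iff₀ (h.unif_pow_ne_zero N), hA']
  funext t
  rw [h.d_scale hd, ← hB]

variable {κ : Type*} [Fintype κ] (μ : κ → Fin n →₀ ℕ)

theorem exists_eq_sum_add_d (hO : AdicPrecomplete ϖ (integers L))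
    (hx : ∀ v : V, ∃ (c : κ → integers L) (w : Finset (Fin n) → V),
      v = ρ (∑ i, c i • (⟨_, monomial_mem_restrictedSeries ϖ (μ i) 1⟩ : restrictedSeries n ϖ))
        + koszul S w Finset.univ)
    {ξ : MvPowerSeries (Fin n) L} (hξ : ξ ∈ CSpace n π m) :
    ∃ (c : κ → L) (η : Form n L), (∀ t, η t ∈ CSpace n π m) ∧
      ξ = ∑ i, c i • MvPowerSeries.monomial (μ i) 1 + d η Finset.univ := by
  obtain ⟨N, A, hA⟩ := exists_pow_smul_eq_scaleSeries h.unif_ne_zero h.unif_norm hξ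
  obtain ⟨c, B, hB⟩ := h.reduction.exists_eq_sum_add_diff_univ hO _ hx A
  refine ⟨fun i => ((ϖ : L) ^ N)⁻¹ * (c i * (π ^ m) ^ (μ i).degree),
    ((ϖ : L) ^ N)⁻¹ • fun t => scaleRestricted ϖ (π ^ m) (B t), fun t =>
    Submodule.smul_mem _ _ (scaleSeries_mem_CSpace h.unif_ne_zero h.unif_norm (B t).2), ?_⟩
  simp only [mul_smul]
  rw [map_smul, Pi.smul_apply, ← Finset.smul_sum, ← smul_add,
    eq_inv_smul_iff₀ (h.unif_pow_ne_zero N), hA, h.d_scale hd, ← scaleRestricted_apply, hB,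
    map_add, map_sum]
  congr 1
  refine Finset.sum_congr rfl fun i _ => ?_
  rw [scaleRestricted_apply, Submodule.coe_smul, scaleSeries_smul, scaleSeries_monomial]

theorem eq_zero_of_sum_eq_d (hO : AdicSeparated ϖ (integers L))
    (hx : ∀ (c : κ → integers L) (w : Finset (Fin n) → V),
      ρ (∑ i, c i • (⟨_, monomial_mem_restrictedSeries ϖ (μ i) 1⟩ : restrictedSeries n ϖ))
        = koszul S w Finset.univ → ∀ i, ∃ c', c i = ϖ * c')
    {c : κ → L} {η : Form n L} (hη : ∀ t, η t ∈ CSpace n π m)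
    (hc : ∑ i, c i • MvPowerSeries.monomial (μ i) 1 = d η Finset.univ) : c = 0 := by
  obtain ⟨N, B, hB⟩ := exists_pow_smul_form_eq_scaleSeries h.unif_ne_zero h.unif_norm hη
  have hB' : (ϖ : L) ^ N • η = fun t => scaleRestricted ϖ (π ^ m) (B t) := funext hB
  have hw : ∀ i, (π ^ m) ^ (μ i).degree ≠ 0 := fun i =>
    pow_ne_zero _ (pow_ne_zero _ h.scale_ne_zero)
  -- Rescaling multiplies the monomial x^μ by (π^m)^|μ|, so the coefficients carry the inverse
  -- factor and need a further power of ϖ to become integral.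
  obtain ⟨N', hN'⟩ := exists_pow_smul_mem_integers h.unif_norm
    fun i => (ϖ : L) ^ N * (c i * ((π ^ m) ^ (μ i).degree)⁻¹)
  let c' : κ → integers L := fun i => ⟨_, hN' i⟩
  have hsum : ∑ i, c' i • (⟨_, monomial_mem_restrictedSeries ϖ (μ i) 1⟩ : restrictedSeries n ϖ)
      = KoszulReduction.diff T (ϖ ^ N' • B) Finset.univ := by
    apply h.scaleRestricted_injective
    have h1 : scaleRestricted ϖ (π ^ m) (KoszulReduction.diff T (ϖ ^ N' • B) Finset.univ)
        = (ϖ : L) ^ N' • (ϖ : L) ^ N • d η Finset.univ := by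
      rw [KoszulReduction.diff_smul, Pi.smul_apply, scaleRestricted_apply, Submodule.coe_smul,
        scaleSeries_smul, ← scaleRestricted_apply, ← h.d_scale hd, ← hB', map_smul,
        Pi.smul_apply, SubmonoidClass.coe_pow]
    rw [h1, ← hc, map_sum, Finset.smul_sum, Finset.smul_sum]
    refine Finset.sum_congr rfl fun i _ => ?_
    rw [scaleRestricted_apply, Submodule.coe_smul, scaleSeries_smul, scaleSeries_monomial,
      smul_smul, smul_smul, smul_smul]
    congr 1
    change (ϖ : L) ^ N' * ((ϖ : L) ^ N * (c i * ((π ^ m) ^ (μ i).degree)⁻¹)) * _ = _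
    have := hw i
    field_simp
  have h0 := h.reduction.eq_zero_of_sum_eq_diff_univ hO _ hx hsum
  funext i
  have h1 : (ϖ : L) ^ N' * ((ϖ : L) ^ N * (c i * ((π ^ m) ^ (μ i).degree)⁻¹)) = 0 :=
    congrArg Subtype.val (congrFun h0 i)
  have h2 := (mul_eq_zero.1 ((mul_eq_zero.1 h1).resolve_left
    (h.unif_pow_ne_zero N'))).resolve_left (h.unif_pow_ne_zero N)
  exact (mul_eq_zero.1 h2).resolve_right (inv_ne_zero (hw i))

end Differential

-- For a form concentrated in degree k the primitive may be taken mixed: its part of degree k-1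
-- suffices. In degree 0 the differential is an empty sum, in accordance with the zero space of
-- coboundaries.
omit [IsUltrametricDist L] in
theorem mem_coboundaries_iff
    (hd : ∀ ω t, d ω t = koszul (fun i => (D i).toAddMonoidHom) ω t) {k : ℕ} {ω : Form n L}
    (hω : ∀ t, t.card ≠ k → ω t = 0) :
    ω ∈ coboundaries π m d k ↔ ∃ η : Form n L, (∀ t, η t ∈ CSpace n π m) ∧ ω = d η := by
  constructor
  · cases k with
    | zero =>
      intro h0
      have h0' : ω = 0 := h0
      exact ⟨0, fun _ => zero_mem _, by rw [h0', map_zero]⟩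
    | succ k =>
      rintro ⟨η, hη, rfl⟩
      exact ⟨η, fun t => (hη t).1, rfl⟩
  · rintro ⟨η, hη, rfl⟩
    cases k with
    | zero =>
      have h0 : d η = 0 := funext fun t => by
        by_cases ht : t.card = 0
        · rw [Finset.card_eq_zero.1 ht, hd]; rfl
        · exact hω t ht
      rw [h0]
      exact zero_mem _
    | succ k =>
      refine ⟨fun t => if t.card + 1 = k + 1 then η t else 0, fun t => ⟨?_, fun ht => ?_⟩,
        funext fun t => ?_⟩
      · dsimp only
        split_ifs
        exacts [hη t, zero_mem _]
      · exact if_neg (by omega)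
      · rw [hd, koszul_filter_card _ (fun c => c = k + 1)]
        split_ifs with ht
        · exact (hd η t).symm
        · exact (hω t ht).symm

section Complex

variable (h : IntegralModel ϖ π m D T S ρ)
  (hd : ∀ ω t, d ω t = koszul (fun i => (D i).toAddMonoidHom) ω t)
include h hd

theorem coboundaries_le_cocycles (k : ℕ) : coboundaries π m d k ≤ cocycles π m d k := by
  cases k with
  | zero => exact bot_le
  | succ k =>
    rintro _ ⟨η, hη, rfl⟩
    refine ⟨fun t => ⟨h.d_mem_CSpace hd (fun t => (hη t).1) t, fun ht => ?_⟩, h.d_d hd η⟩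
    rw [hd, koszul_apply]
    refine Finset.sum_eq_zero fun i hi => ?_
    have hc := Finset.card_erase_add_one hi
    rw [(hη (t.erase i)).2 (by omega), map_zero, smul_zero]

theorem subsingleton_cohomology {k : ℕ} (hk : k ≠ n) : Subsingleton (Cohomology π m d k) := by
  rw [Submodule.Quotient.subsingleton_iff, Submodule.submoduleOf_eq_top]
  rintro ω ⟨hω, hdω⟩
  rw [mem_coboundaries_iff hd fun t => (hω t).2]
  exact h.exists_eq_d hd (fun t => (hω t).1) hdω ((hω _).2 (by simpa using hk.symm))

end Complex

end IntegralModel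

end Cohomology

/-! ### Commutation of the operators D_i and the coefficients of H_i. -/

section Formal

open MvPolynomial

variable {n : ℕ}

theorem pderiv_expand {R : Type*} [CommSemiring R] {q : ℕ} (hq : q ≠ 0) (i : Fin n)
    (f : MvPolynomial (Fin n) R) :
    pderiv i (expand q f) = (q : MvPolynomial (Fin n) R) * X i ^ (q - 1)
      * expand q (pderiv i f) := by
  induction f using MvPolynomial.induction_on' with
  | monomial u c =>
    rw [expand_monomial, pderiv_monomial, pderiv_monomial, expand_monomial, X_pow_eq_monomial,
      ← C_eq_coe_nat, C_mul_monomial, monomial_mul]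
    rcases Nat.eq_zero_or_pos (u i) with h | h
    · simp [h]
    · have hu : q • u - Finsupp.single i 1
          = Finsupp.single i (q - 1) + q • (u - Finsupp.single i 1) := by
        ext j
        obtain ⟨q, rfl⟩ := Nat.exists_eq_succ_of_ne_zero hq
        by_cases hj : i = j
        · subst hj
          obtain ⟨a, ha⟩ := Nat.exists_eq_succ_of_ne_zero h.ne'
          simp [ha, Nat.mul_succ]
          ring_nf
          omega
        · simp [Finsupp.single_eq_of_ne (Ne.symm hj)]
      rw [hu]
      congr 1
      simp only [Finsupp.coe_smul, Pi.smul_apply, smul_eq_mul, Nat.cast_mul]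
      ring
  | add p q hp hq => rw [map_add, map_add, hp, hq, map_add, map_add, mul_add]

theorem exists_of_coeff_expand_ne_zero {R : Type*} [CommSemiring R] {q : ℕ}
    {f : MvPolynomial (Fin n) R} {v : Fin n →₀ ℕ} (h : coeff v (expand q f) ≠ 0) :
    ∃ v', v = q • v' := by
  classical
  obtain ⟨v', -, hv'⟩ := Finset.mem_image.1 (support_expand_subset f (mem_support_iff.2 h))
  exact ⟨v', hv'.symm⟩

theorem pderiv_pderiv_comm {R : Type*} [CommSemiring R] (i j : Fin n)
    (f : MvPolynomial (Fin n) R) : pderiv i (pderiv j f) = pderiv j (pderiv i f) := by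
  ext u
  simp only [coeff_pderiv]
  rw [add_right_comm]
  by_cases h : i = j
  · rw [h]
  · simp [Finsupp.single_eq_of_ne h, Finsupp.single_eq_of_ne (Ne.symm h), mul_right_comm]

variable {K L : Type*} [Field K] [NormedField L] {p : ℕ} (j : K →+* L) (τ : K ≃+* K) (γ : L)
  (fhat : MvPolynomial (Fin n) K)

/-- The polynomial `γ_l f̂ ^ (τ ^ l) (x ^ (p ^ l))`. -/
noncomputable def potentialTerm (p : ℕ) (l : ℕ) : MvPolynomial (Fin n) L :=
  C (gammaTrunc p γ l) * expand (p ^ l) (map (j.comp ((τ ^ l : K ≃+* K) : K →+* K)) fhat)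

/-- The factor p^l x_i^(p^l-1) is the chain rule for x ↦ x^(p^l). The H_i thus have a common
potential, which is why the D_i commute. -/
theorem HTerm_eq_pderiv (hp : p ≠ 0) (i : Fin n) (l : ℕ) :
    HTerm p j τ γ fhat i l = pderiv i (potentialTerm j τ γ fhat p l) := by
  rw [potentialTerm, pderiv_C_mul, pderiv_expand (pow_ne_zero l hp), pderiv_map, HTerm, C_mul]
  simp only [map_pow, map_natCast, Nat.cast_pow]
  ring

theorem pderiv_HSeries (hp : p ≠ 0) (i i' : Fin n) :
    MvPowerSeries.pderiv L i (HSeries p j τ γ fhat i')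
      = MvPowerSeries.pderiv L i' (HSeries p j τ γ fhat i) := by
  have key : ∀ i i' u, MvPowerSeries.coeff u (MvPowerSeries.pderiv L i (HSeries p j τ γ fhat i'))
      = ∑ᶠ l : ℕ, coeff u (pderiv i (pderiv i' (potentialTerm j τ γ fhat p l))) := by
    intro i i' u
    rw [MvPowerSeries.coeff_pderiv, mul_comm]
    change _ * (∑ᶠ l : ℕ, (HTerm p j τ γ fhat i' l).coeff (u + Finsupp.single i 1)) = _
    rw [← smul_eq_mul, smul_finsum]
    refine finsum_congr fun l => ?_
    rw [smul_eq_mul, mul_comm, HTerm_eq_pderiv j τ γ fhat hp, coeff_pderiv (i := i)]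
  ext u
  rw [key, key]
  exact finsum_congr fun l => by rw [pderiv_pderiv_comm]

theorem DOp_apply (i : Fin n) (ξ : MvPowerSeries (Fin n) L) :
    DOp p j τ γ fhat i ξ = MvPowerSeries.pderiv L i ξ + HSeries p j τ γ fhat i * ξ := rfl

theorem mvPowerSeries_pderiv_comm (i i' : Fin n) (ξ : MvPowerSeries (Fin n) L) :
    MvPowerSeries.pderiv L i (MvPowerSeries.pderiv L i' ξ)
      = MvPowerSeries.pderiv L i' (MvPowerSeries.pderiv L i ξ) := by
  ext u
  simp only [MvPowerSeries.coeff_pderiv]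
  rw [add_right_comm]
  by_cases h : i = i'
  · rw [h]
  · simp [Finsupp.single_eq_of_ne h, Finsupp.single_eq_of_ne (Ne.symm h), mul_right_comm]

/-- The commutator is multiplication by ∂_i H_i' - ∂_i' H_i, which vanishes by symmetry of second
derivatives of the potential. -/
theorem DOp_comm (hp : p ≠ 0) (i i' : Fin n) (ξ : MvPowerSeries (Fin n) L) :
    DOp p j τ γ fhat i (DOp p j τ γ fhat i' ξ) = DOp p j τ γ fhat i' (DOp p j τ γ fhat i ξ) := by
  simp only [DOp_apply, map_add, Derivation.leibniz, smul_eq_mul]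
  rw [mvPowerSeries_pderiv_comm i i', pderiv_HSeries j τ γ fhat hp i i']
  ring

theorem piD_apply_eq_koszul (π : L) (ε : ℤ) (ω : Form n L) (t : Finset (Fin n)) :
    piD p j τ γ π ε fhat ω t
      = koszul (fun i => (π ^ ε • DOp p j τ γ fhat i).toAddMonoidHom) ω t := by
  rw [koszul_apply, piD, LinearMap.smul_apply, Pi.smul_apply, DForm, LinearMap.pi_apply,
    LinearMap.sum_apply, Finset.smul_sum]
  refine Finset.sum_congr rfl fun i _ => ?_
  rw [LinearMap.smul_apply, smul_comm, wedgeSign, ← Int.cast_smul_eq_zsmul L]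
  push_cast
  rfl

theorem coeff_HTerm_eq (hp : p ≠ 0) (i : Fin n) (l : ℕ) (u : Fin n →₀ ℕ) :
    coeff u (HTerm p j τ γ fhat i l) = 0 ∨ ∃ v : Fin n →₀ ℕ, u + Finsupp.single i 1 = p ^ l • v ∧
      coeff u (HTerm p j τ γ fhat i l)
        = gammaTrunc p γ l * (p : L) ^ l * ((v i : L) * j ((τ ^ l : K ≃+* K) (fhat.coeff v))) := by
  by_cases h : coeff (u + Finsupp.single i 1)
      (expand (p ^ l) (map (j.comp ((τ ^ l : K ≃+* K) : K →+* K)) fhat)) = 0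
  · left
    rw [HTerm_eq_pderiv j τ γ fhat hp, potentialTerm, pderiv_C_mul, coeff_C_mul, coeff_pderiv, h]
    simp
  · right
    obtain ⟨v, hv⟩ := exists_of_coeff_expand_ne_zero h
    refine ⟨v, hv, ?_⟩
    have h1 : ((u i : L) + 1) = (p : L) ^ l * v i := by
      have := congrArg (fun w : Fin n →₀ ℕ => w i) hv
      simp only [Finsupp.add_apply, Finsupp.single_eq_same, Finsupp.smul_apply,
        smul_eq_mul] at this
      exact_mod_cast congrArg (Nat.cast : ℕ → L) this
    rw [HTerm_eq_pderiv j τ γ fhat hp, potentialTerm, pderiv_C_mul, coeff_C_mul, coeff_pderiv, hv,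
      coeff_expand_smul (p ^ l) (pow_ne_zero l hp), coeff_map, h1]
    simp only [RingHom.comp_apply, RingHom.coe_coe]
    ring

theorem coeff_HTerm_zero (i : Fin n) (u : Fin n →₀ ℕ) :
    coeff u (HTerm p j τ γ fhat i 0)
      = γ * (((u i : L) + 1) * j (fhat.coeff (u + Finsupp.single i 1))) := by
  simp only [HTerm, gammaTrunc, pow_zero, mul_one, zero_add, Finset.range_one, Finset.sum_singleton,
    pow_one, div_one, tsub_self, expand_one_apply, coeff_C_mul, coeff_map, coeff_pderiv, map_mul,
    map_add, map_natCast, map_one]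
  simp only [RingHom.comp_apply, RingHom.coe_coe]
  rw [mul_comm (j _)]
  rfl

end Formal

/-! ### Integrality and reduction of the rescaled operators. -/

section Estimates

variable {K L : Type*} [Field K] [NormedField L] [IsUltrametricDist L] {n : ℕ}

theorem norm_finsum_le_of_forall_le {κ : Type*} {g : κ → L} {C : ℝ} (hC : 0 ≤ C)
    (h : ∀ i, ‖g i‖ ≤ C) : ‖∑ᶠ i, g i‖ ≤ C :=
  finsum_induction (fun x => ‖x‖ ≤ C) (by simpa using hC)
    (fun x y hx hy => (IsUltrametricDist.norm_add_le_max x y).trans (max_le hx hy)) h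

/-- The hypotheses on the norms of the parameters that make the operators `π ^ ε D_i` integral:
`r l` bounds the norm of the `l`-th term of `π ^ ε H_i`. -/
structure Bounds (p : ℕ) (j : K →+* L) (τ : K ≃+* K) (γ π : L) (m d : ℕ) (ε : ℤ)
    (fhat : MvPolynomial (Fin n) K) (r : ℕ → ℝ) : Prop where
  prime : p.Prime
  scale_pos : 1 ≤ m
  pi_ne_zero : π ≠ 0
  pi_lt_one : ‖π‖ < 1
  coeff_le : ∀ l v, ‖j ((τ ^ l : K ≃+* K) (fhat.coeff v))‖ ≤ 1
  coeff_eq_zero : ∀ v : Fin n →₀ ℕ, d < v.degree → fhat.coeff v = 0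
  term_le : ∀ l, ‖π‖ ^ ε * ‖gammaTrunc p γ l * (p : L) ^ l‖ ≤ r l * ‖π‖ ^ (m * (p ^ l * d - 1))
  gamma_eq : ‖π‖ ^ ε * ‖γ‖ = ‖π‖ ^ (m * (d - 1))
  deriv_lt : ‖π ^ ε * π ^ m‖ < 1
  r_zero : r 0 = 1
  r_lt : ∀ l, l ≠ 0 → r l < 1
  r_tendsto : Filter.Tendsto r Filter.atTop (nhds 0)

namespace Bounds

variable {p : ℕ} {j : K →+* L} {τ : K ≃+* K} {γ π : L} {m d : ℕ} {ε : ℤ}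
  {fhat : MvPolynomial (Fin n) K} {r : ℕ → ℝ}

/-- The coefficient at `x ^ u` of the `l`-th term of `π ^ ε H_i`, divided by `π ^ (m |u|)`. -/
noncomputable def scaledTerm (p : ℕ) (j : K →+* L) (τ : K ≃+* K) (γ π : L) (m : ℕ) (ε : ℤ)
    (fhat : MvPolynomial (Fin n) K) (i : Fin n) (u : Fin n →₀ ℕ) (l : ℕ) : L :=
  π ^ ε * (HTerm p j τ γ fhat i l).coeff u / (π ^ m) ^ u.degree

variable (h : Bounds p j τ γ π m d ε fhat r)
include h

omit [IsUltrametricDist L] in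
theorem pi_pos : 0 < ‖π‖ := norm_pos_iff.2 h.pi_ne_zero

omit [IsUltrametricDist L] in
theorem r_nonneg (l : ℕ) : 0 ≤ r l :=
  nonneg_of_mul_nonneg_left ((by positivity : (0 : ℝ) ≤ _).trans (h.term_le l))
    (pow_pos h.pi_pos _)

omit [IsUltrametricDist L] in
theorem r_le_one (l : ℕ) : r l ≤ 1 := by
  rcases eq_or_ne l 0 with rfl | hl
  · exact h.r_zero.le
  · exact (h.r_lt l hl).le

/-- A nonzero coefficient forces u + e_i = p^l v with |v| ≤ d. This bounds |u| from above, which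
sets the worst scaling factor, and bounds l by l < p^l ≤ u_i + 1, so only finitely many l contribute
to a given u. -/
theorem scaledTerm_bound (i : Fin n) (u : Fin n →₀ ℕ) (l : ℕ) :
    scaledTerm p j τ γ π m ε fhat i u l = 0 ∨
      (u.degree < p ^ l * d ∧ l < u i + 1 ∧ ‖scaledTerm p j τ γ π m ε fhat i u l‖ ≤ r l) := by
  rcases coeff_HTerm_eq j τ γ fhat h.prime.ne_zero i l u with h0 | ⟨v, hv, hc⟩
  · left; rw [scaledTerm, h0]; simp
  by_cases hvd : d < v.degree
  · left
    rw [scaledTerm, hc, h.coeff_eq_zero v hvd]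
    simp
  right
  have hdeg : u.degree + 1 = p ^ l * v.degree := by
    have := congrArg Finsupp.degree hv
    rwa [map_add, Finsupp.degree_single, map_nsmul, smul_eq_mul] at this
  have hui : u i + 1 = p ^ l * v i := by
    have := congrArg (fun w : Fin n →₀ ℕ => w i) hv
    simpa using this
  have hle : p ^ l * v.degree ≤ p ^ l * d := Nat.mul_le_mul_left _ (not_lt.1 hvd)
  refine ⟨by omega, ?_, ?_⟩
  · have hvi : 1 ≤ v i := Nat.one_le_iff_ne_zero.2 fun h0 => by rw [h0] at hui; omega
    rw [hui]
    exact (Nat.lt_pow_self h.prime.one_lt).trans_le (Nat.le_mul_of_pos_right _ hvi)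
  · have hcn : ‖(HTerm p j τ γ fhat i l).coeff u‖ ≤ ‖gammaTrunc p γ l * (p : L) ^ l‖ := by
      rw [hc, norm_mul (gammaTrunc p γ l * (p : L) ^ l)]
      refine mul_le_of_le_one_right (norm_nonneg _) ?_
      rw [norm_mul]
      exact mul_le_one₀ (IsUltrametricDist.norm_natCast_le_one L _) (norm_nonneg _)
        (h.coeff_le l v)
    rw [scaledTerm, norm_div, norm_mul, norm_zpow, norm_pow, norm_pow, ← pow_mul,
      div_le_iff₀ (pow_pos h.pi_pos _)]
    calc _ ≤ ‖π‖ ^ ε * ‖gammaTrunc p γ l * (p : L) ^ l‖ :=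
          mul_le_mul_of_nonneg_left hcn (zpow_nonneg (norm_nonneg _) _)
      _ ≤ _ := h.term_le l
      _ ≤ _ := mul_le_mul_of_nonneg_left (pow_le_pow_of_le_one (norm_nonneg _) h.pi_lt_one.le
          (Nat.mul_le_mul_left _ (by omega))) (h.r_nonneg l)

theorem norm_scaledTerm_le (i : Fin n) (u : Fin n →₀ ℕ) (l : ℕ) :
    ‖scaledTerm p j τ γ π m ε fhat i u l‖ ≤ r l := by
  rcases h.scaledTerm_bound i u l with h0 | h0
  · rw [h0, norm_zero]; exact h.r_nonneg l
  · exact h0.2.2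

theorem finite_support_scaledTerm (i : Fin n) (u : Fin n →₀ ℕ) :
    (Function.support (scaledTerm p j τ γ π m ε fhat i u)).Finite :=
  (Set.finite_lt_nat (u i + 1)).subset fun l hl =>
    ((h.scaledTerm_bound i u l).resolve_left hl).2.1

omit [IsUltrametricDist L] h in
theorem coeff_HSeries_eq_finsum (i : Fin n) (u : Fin n →₀ ℕ) :
    π ^ ε * MvPowerSeries.coeff u (HSeries p j τ γ fhat i) / (π ^ m) ^ u.degree
      = ∑ᶠ l, scaledTerm p j τ γ π m ε fhat i u l := by
  change π ^ ε * (∑ᶠ l : ℕ, (HTerm p j τ γ fhat i l).coeff u) / _ = _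
  rw [div_eq_inv_mul, ← mul_assoc, ← smul_eq_mul, smul_finsum]
  refine finsum_congr fun l => ?_
  rw [smul_eq_mul, scaledTerm, div_eq_inv_mul, mul_assoc]

theorem norm_sum_le (i : Fin n) (u : Fin n →₀ ℕ) :
    ‖π ^ ε * MvPowerSeries.coeff u (HSeries p j τ γ fhat i) / (π ^ m) ^ u.degree‖ ≤ 1 := by
  rw [coeff_HSeries_eq_finsum]
  exact norm_finsum_le_of_forall_le zero_le_one fun l =>
    (h.norm_scaledTerm_le i u l).trans (h.r_le_one l)

/-- The series `π ^ ε H_i` in the scaled variables. -/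
noncomputable def scaledH (h : Bounds p j τ γ π m d ε fhat r) (i : Fin n) :
    MvPowerSeries (Fin n) (integers L) :=
  fun u => ⟨_, mem_integers.2 (h.norm_sum_le i u)⟩

theorem coeff_scaledH (i : Fin n) (u : Fin n →₀ ℕ) :
    ((MvPowerSeries.coeff u (h.scaledH i) : integers L) : L)
      = ∑ᶠ l, scaledTerm p j τ γ π m ε fhat i u l :=
  coeff_HSeries_eq_finsum i u

theorem scaleSeries_scaledH (i : Fin n) :
    scaleSeries (π ^ m) (h.scaledH i) = π ^ ε • HSeries p j τ γ fhat i := by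
  ext u
  rw [coeff_scaleSeries, MvPowerSeries.coeff_smul]
  exact div_mul_cancel₀ _ (pow_ne_zero _ (pow_ne_zero _ h.pi_ne_zero))

theorem scaledH_mem_restrictedSeries {ϖ : integers L} (hϖ : ϖ ≠ 0) (i : Fin n) :
    h.scaledH i ∈ restrictedSeries n ϖ := by
  intro N
  have hpos : 0 < ‖(ϖ : L)‖ ^ N := pow_pos (norm_pos_iff.2 fun h => hϖ (Subtype.ext h)) N
  -- When |u| ≥ p^l₀ d, terms with l < l₀ have no coefficient at u, and the others have norm at most
  -- ‖ϖ‖^N.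
  obtain ⟨l₀, hl₀⟩ := Filter.eventually_atTop.1 (h.r_tendsto.eventually_le_const hpos)
  refine (Finset.finite_toSet ((Finset.range (p ^ l₀ * d)).biUnion fun k =>
    Finset.finsuppAntidiag (Finset.univ : Finset (Fin n)) k)).subset fun u hu => ?_
  by_contra hnot
  refine hu ?_
  rw [integers_dvd_iff (pow_ne_zero N hϖ), h.coeff_scaledH, SubmonoidClass.coe_pow, norm_pow]
  refine norm_finsum_le_of_forall_le hpos.le fun l => ?_
  rcases h.scaledTerm_bound i u l with h0 | ⟨h1, -, h2⟩
  · rw [h0, norm_zero]; exact hpos.le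
  · refine h2.trans (hl₀ l ?_)
    by_contra hlt
    refine hnot ?_
    simp only [Finset.coe_biUnion, Set.mem_iUnion, Finset.mem_coe, Finset.mem_finsuppAntidiag,
      Finset.mem_range, Finset.subset_univ, and_true, exists_prop]
    refine ⟨u.degree, h1.trans_le (Nat.mul_le_mul_right _
      (Nat.pow_le_pow_right h.prime.pos (by omega))), ?_⟩
    rw [Finsupp.degree_eq_sum]

/-- The unit by which the reduction of `π ^ ε H_i` differs from the leading partial derivative. -/
noncomputable def leadingUnit (h : Bounds p j τ γ π m d ε fhat r) : integers L :=
  ⟨π ^ ε * γ / (π ^ m) ^ (d - 1), mem_integers.2 (by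
    rw [norm_div, norm_mul, norm_zpow, h.gamma_eq, norm_pow, norm_pow, ← pow_mul,
      div_self (pow_pos h.pi_pos _).ne'])⟩

theorem residue_leadingUnit_ne_zero : IsLocalRing.residue (integers L) h.leadingUnit ≠ 0 := by
  rw [Ne, residue_eq_zero_iff, not_lt]
  change 1 ≤ ‖π ^ ε * γ / (π ^ m) ^ (d - 1)‖
  rw [norm_div, norm_mul, norm_zpow, h.gamma_eq, norm_pow, norm_pow, ← pow_mul,
    div_self (pow_pos h.pi_pos _).ne']

theorem coeff_mem_integers (v : Fin n →₀ ℕ) : j (fhat.coeff v) ∈ integers L :=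
  mem_integers.2 (h.coeff_le 0 v)

theorem norm_scaledH_sub_lt {ϖ : integers L} (hϖ1 : ‖(ϖ : L)‖ < 1)
    (hmax : ∀ x : L, ‖x‖ < 1 → ‖x‖ ≤ ‖(ϖ : L)‖) (i : Fin n) (u : Fin n →₀ ℕ) :
    ‖((MvPowerSeries.coeff u (h.scaledH i) : integers L) : L)
      - scaledTerm p j τ γ π m ε fhat i u 0‖ < 1 := by
  have hfin := h.finite_support_scaledTerm i u
  have h1 : ∑ᶠ l, scaledTerm p j τ γ π m ε fhat i u l
      = scaledTerm p j τ γ π m ε fhat i u 0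
        + ∑ᶠ l, if l = 0 then 0 else scaledTerm p j τ γ π m ε fhat i u l := by
    have h2 : scaledTerm p j τ γ π m ε fhat i u 0
        = ∑ᶠ l, if l = 0 then scaledTerm p j τ γ π m ε fhat i u l else 0 := by
      rw [finsum_eq_single _ 0 fun l hl => if_neg hl, if_pos rfl]
    rw [h2, ← finsum_add_distrib]
    · exact finsum_congr fun l => by split_ifs <;> simp
    · refine hfin.subset fun l hl => ?_
      rw [Function.mem_support] at hl ⊢
      split_ifs at hl
      exacts [hl, absurd rfl hl]
    · refine hfin.subset fun l hl => ?_
      rw [Function.mem_support] at hl ⊢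
      split_ifs at hl
      exacts [absurd rfl hl, hl]
  rw [h.coeff_scaledH, h1, add_sub_cancel_left]
  -- Discreteness of the norm turns the separate strict bounds into the uniform bound ‖ϖ‖, so the
  -- sum is also strictly below 1.
  refine (norm_finsum_le_of_forall_le (norm_nonneg (ϖ : L)) fun l => ?_).trans_lt hϖ1
  split_ifs with hl
  · rw [norm_zero]; exact norm_nonneg _
  · exact hmax _ ((h.norm_scaledTerm_le i u l).trans_lt (h.r_lt l hl))

/-- Only l = 0 matters. In degree d-1 its factor π^ε γ / π^(m(d-1)) is a unit; in lower degrees less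
is divided out and the norm drops below 1; in higher degrees f̂ has no coefficients left. -/
theorem residue_coeff_scaledH {ϖ : integers L} (hϖ1 : ‖(ϖ : L)‖ < 1)
    (hmax : ∀ x : L, ‖x‖ < 1 → ‖x‖ ≤ ‖(ϖ : L)‖) (i : Fin n) (u : Fin n →₀ ℕ) :
    IsLocalRing.residue (integers L) (MvPowerSeries.coeff u (h.scaledH i))
      = if u.degree + 1 = d then IsLocalRing.residue (integers L) h.leadingUnit
        * (IsLocalRing.residue (integers L)
          ⟨_, h.coeff_mem_integers (u + Finsupp.single i 1)⟩
            * ((u i : IsLocalRing.ResidueField (integers L)) + 1))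
        else 0 := by
  have hsub := h.norm_scaledH_sub_lt hϖ1 hmax i u
  have hterm : scaledTerm p j τ γ π m ε fhat i u 0 = π ^ ε * γ / (π ^ m) ^ u.degree
      * (((u i : L) + 1) * j (fhat.coeff (u + Finsupp.single i 1))) := by
    rw [scaledTerm, coeff_HTerm_zero]; ring
  split_ifs with hd
  · have hmul : IsLocalRing.residue (integers L) h.leadingUnit
        * (IsLocalRing.residue (integers L)
          ⟨_, h.coeff_mem_integers (u + Finsupp.single i 1)⟩
            * ((u i : IsLocalRing.ResidueField (integers L)) + 1))
        = IsLocalRing.residue (integers L) (h.leadingUnit *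
          (⟨_, h.coeff_mem_integers (u + Finsupp.single i 1)⟩ * ((u i : integers L) + 1))) := by
      simp only [map_mul, map_add, map_natCast, map_one]
    rw [hmul, ← sub_eq_zero, ← map_sub, residue_eq_zero_iff]
    convert hsub using 2
    rw [hterm, AddSubgroupClass.coe_sub]
    congr 1
    have hd' : d - 1 = u.degree := by omega
    simp only [MulMemClass.coe_mul, AddMemClass.coe_add, OneMemClass.coe_one, leadingUnit, hd']
    push_cast
    ring
  · rw [residue_eq_zero_iff]
    have hlt : ‖scaledTerm p j τ γ π m ε fhat i u 0‖ < 1 := by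
      rcases Nat.lt_or_ge (u.degree + 1) d with hlt | hge
      · have hci : ‖((u i : L) + 1) * j (fhat.coeff (u + Finsupp.single i 1))‖ ≤ 1 := by
          rw [norm_mul]
          refine mul_le_one₀ ?_ (norm_nonneg _) (h.coeff_le 0 _)
          exact_mod_cast IsUltrametricDist.norm_natCast_le_one L (u i + 1)
        rw [hterm, norm_mul]
        refine (mul_le_of_le_one_right (norm_nonneg _) hci).trans_lt ?_
        rw [norm_div, norm_mul, norm_zpow, h.gamma_eq, norm_pow, norm_pow, ← pow_mul,
          div_lt_one (pow_pos h.pi_pos _)]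
        exact pow_lt_pow_right_of_lt_one₀ h.pi_pos h.pi_lt_one
          (Nat.mul_lt_mul_of_pos_left (by omega) h.scale_pos)
      · rw [hterm, h.coeff_eq_zero]
        · simp
        · rw [map_add, Finsupp.degree_single]; omega
    have := (IsUltrametricDist.norm_add_le_max _ _).trans_lt (max_lt hsub hlt)
    rwa [sub_add_cancel] at this

theorem reduction_scaledH {ϖ : integers L} (hϖ : ϖ ≠ 0) (hϖ1 : ‖(ϖ : L)‖ < 1)
    (hmax : ∀ x : L, ‖x‖ < 1 → ‖x‖ ≤ ‖(ϖ : L)‖) {F : Type*} [Field F]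
    [Algebra F (IsLocalRing.ResidueField (integers L))] (f : MvPolynomial (Fin n) F)
    (hf : ∀ v, algebraMap F (IsLocalRing.ResidueField (integers L)) (f.coeff v)
      = IsLocalRing.residue (integers L) ⟨_, h.coeff_mem_integers v⟩) (i : Fin n) :
    reduction (IsLocalRing.residue (integers L)) (residue_eq_zero_iff_dvd hϖ hϖ1 hmax)
        ⟨_, h.scaledH_mem_restrictedSeries hϖ i⟩
      = MvPolynomial.C (IsLocalRing.residue (integers L) h.leadingUnit)
        * MvPolynomial.map (algebraMap F (IsLocalRing.ResidueField (integers L)))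
          (leadingPartial d f i) := by
  ext u
  rw [coeff_reduction, h.residue_coeff_scaledH hϖ1 hmax, MvPolynomial.coeff_C_mul,
    MvPolynomial.coeff_map, leadingPartial, MvPolynomial.coeff_pderiv,
    MvPolynomial.coeff_homogeneousComponent, map_add, Finsupp.degree_single]
  split_ifs
  · rw [map_mul, hf]
    simp only [map_add, map_natCast, map_one]
  · simp

theorem map_scale_DOp {ϖ : integers L} (hϖ : ϖ ≠ 0) (i : Fin n) (A : restrictedSeries n ϖ) :
    (π ^ ε • DOp p j τ γ fhat i) (scaleRestricted ϖ (π ^ m) A)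
      = scaleRestricted ϖ (π ^ m) (restrictedOp ⟨π ^ ε * π ^ m, mem_integers.2 h.deriv_lt.le⟩
        (fun i => ⟨_, h.scaledH_mem_restrictedSeries hϖ i⟩) i A) := by
  rw [scaleRestricted_apply, scaleRestricted_apply, coe_restrictedOp, map_add, scaleSeries_smul,
    scaleSeries_mul, h.scaleSeries_scaledH, LinearMap.smul_apply, DOp_apply, pderiv_scaleSeries,
    smul_add, smul_smul, smul_mul_assoc]

theorem integralModel {ϖ : integers L} [CompleteSpace L] (hϖ : ϖ ≠ 0) (hϖ1 : ‖(ϖ : L)‖ < 1)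
    (hmax : ∀ x : L, ‖x‖ < 1 → ‖x‖ ≤ ‖(ϖ : L)‖) {F : Type*} [Field F]
    [Algebra F (IsLocalRing.ResidueField (integers L))] (f : MvPolynomial (Fin n) F)
    (hf : ∀ v, algebraMap F (IsLocalRing.ResidueField (integers L)) (f.coeff v)
      = IsLocalRing.residue (integers L) ⟨_, h.coeff_mem_integers v⟩)
    (hreg : RingTheory.Sequence.IsWeaklyRegular (MvPolynomial (Fin n) F)
      (List.ofFn (leadingPartial d f))) :
    IntegralModel ϖ π m (fun i => π ^ ε • DOp p j τ γ fhat i)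
      (restrictedOp ⟨π ^ ε * π ^ m, mem_integers.2 h.deriv_lt.le⟩
        (fun i => ⟨_, h.scaledH_mem_restrictedSeries hϖ i⟩))
      (fun i => AddMonoidHom.mulLeft
        (MvPolynomial.C (IsLocalRing.residue (integers L) h.leadingUnit)
        * MvPolynomial.map (algebraMap F (IsLocalRing.ResidueField (integers L)))
          (leadingPartial d f i)))
      (reduction (IsLocalRing.residue (integers L)) (residue_eq_zero_iff_dvd hϖ hϖ1 hmax)) := by
  have hcomm : ∀ i i' ξ, (π ^ ε • DOp p j τ γ fhat i) ((π ^ ε • DOp p j τ γ fhat i') ξ)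
      = (π ^ ε • DOp p j τ γ fhat i') ((π ^ ε • DOp p j τ γ fhat i) ξ) := fun i i' ξ => by
    simp only [LinearMap.smul_apply, map_smul]
    rw [DOp_comm j τ γ fhat h.prime.ne_zero]
  refine ⟨hϖ, hϖ1, h.pi_ne_zero, hcomm, h.map_scale_DOp hϖ, ?_⟩
  refine koszulReduction_restrictedOp _ _ hϖ (integers_separated hϖ1)
    (integers_precomplete hϖ hϖ1) IsLocalRing.residue_surjective ?_ (fun i i' A => ?_) hreg
    h.residue_leadingUnit_ne_zero (h.reduction_scaledH hϖ hϖ1 hmax f hf)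
  · rw [integers_dvd_iff hϖ]
    exact hmax _ h.deriv_lt
  -- Commutation of the integral operators is inherited from that of the D_i through the injective
  -- rescaling.
  · refine Subtype.ext (scaleSeries_injective (pow_ne_zero m h.pi_ne_zero) ?_)
    simp only [← scaleRestricted_apply, ← h.map_scale_DOp hϖ]
    exact hcomm i i' _

end Bounds

end Estimates

/-! ### The monomial basis of the top cohomology. -/

section TopCohomology

variable {K L : Type*} [Field K] [NormedField L] [IsUltrametricDist L] {n : ℕ}

omit [IsUltrametricDist L] in
theorem topForm_univ (μ : Fin n →₀ ℕ) :
    (topForm μ : Form n L) Finset.univ = MvPowerSeries.monomial μ 1 := by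
  rw [topForm, Pi.single_eq_same]

namespace Bounds

variable {p : ℕ} {j : K →+* L} {τ : K ≃+* K} {γ π : L} {m d : ℕ} {ε : ℤ}
  {fhat : MvPolynomial (Fin n) K} {r : ℕ → ℝ}

variable (h : Bounds p j τ γ π m d ε fhat r) {ϖ : integers L} [CompleteSpace L] (hϖ : ϖ ≠ 0)
  (hϖ1 : ‖(ϖ : L)‖ < 1) (hmax : ∀ x : L, ‖x‖ < 1 → ‖x‖ ≤ ‖(ϖ : L)‖) {F : Type*} [Field F]
  [Algebra F (IsLocalRing.ResidueField (integers L))] (f : MvPolynomial (Fin n) F)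
  (hf : ∀ v, algebraMap F (IsLocalRing.ResidueField (integers L)) (f.coeff v)
    = IsLocalRing.residue (integers L) ⟨_, h.coeff_mem_integers v⟩)
  (hreg : RingTheory.Sequence.IsWeaklyRegular (MvPolynomial (Fin n) F)
    (List.ofFn (leadingPartial d f)))
include hϖ hϖ1 hmax hf hreg

theorem isComplex (k : ℕ) :
    coboundaries π m (piD p j τ γ π ε fhat) k ≤ cocycles π m (piD p j τ γ π ε fhat) k :=
  (h.integralModel hϖ hϖ1 hmax f hf hreg).coboundaries_le_cocycles
    (piD_apply_eq_koszul j τ γ fhat π ε) k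

theorem cohomology_subsingleton {k : ℕ} (hk : k ≠ n) :
    Subsingleton (Cohomology π m (piD p j τ γ π ε fhat) k) :=
  (h.integralModel hϖ hϖ1 hmax f hf hreg).subsingleton_cohomology
    (piD_apply_eq_koszul j τ γ fhat π ε) hk

variable {κ : Type*} [Fintype κ] {μ : κ → Fin n →₀ ℕ} (hμ : IsMonomialBasis d f μ)
include hμ

theorem linearIndependent_topClass :
    LinearIndependent L (fun i => topClass h.pi_ne_zero m p j τ γ ε fhat (μ i)) := by
  rw [Fintype.linearIndependent_iff]
  intro c hc
  have h1 : (Submodule.Quotient.mk (∑ i, c i • ⟨topForm (μ i),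
      topForm_mem_cocycles h.pi_ne_zero m p j τ γ ε fhat (μ i)⟩) :
      Cohomology π m (piD p j τ γ π ε fhat) n) = 0 := by
    rw [← hc, ← Submodule.mkQ_apply, map_sum]
    exact Finset.sum_congr rfl fun i _ => map_smul _ _ _
  rw [Submodule.Quotient.mk_eq_zero, Submodule.submoduleOf,
    Submodule.mem_comap, Submodule.subtype_apply, Submodule.coe_sum] at h1
  obtain ⟨η, hη, he⟩ := (IntegralModel.mem_coboundaries_iff
    (piD_apply_eq_koszul j τ γ fhat π ε) (fun t ht => by
      rw [Finset.sum_apply]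
      refine Finset.sum_eq_zero fun i _ => ?_
      exact (congrArg (c i • ·) ((topForm_mem_OmegaC h.pi_ne_zero m (μ i) t).2 ht)).trans
        (smul_zero _))).1 h1
  have he' := congrFun he Finset.univ
  rw [Finset.sum_apply] at he'
  refine congrFun ((h.integralModel hϖ hϖ1 hmax f hf hreg).eq_zero_of_sum_eq_d
    (piD_apply_eq_koszul j τ γ fhat π ε) μ (integers_separated hϖ1) ?_ hη (c := c) ?_)
  · intro c w hw i
    rw [reduction_sum_smul_monomial] at hw
    have hmem := (exists_koszul_univ_iff _
      (h.residue_leadingUnit_ne_zero.isUnit.map MvPolynomial.C) _).1 ⟨w, hw⟩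
    -- Modulo ϖ the relation places a combination of the monomials in the extended Jacobian ideal,
    -- so its coefficients vanish in the residue field.
    have h0 := congrFun (eq_zero_of_sum_mem_span_map hμ.eq_zero hmem) i
    obtain ⟨c', hc'⟩ := (residue_eq_zero_iff_dvd hϖ hϖ1 hmax _).1 h0
    exact ⟨c', hc'⟩
  · rw [← he']
    exact Finset.sum_congr rfl fun i _ => (congrArg (c i • ·) (topForm_univ (μ i))).symm

theorem span_topClass :
    Submodule.span L (Set.range fun i => topClass h.pi_ne_zero m p j τ γ ε fhat (μ i)) = ⊤ := by
  refine eq_top_iff.2 fun x _ => ?_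
  obtain ⟨⟨ω, hω, hdω⟩, rfl⟩ := Submodule.Quotient.mk_surjective _ x
  obtain ⟨c, η, hη, hc⟩ := (h.integralModel hϖ hϖ1 hmax f hf hreg).exists_eq_sum_add_d
    (piD_apply_eq_koszul j τ γ fhat π ε) μ (integers_precomplete hϖ hϖ1) (fun v => by
      obtain ⟨c, hc⟩ := exists_sub_mem_span_map hμ.exists_sub_mem v
      obtain ⟨w, hw⟩ := (exists_koszul_univ_iff _
        (h.residue_leadingUnit_ne_zero.isUnit.map MvPolynomial.C) _).2 hc
      choose c' hc' using fun i => IsLocalRing.residue_surjective (c i)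
      refine ⟨c', w, ?_⟩
      rw [reduction_sum_smul_monomial, ← hw]
      simp only [hc', add_sub_cancel]) (hω Finset.univ).1
  rw [Submodule.mem_span_range_iff_exists_fun]
  refine ⟨c, ?_⟩
  have h1 : ∑ i, c i • topClass h.pi_ne_zero m p j τ γ ε fhat (μ i)
      = (Submodule.Quotient.mk (∑ i, c i • ⟨topForm (μ i),
      topForm_mem_cocycles h.pi_ne_zero m p j τ γ ε fhat (μ i)⟩) :
      Cohomology π m (piD p j τ γ π ε fhat) n) := by
    rw [← Submodule.mkQ_apply, map_sum]
    exact Finset.sum_congr rfl fun i _ =>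
      (map_smul (Submodule.mkQ ((coboundaries π m (piD p j τ γ π ε fhat) n).submoduleOf _))
        _ _).symm
  rw [h1, eq_comm, Submodule.Quotient.eq, Submodule.submoduleOf,
    Submodule.mem_comap, Submodule.subtype_apply, AddSubgroupClass.coe_sub,
    Submodule.coe_sum]
  have htop : ∀ t : Finset (Fin n), t.card ≠ n →
      (∑ i, c i • topForm (μ i) : Form n L) t = 0 := fun t ht => by
    rw [Finset.sum_apply]
    refine Finset.sum_eq_zero fun i _ => ?_
    rw [Pi.smul_apply, (topForm_mem_OmegaC h.pi_ne_zero m (μ i) t).2 ht, smul_zero]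
  -- The identity involving η is known only at `univ`; keeping the part of η of degree n-1 makes it
  -- hold at every index set.
  refine (IntegralModel.mem_coboundaries_iff (piD_apply_eq_koszul j τ γ fhat π ε)
    (fun t ht => ?_)).2 ⟨fun t => if t.card + 1 = n then η t else 0, fun t => ?_,
      funext fun t => ?_⟩
  · change ω t - (∑ i, c i • topForm (μ i) : Form n L) t = 0
    rw [(hω t).2 ht, htop t ht, sub_zero]
  · dsimp only
    split_ifs
    exacts [hη t, zero_mem _]
  · rw [piD_apply_eq_koszul, koszul_filter_card _ (fun c => c = n)]
    change ω t - (∑ i, c i • topForm (μ i) : Form n L) t = _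
    split_ifs with ht
    · have hu : t = Finset.univ := (Finset.card_eq_iff_eq_univ t).1 (by simpa using ht)
      rw [← piD_apply_eq_koszul, hu, hc, Finset.sum_apply, sub_eq_iff_eq_add, add_comm]
      congr 1
      refine Finset.sum_congr rfl fun i _ => ?_
      rw [Pi.smul_apply, topForm_univ]
    · rw [(hω t).2 ht, htop t ht, sub_zero]

end Bounds

end TopCohomology

/-! ### The p-adic fields: uniformizer, finiteness and residue field. -/

section FieldTheory

/-- In an ultrametric space the open unit ball is also closed, hence compact here, and the norm
attains its maximum on it. -/
theorem exists_uniformizer {L : Type*} [NormedField L] [IsUltrametricDist L] [ProperSpace L]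
    {x₀ : L} (h0 : x₀ ≠ 0) (h1 : ‖x₀‖ < 1) :
    ∃ ϖ : integers L, ϖ ≠ 0 ∧ ‖(ϖ : L)‖ < 1 ∧ ∀ x : L, ‖x‖ < 1 → ‖x‖ ≤ ‖(ϖ : L)‖ := by
  have hc : IsCompact (Metric.ball (0 : L) 1) :=
    Metric.isCompact_of_isClosed_isBounded (IsUltrametricDist.isClosed_ball 0 1)
      Metric.isBounded_ball
  obtain ⟨ϖ, hϖ, hmax⟩ := hc.exists_isMaxOn ⟨x₀, by simpa using h1⟩ continuous_norm.continuousOn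
  have hϖ1 : ‖ϖ‖ < 1 := by simpa using hϖ
  have hmax' : ∀ x : L, ‖x‖ < 1 → ‖x‖ ≤ ‖ϖ‖ := fun x hx => hmax (by simpa using hx)
  refine ⟨⟨ϖ, mem_integers.2 hϖ1.le⟩, fun h => ?_, hϖ1, hmax'⟩
  have h2 : ϖ = 0 := congrArg Subtype.val h
  have h3 := hmax' x₀ h1
  rw [h2, norm_zero] at h3
  exact h0 (norm_le_zero_iff.1 h3)

theorem norm_le_one_of_pow_eq {E : Type*} [NormedField E] {x : E} {q : ℕ} (hq : 1 < q)
    (hx : x ^ q = x) : ‖x‖ ≤ 1 := by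
  by_contra! h
  have h1 := lt_self_pow₀ h hq
  rw [← norm_pow, hx] at h1
  exact lt_irrefl _ h1

theorem eq_zero_of_pow_eq_of_norm_lt_one {E : Type*} [NormedField E] {x : E} {q : ℕ} (hq : 1 < q)
    (hx : x ^ q = x) (h : ‖x‖ < 1) : x = 0 := by
  by_contra h0
  have h1 := pow_lt_self_of_lt_one₀ (norm_pos_iff.2 h0) h hq
  rw [← norm_pow, hx] at h1
  exact lt_irrefl _ h1

/-- A partial sum of a series with sum zero is minus the tail, to which the ultrametric inequality
applies. -/
theorem norm_sum_range_le_of_hasSum_zero {E : Type*} [NormedField E] [IsUltrametricDist E]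
    {g : ℕ → E} (hg : HasSum g 0) {N : ℕ} {C : ℝ} (hC : 0 ≤ C) (h : ∀ i, N ≤ i → ‖g i‖ ≤ C) :
    ‖∑ i ∈ Finset.range N, g i‖ ≤ C := by
  have h1 : Filter.Tendsto (fun k => ‖∑ i ∈ Finset.range k, g i - ∑ i ∈ Finset.range N, g i‖)
      Filter.atTop (nhds ‖0 - ∑ i ∈ Finset.range N, g i‖) :=
    (hg.tendsto_sum_nat.sub_const _).norm
  rw [zero_sub, norm_neg] at h1
  refine le_of_tendsto h1 (Filter.eventually_atTop.2 ⟨N, fun k hk => ?_⟩)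
  rw [← Finset.sum_Ico_eq_sub _ hk]
  exact IsUltrametricDist.norm_sum_le_of_forall_le_of_nonneg hC fun i hi =>
    h i (Finset.mem_Ico.1 hi).1

variable {p : ℕ} [Fact p.Prime]

theorem norm_prime_padicComplex : ‖(p : PadicComplex p)‖ = (p : ℝ)⁻¹ := by
  have h : (p : PadicComplex p) = algebraMap ℚ_[p] (PadicComplex p) (p : ℚ_[p]) := by simp
  rw [h, norm_algebraMap', Padic.norm_p]

theorem finite_roots_pow_eq {E : Type*} [Field E] {q : ℕ} (hq : 1 < q) :
    {z : E | z ^ q = z}.Finite := by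
  have hne : (Polynomial.X ^ q - Polynomial.X : Polynomial E) ≠ 0 :=
    FiniteField.X_pow_card_sub_X_ne_zero E hq
  refine (Polynomial.finite_setOfPred_isRoot hne).subset fun z hz => ?_
  have hz' : z ^ q = z := hz
  simp [Polynomial.IsRoot, hz']

theorem finiteDimensional_unramifiedField {a : ℕ} (ha : a ≠ 0) :
    FiniteDimensional ℚ_[p] (unramifiedField p a) := by
  have hq : 1 < p ^ a := Nat.one_lt_pow ha (Fact.out : p.Prime).one_lt
  have := (finite_roots_pow_eq (E := PadicComplex p) hq).to_subtype
  refine IntermediateField.finiteDimensional_adjoin fun z hz => ?_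
  refine ⟨Polynomial.X ^ (p ^ a) - Polynomial.X,
    Polynomial.monic_X_pow_sub (by rw [Polynomial.degree_X]; exact_mod_cast hq), ?_⟩
  have hz' : z ^ (p ^ a) = z := hz
  simp [hz']

theorem isIntegral_of_pow_eq {E : Type*} [Field E] [Algebra ℚ_[p] E] {x : E} {N : ℕ} (hN : N ≠ 0)
    {c : ℕ} (hx : x ^ N = c) : IsIntegral ℚ_[p] x :=
  IsIntegral.of_pow (Nat.pos_of_ne_zero hN) (hx ▸ isIntegral_natCast c)

/-- Finiteness over ℚ_p makes Ω̃₀ locally compact, the source of both its completeness and its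
uniformizer. -/
theorem finiteDimensional_OmegaTilde {a N : ℕ} (ha : a ≠ 0) (hN : N ≠ 0) {ζ π : PadicComplex p}
    (hζ : ζ ^ p = 1) (hπ : π ^ N = (p : PadicComplex p)) :
    FiniteDimensional ℚ_[p] (OmegaTilde p a ζ π) := by
  have := finiteDimensional_unramifiedField (p := p) ha
  have h1 : FiniteDimensional ℚ_[p] (OmegaOne p ζ) :=
    IntermediateField.adjoin.finiteDimensional
      (isIntegral_of_pow_eq (c := 1) (Fact.out : p.Prime).ne_zero (by simpa using hζ))
  have h2 : FiniteDimensional ℚ_[p] (IntermediateField.adjoin ℚ_[p] {π}) :=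
    IntermediateField.adjoin.finiteDimensional (isIntegral_of_pow_eq hN hπ)
  have h3 : FiniteDimensional ℚ_[p] (OmegaZero p a ζ) :=
    IntermediateField.finiteDimensional_sup _ _
  exact IntermediateField.finiteDimensional_sup _ _

section Reduction

variable {a : ℕ} {F : Type*} [Field F] [Fintype F] (hF : Fintype.card F = p ^ a)
  (red : unramifiedIntegers p a →+* F)

theorem mem_unramifiedIntegers {x : unramifiedField p a} :
    x ∈ unramifiedIntegers p a ↔ ‖x‖ ≤ 1 := Iff.rfl

omit [Fact p.Prime] in
include hF in
theorem exponent_ne_zero : a ≠ 0 := by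
  rintro rfl
  have := Fintype.one_lt_card (α := F)
  rw [hF] at this
  simp at this

omit [Fact p.Prime] in
include hF in
theorem natCast_prime_eq_zero : (p : F) = 0 := by
  have h : ((p ^ a : ℕ) : F) = 0 := by rw [← hF]; exact FiniteField.cast_card_eq_zero F
  rw [Nat.cast_pow] at h
  exact eq_zero_of_pow_eq_zero h

omit [Fintype F] in
theorem norm_lt_one_of_red_eq_zero {x : unramifiedIntegers p a} (hx : red x = 0) :
    ‖(x : unramifiedField p a)‖ < 1 := by
  refine lt_of_le_of_ne (mem_unramifiedIntegers.1 x.2) fun h => ?_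
  have h0 : (x : unramifiedField p a) ≠ 0 := fun h0 => by rw [h0, norm_zero] at h; simp at h
  have hy : (x : unramifiedField p a)⁻¹ ∈ unramifiedIntegers p a := by
    rw [mem_unramifiedIntegers, norm_inv, h, inv_one]
  have hxy : x * ⟨_, hy⟩ = 1 := Subtype.ext (mul_inv_cancel₀ h0)
  have := congrArg red hxy
  rw [map_mul, hx, zero_mul, map_one] at this
  exact zero_ne_one this

-- A primitive (q-1)-th root of unity keeps its order under reduction, and its powers then exhaust
-- the nonzero elements of F.
include hF in
theorem red_surjective : Function.Surjective red := by
  have hq : 1 < p ^ a := Nat.one_lt_pow (exponent_ne_zero hF) (Fact.out : p.Prime).one_lt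
  have hN : p ^ a - 1 ≠ 0 := by omega
  have : NeZero ((p ^ a - 1 : ℕ) : PadicComplex p) := ⟨Nat.cast_ne_zero.2 hN⟩
  obtain ⟨ξ, hξ⟩ := HasEnoughRootsOfUnity.exists_primitiveRoot (PadicComplex p) (p ^ a - 1)
  have hξq : ξ ^ (p ^ a) = ξ := by
    conv_lhs => rw [← Nat.sub_add_cancel hq.le]
    rw [pow_succ, hξ.pow_eq_one, one_mul]
  let ξK : unramifiedField p a := ⟨ξ, IntermediateField.subset_adjoin _ _ hξq⟩
  have hξK : ξK ^ (p ^ a) = ξK := Subtype.ext hξq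
  let ξO : unramifiedIntegers p a :=
    ⟨ξK, mem_unramifiedIntegers.2 (norm_le_one_of_pow_eq hq hξK)⟩
  have hξO : IsPrimitiveRoot ξO (p ^ a - 1) := by
    refine IsPrimitiveRoot.of_map_of_injective
      (f := (unramifiedField p a).val.toRingHom.comp (unramifiedIntegers p a).subtype) ?_ ?_
    · exact hξ
    · exact Subtype.val_injective.comp Subtype.val_injective
  have hred : IsPrimitiveRoot (red ξO) (p ^ a - 1) := by
    refine ⟨by rw [← map_pow, hξO.pow_eq_one, map_one], fun i hi => hξO.dvd_of_pow_eq_one i ?_⟩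
    -- If ξ^i reduces to 1 but is not 1, the geometric sum of its powers vanishes; its reduction is
    -- q-1 = -1 in F, a contradiction.
    have hgeom := geom_sum_mul (ξO ^ i) (p ^ a - 1)
    rw [← pow_mul, mul_comm i, pow_mul, hξO.pow_eq_one, one_pow, sub_self] at hgeom
    refine sub_eq_zero.1 ((mul_eq_zero.1 hgeom).resolve_left fun h => ?_)
    have h1 := congrArg red h
    rw [map_sum, map_zero] at h1
    simp only [map_pow, hi, one_pow, Finset.sum_const, Finset.card_range, nsmul_eq_mul,
      mul_one] at h1
    rw [Nat.cast_sub hq.le, Nat.cast_pow, natCast_prime_eq_zero hF,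
      zero_pow (exponent_ne_zero hF), Nat.cast_one, zero_sub, neg_eq_zero] at h1
    exact one_ne_zero h1
  intro x
  rcases eq_or_ne x 0 with rfl | hx
  · exact ⟨0, map_zero _⟩
  · have : NeZero (p ^ a - 1) := ⟨hN⟩
    obtain ⟨i, -, hi⟩ := hred.eq_pow_of_pow_eq_one
      (by rw [← hF]; exact FiniteField.pow_card_sub_one_eq_one x hx)
    exact ⟨ξO ^ i, by rw [map_pow, hi]⟩

-- Elements killed by `red` have norm below 1, so the map from the integers of K to the residue
-- field of Ω̃₀ factors through F.
include hF in
theorem exists_residue_hom (ζ π : PadicComplex p) :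
    ∃ φ : F →+* IsLocalRing.ResidueField (integers (OmegaTilde p a ζ π)),
      ∀ (x : unramifiedField p a) (hx : x ∈ unramifiedIntegers p a)
        (hx' : IntermediateField.inclusion (unramifiedField_le a ζ π) x
          ∈ integers (OmegaTilde p a ζ π)),
        φ (red ⟨x, hx⟩) = IsLocalRing.residue _ ⟨_, hx'⟩ := by
  let ι : unramifiedIntegers p a →+* integers (OmegaTilde p a ζ π) :=
    ((IntermediateField.inclusion (unramifiedField_le a ζ π)).toRingHom.comp
      (unramifiedIntegers p a).subtype).codRestrict _ fun x => x.2
  let ψ := (IsLocalRing.residue (integers (OmegaTilde p a ζ π))).comp ι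
  have hker : RingHom.ker red ≤ RingHom.ker ψ := fun x hx =>
    residue_eq_zero_iff.2 (norm_lt_one_of_red_eq_zero red hx)
  refine ⟨red.liftOfSurjective (red_surjective hF red) ⟨ψ, hker⟩, fun x hx hx' => ?_⟩
  exact RingHom.congr_fun (red.liftOfRightInverse_comp _
    (Function.rightInverse_surjInv (red_surjective hF red)) ⟨ψ, hker⟩) ⟨x, hx⟩

end Reduction

end FieldTheory

/-! ### Exponents of ‖π‖ and the role of the bounds on b. -/

section Parameters

/-- Up to the factor e these are the exponents of the norms of γ^(p^i)/p^i; each step adds (p-1)(p^i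
- 1) ≥ 0, so the first omitted term dominates the tail. -/
theorem monotone_pow_sub (p : ℕ) (hp : 1 ≤ p) :
    Monotone fun i : ℕ => (p : ℤ) ^ i - (p - 1) * i := by
  refine monotone_nat_of_le_succ fun i => ?_
  have h1 : (1 : ℤ) ≤ (p : ℤ) ^ i := by exact_mod_cast Nat.one_le_pow _ _ hp
  have h2 : (0 : ℤ) ≤ (p : ℤ) - 1 := by omega
  push_cast
  rw [pow_succ]
  nlinarith [mul_le_mul_of_nonneg_left h1 h2]

/-- The norm of `γ_l` is bounded by that of the first omitted term
`γ ^ (p ^ (l + 1)) / p ^ (l + 1)`; here `P ^ (e (p - 1)) = ‖p‖` and `‖γ‖ = P ^ e`. -/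
theorem norm_gammaTrunc_mul_le {E : Type*} [NormedField E] [IsUltrametricDist E] {p : ℕ}
    (hp : 1 ≤ p) {γ : E} (hγ : HasSum (fun i : ℕ => γ ^ (p ^ i) / (p : E) ^ i) 0) {P : ℝ}
    (hP : 0 < P) (hP1 : P ≤ 1) {e : ℕ} (hγn : ‖γ‖ = P ^ e) (hpn : ‖(p : E)‖ = P ^ (e * (p - 1)))
    (l : ℕ) :
    ‖gammaTrunc p γ l * (p : E) ^ l‖ ≤ P ^ ((e : ℤ) * ((p : ℤ) ^ (l + 1) - (p - 1))) := by
  have hcast : ((e * (p - 1) : ℕ) : ℤ) = e * ((p : ℤ) - 1) := by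
    rw [Nat.cast_mul, Nat.cast_sub hp, Nat.cast_one]
  have hterm : ∀ i : ℕ, ‖γ ^ (p ^ i) / (p : E) ^ i‖
      = P ^ ((e : ℤ) * ((p : ℤ) ^ i - (p - 1) * i)) := fun i => by
    rw [norm_div, norm_pow, norm_pow, hγn, hpn, ← pow_mul, ← pow_mul, ← zpow_natCast,
      ← zpow_natCast, ← zpow_sub₀ hP.ne']
    congr 1
    rw [Nat.cast_mul (e * (p - 1)), hcast]
    push_cast
    ring
  have h1 : ‖gammaTrunc p γ l‖ ≤ P ^ ((e : ℤ) * ((p : ℤ) ^ (l + 1) - (p - 1) * (l + 1 : ℕ))) := by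
    refine norm_sum_range_le_of_hasSum_zero hγ (zpow_nonneg hP.le _) fun i hi => ?_
    rw [hterm]
    exact zpow_le_zpow_right_of_le_one₀ hP hP1
      (mul_le_mul_of_nonneg_left (monotone_pow_sub p hp hi) (Nat.cast_nonneg e))
  rw [norm_mul, norm_pow, hpn, ← pow_mul, ← zpow_natCast P]
  refine (mul_le_mul_of_nonneg_right h1 (zpow_nonneg hP.le _)).trans_eq ?_
  rw [← zpow_add₀ hP.ne']
  congr 1
  rw [Nat.cast_mul (e * (p - 1)), hcast]
  push_cast
  ring

theorem tendsto_pow_pow_sub_one {P : ℝ} (hP : 0 < P) (hP1 : P < 1) {p c : ℕ} (hp : 2 ≤ p)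
    (hc : 1 ≤ c) : Filter.Tendsto (fun l => P ^ ((p ^ l - 1) * c)) Filter.atTop (nhds 0) := by
  refine squeeze_zero (fun l => pow_nonneg hP.le _) (fun l => ?_)
    (tendsto_pow_atTop_nhds_zero_of_lt_one hP.le hP1)
  refine pow_le_pow_of_le_one hP.le hP1.le ?_
  have h1 : l < p ^ l := Nat.lt_pow_self (by omega)
  exact (by omega : l ≤ p ^ l - 1).trans (Nat.le_mul_of_pos_right _ hc)

/-- The integrality hypotheses hold as soon as `‖γ‖ = ‖π‖ ^ e` with `e < m d < p e`. -/
theorem Bounds.of_exponents {K L : Type*} [Field K] [NormedField L] [IsUltrametricDist L] {n p : ℕ}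
    {j : K →+* L} {τ : K ≃+* K} {γ π : L} {m d e : ℕ} {fhat : MvPolynomial (Fin n) K}
    (hp : p.Prime) (hd : 1 ≤ d) (hπ0 : π ≠ 0) (hπ1 : ‖π‖ < 1)
    (hcoeff : ∀ l v, ‖j ((τ ^ l : K ≃+* K) (fhat.coeff v))‖ ≤ 1)
    (hdeg : ∀ v : Fin n →₀ ℕ, d < v.degree → fhat.coeff v = 0)
    (hγ : ∀ l, ‖gammaTrunc p γ l * (p : L) ^ l‖
      ≤ ‖π‖ ^ ((e : ℤ) * ((p : ℤ) ^ (l + 1) - (p - 1))))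
    (hγn : ‖γ‖ = ‖π‖ ^ e) (he : e < m * d) (he' : m * d < p * e) :
    Bounds p j τ γ π m d ((m : ℤ) * (d - 1) - e) fhat
      (fun l => ‖π‖ ^ ((p ^ l - 1) * (p * e - m * d))) := by
  have hP : 0 < ‖π‖ := norm_pos_iff.2 hπ0
  have hc : 1 ≤ p * e - m * d := by omega
  have hone : ∀ l, 1 ≤ p ^ l := fun l => Nat.one_le_pow _ _ hp.pos
  refine ⟨hp, Nat.one_le_iff_ne_zero.2 fun h => by simp [h] at he, hπ0, hπ1, hcoeff, hdeg,
    fun l => ?_, ?_, ?_, by simp, fun l hl => ?_,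
    tendsto_pow_pow_sub_one hP hπ1 hp.two_le hc⟩
  -- Equality of exponents: m(d-1) - e + e(p^(l+1) - (p-1)) = (p^l - 1)(pe - md) + m(p^l d - 1).
  · refine (mul_le_mul_of_nonneg_left (hγ l) (zpow_nonneg hP.le _)).trans_eq ?_
    rw [← zpow_natCast, ← zpow_natCast, ← zpow_add₀ hP.ne', ← zpow_add₀ hP.ne']
    congr 1
    have h1 : 1 ≤ p ^ l * d := Nat.mul_pos (hone l) hd
    rw [Nat.cast_mul (p ^ l - 1), Nat.cast_mul m, Nat.cast_sub (hone l), Nat.cast_sub he'.le,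
      Nat.cast_sub h1]
    push_cast
    ring
  · rw [hγn, ← zpow_natCast, ← zpow_natCast, ← zpow_add₀ hP.ne']
    congr 1
    rw [Nat.cast_mul, Nat.cast_sub hd]
    push_cast
    ring
  · rw [norm_mul, norm_zpow, norm_pow, ← zpow_natCast, ← zpow_add₀ hP.ne']
    have h1 : ((m : ℤ) * (d - 1) - e + m) = ((m * d - e : ℕ) : ℤ) := by
      rw [Nat.cast_sub he.le]
      push_cast
      ring
    rw [h1, zpow_natCast]
    exact pow_lt_one₀ hP.le hπ1 (by omega)
  · refine pow_lt_one₀ hP.le hπ1 (Nat.mul_ne_zero ?_ (by omega))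
    have := Nat.one_lt_pow hl hp.one_lt
    omega

/-- From Md = (p-1)e and m = Mb one gets md = e · b(p-1), while 1 < b(p-1) < p. -/
theorem exponent_bounds {p M m d e : ℕ} {b : ℚ} (hp : 2 ≤ p) (hb : 1 / ((p : ℚ) - 1) < b)
    (hb' : b < (p : ℚ) / ((p : ℚ) - 1)) (hM : 0 < M) (hd : 1 ≤ d) (hm : (m : ℚ) = M * b)
    (he : M * d = (p - 1) * e) : e < m * d ∧ m * d < p * e := by
  have hp1 : (0 : ℚ) < (p : ℚ) - 1 := by
    have : (2 : ℚ) ≤ p := by exact_mod_cast hp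
    linarith
  have heq : (M : ℚ) * d = ((p : ℚ) - 1) * e := by
    have h := congrArg (Nat.cast : ℕ → ℚ) he
    rwa [Nat.cast_mul, Nat.cast_mul, Nat.cast_sub (by omega), Nat.cast_one] at h
  have hMd : (0 : ℚ) < (M : ℚ) * d := by
    have : 0 < M * d := Nat.mul_pos hM hd
    exact_mod_cast this
  rw [div_lt_iff₀ hp1] at hb
  rw [lt_div_iff₀ hp1] at hb'
  have h1 : ((p : ℚ) - 1) * (m * d) = (M * d) * (b * ((p : ℚ) - 1)) := by rw [hm]; ring
  constructor
  · have : (e : ℚ) < m * d := by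
      refine lt_of_mul_lt_mul_left ?_ hp1.le
      rw [h1, ← heq]
      exact lt_mul_of_one_lt_right hMd hb
    exact_mod_cast this
  · have : (m : ℚ) * d < p * e := by
      refine lt_of_mul_lt_mul_left ?_ hp1.le
      have h2 : ((p : ℚ) - 1) * (p * e) = (M * d) * p := by rw [heq]; ring
      rw [h1, h2]
      exact mul_lt_mul_of_pos_left hb' hMd
    exact_mod_cast this

end Parameters

end Dwork

/-! ### The theorem: the p-adic parameters satisfy the bounds. -/

set_option maxHeartbeats 1000000 in
theorem theorem3p8 (p : ℕ) [Fact p.Prime] (a n d M : ℕ)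
    -- the finite field with `q = p ^ a` elements and the reduction map of `K`
    {F : Type*} [Field F] [Fintype F] (hF : Fintype.card F = p ^ a)
    (red : Dwork.unramifiedIntegers p a →+* F)
    -- the polynomial `f` of degree `d`, with regular sequence of leading partial derivatives
    (f : MvPolynomial (Fin n) F) (hd : f.totalDegree = d)
    (hreg : RingTheory.Sequence.IsRegular (MvPolynomial (Fin n) F)
      (List.ofFn (Dwork.leadingPartial d f)))
    -- the Teichmüller lifting of `f` and the Frobenius automorphism of `K`
    (fhat : MvPolynomial (Fin n) (Dwork.unramifiedField p a))
    (hfhat : Dwork.IsTeichmullerLift red f fhat)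
    (τ : Dwork.unramifiedField p a ≃ₐ[ℚ_[p]] Dwork.unramifiedField p a)
    (hτ : Dwork.IsFrobenius τ)
    -- `ζ_p`, and `γ ∈ ℚ_p(ζ_p)` with `∑ γ ^ (p ^ i) / p ^ i = 0` and `ord γ = 1 / (p - 1)`
    (ζ : PadicComplex p) (hζ : IsPrimitiveRoot ζ p)
    (γ : Dwork.OmegaOne p ζ)
    (hγ : HasSum (fun i : ℕ => γ ^ (p ^ i) / (p : Dwork.OmegaOne p ζ) ^ i) 0)
    (hγ_ord : ‖γ‖ = (p : ℝ) ^ (-(1 / ((p : ℝ) - 1))))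
    -- the rational number `b`; `M b / p` and `M d / (p - 1)` are integers, and `m = M b`
    (b : ℚ) (hb : 1 / ((p : ℚ) - 1) < b) (hb' : b < (p : ℚ) / ((p : ℚ) - 1))
    (hM : 0 < M) (m : ℕ) (hm : (m : ℚ) = M * b) (hpm : p ∣ m) (hMd : (p - 1) ∣ M * d)
    -- `π ^ (M d) = p`, and `ε = M b (d - 1) - M d / (p - 1)`
    (π : PadicComplex p) (hπ : π ^ (M * d) = (p : PadicComplex p))
    (ε : ℤ) (hε : (ε : ℚ) = M * b * (d - 1) - M * d / (p - 1)) :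
    let j : Dwork.unramifiedField p a →+* Dwork.OmegaTilde p a ζ π :=
      (IntermediateField.inclusion (Dwork.unramifiedField_le a ζ π)).toRingHom
    let γ' : Dwork.OmegaTilde p a ζ π :=
      IntermediateField.inclusion (Dwork.OmegaOne_le a ζ π) γ
    let π' : Dwork.OmegaTilde p a ζ π := Dwork.piTilde a ζ π
    let πD : Dwork.Form n (Dwork.OmegaTilde p a ζ π) →ₗ[Dwork.OmegaTilde p a ζ π]
        Dwork.Form n (Dwork.OmegaTilde p a ζ π) :=
      Dwork.piD p j τ.toRingEquiv γ' π' ε fhat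
    -- `(Ω^•_{C(b)}, π ^ ε D)` is a complex
    (∀ k, Dwork.coboundaries π' m πD k ≤ Dwork.cocycles π' m πD k) ∧
    -- its cohomology vanishes outside degree `n`
    (∀ k, k ≠ n → Subsingleton (Dwork.Cohomology π' m πD k)) ∧
    -- there are `(d - 1) ^ n` monomials that form a basis of the Jacobian ring
    (∃ μ : Fin ((d - 1) ^ n) → Fin n →₀ ℕ, Dwork.IsMonomialBasis d f μ) ∧
    -- for any such monomials the classes of `x ^ μ_i dx_1 ∧ ⋯ ∧ dx_n` form a basis of `H^n`
    (∀ μ : Fin ((d - 1) ^ n) → Fin n →₀ ℕ, Dwork.IsMonomialBasis d f μ →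
      LinearIndependent (Dwork.OmegaTilde p a ζ π) (fun i => Dwork.topClass
        (Dwork.piTilde_ne_zero hπ) m p j τ.toRingEquiv γ' ε fhat (μ i)) ∧
      Submodule.span (Dwork.OmegaTilde p a ζ π) (Set.range fun i => Dwork.topClass
        (Dwork.piTilde_ne_zero hπ) m p j τ.toRingEquiv γ' ε fhat (μ i)) = ⊤) ∧
    Module.finrank (Dwork.OmegaTilde p a ζ π) (Dwork.Cohomology π' m πD n)
      = (d - 1) ^ n := by
  intro j γ' π' πD
  have hprime : p.Prime := Fact.out
  have ha : a ≠ 0 := Dwork.exponent_ne_zero hF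
  have hMd0 : M * d ≠ 0 := by
    intro h0
    rw [h0, pow_zero] at hπ
    exact hprime.one_lt.ne (by exact_mod_cast hπ)
  have hd1 : 1 ≤ d := Nat.one_le_iff_ne_zero.2 fun h0 => hMd0 (by rw [h0, mul_zero])
  have hfd := Dwork.finiteDimensional_OmegaTilde ha hMd0 hζ.pow_eq_one hπ
  have hproper : ProperSpace (Dwork.OmegaTilde p a ζ π) :=
    FiniteDimensional.proper ℚ_[p] (Dwork.OmegaTilde p a ζ π)
  -- norms
  have hp0 : (0 : ℝ) < p := Nat.cast_pos.2 hprime.pos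
  have hpL : ‖(p : Dwork.OmegaTilde p a ζ π)‖ = (p : ℝ)⁻¹ := Dwork.norm_prime_padicComplex
  have hpinv : (p : ℝ)⁻¹ < 1 := inv_lt_one_of_one_lt₀ (by exact_mod_cast hprime.one_lt)
  have hpL0 : (p : Dwork.OmegaTilde p a ζ π) ≠ 0 := fun h0 => by
    rw [h0, norm_zero] at hpL
    exact (inv_pos.2 hp0).ne hpL
  have hπp : ‖π'‖ ^ (M * d) = (p : ℝ)⁻¹ := by
    change ‖π‖ ^ (M * d) = _
    rw [← norm_pow, hπ, Dwork.norm_prime_padicComplex]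
  have hπ1 : ‖π'‖ < 1 := (pow_lt_one_iff_of_nonneg (norm_nonneg _) hMd0).1 (hπp.trans_lt hpinv)
  have hπ0 : π' ≠ 0 := Dwork.piTilde_ne_zero hπ
  obtain ⟨ϖ, hϖ, hϖ1, hmax⟩ := Dwork.exists_uniformizer hpL0 (hpL.trans_lt hpinv)
  -- exponents
  obtain ⟨e, he⟩ := hMd
  have hp1 : ((p - 1 : ℕ) : ℝ) = (p : ℝ) - 1 := by rw [Nat.cast_sub hprime.one_le, Nat.cast_one]
  have hp1' : (p : ℝ) - 1 ≠ 0 := by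
    rw [← hp1]
    exact Nat.cast_ne_zero.2 (Nat.sub_ne_zero_of_lt hprime.one_lt)
  have hγn : ‖γ‖ = ‖π'‖ ^ e := by
    -- Both sides have (p-1)-th power 1/p, since (p-1)e = Md and π^(Md) = p.
    refine (pow_left_inj₀ (norm_nonneg _) (pow_nonneg (norm_nonneg _) _)
      (Nat.sub_ne_zero_of_lt hprime.one_lt)).1 ?_
    rw [← pow_mul, mul_comm e, ← he, hπp, hγ_ord, ← Real.rpow_natCast, ← Real.rpow_mul hp0.le,
      hp1, neg_mul, one_div, inv_mul_cancel₀ hp1', Real.rpow_neg_one]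
  obtain ⟨he1, he2⟩ := Dwork.exponent_bounds hprime.two_le hb hb' hM hd1 hm he
  have hεe : ε = (m : ℤ) * (d - 1) - e := by
    have hpQ : (p : ℚ) - 1 ≠ 0 := by
      have : (1 : ℚ) < p := by exact_mod_cast hprime.one_lt
      linarith
    have h1 : (M : ℚ) * d / (p - 1) = e := by
      have h := congrArg (Nat.cast : ℕ → ℚ) he
      rw [Nat.cast_mul, Nat.cast_mul, Nat.cast_sub hprime.one_le, Nat.cast_one] at h
      rw [h, mul_div_cancel_left₀ _ hpQ]
    rw [h1, ← hm] at hε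
    exact_mod_cast hε
  -- coefficients of the Teichmüller lifting
  have hq : 1 < p ^ a := Nat.one_lt_pow ha hprime.one_lt
  have hcoeff : ∀ (l : ℕ) v, ‖j ((τ.toRingEquiv ^ l : Dwork.unramifiedField p a ≃+*
      Dwork.unramifiedField p a) (fhat.coeff v))‖ ≤ 1 := fun l v =>
    Dwork.norm_le_one_of_pow_eq hq (by rw [← map_pow, ← map_pow, (hfhat v).1])
  -- A solution of z^q = z with zero reduction has norm below 1 and is therefore 0, so f̂ has no
  -- terms above degree d.
  have hdeg : ∀ v : Fin n →₀ ℕ, d < v.degree → fhat.coeff v = 0 := fun v hv => by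
    obtain ⟨hv1, hv2, hv3⟩ := hfhat v
    refine Dwork.eq_zero_of_pow_eq_of_norm_lt_one hq hv1
      (Dwork.norm_lt_one_of_red_eq_zero red (x := ⟨_, hv2⟩) ?_)
    rw [hv3]
    by_contra hne
    have h1 := MvPolynomial.le_totalDegree (MvPolynomial.mem_support_iff.2 hne)
    rw [hd] at h1
    exact (h1.trans_lt hv).false
  have hγt : ∀ l, ‖Dwork.gammaTrunc p γ' l * (p : Dwork.OmegaTilde p a ζ π) ^ l‖
      ≤ ‖π'‖ ^ ((e : ℤ) * ((p : ℤ) ^ (l + 1) - (p - 1))) := fun l => by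
    have hpn : ‖(p : Dwork.OmegaOne p ζ)‖ = ‖π'‖ ^ (e * (p - 1)) := by
      rw [mul_comm, ← he, hπp]
      exact Dwork.norm_prime_padicComplex
    refine le_trans (le_of_eq ?_) (Dwork.norm_gammaTrunc_mul_le hprime.one_le hγ
      (norm_pos_iff.2 hπ0) hπ1.le hγn hpn l)
    have h1 : Dwork.gammaTrunc p γ' l * (p : Dwork.OmegaTilde p a ζ π) ^ l
        = IntermediateField.inclusion (Dwork.OmegaOne_le a ζ π)
          (Dwork.gammaTrunc p γ l * (p : Dwork.OmegaOne p ζ) ^ l) := by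
      simp only [Dwork.gammaTrunc, map_mul, map_sum, map_div₀, map_pow, map_natCast, γ']
    rw [h1]
    rfl
  have hB := Dwork.Bounds.of_exponents hprime hd1 hπ0 hπ1 hcoeff hdeg hγt hγn he1 he2
  rw [← hεe] at hB
  -- the embedding of `F` in the residue field
  obtain ⟨φ, hφ⟩ := Dwork.exists_residue_hom hF red ζ π
  let : Algebra F (IsLocalRing.ResidueField (Dwork.integers (Dwork.OmegaTilde p a ζ π))) :=
    φ.toAlgebra
  have hf : ∀ v, algebraMap F (IsLocalRing.ResidueField (Dwork.integers
      (Dwork.OmegaTilde p a ζ π))) (f.coeff v)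
      = IsLocalRing.residue _ ⟨_, hB.coeff_mem_integers v⟩ := fun v => by
    obtain ⟨-, hv2, hv3⟩ := hfhat v
    rw [← hv3]
    exact hφ _ hv2 (hB.coeff_mem_integers v)
  have hreg' := hreg.toIsWeaklyRegular
  obtain ⟨μ₀, hμ₀⟩ := Dwork.exists_isMonomialBasis hreg'
  refine ⟨hB.isComplex hϖ hϖ1 hmax f hf hreg',
    fun k hk => hB.cohomology_subsingleton hϖ hϖ1 hmax f hf hreg' hk, ⟨μ₀, hμ₀⟩,
    fun μ hμ => ⟨hB.linearIndependent_topClass hϖ hϖ1 hmax f hf hreg' hμ,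
      hB.span_topClass hϖ hϖ1 hmax f hf hreg' hμ⟩, ?_⟩
  rw [Module.finrank_eq_card_basis (Module.Basis.mk
    (hB.linearIndependent_topClass hϖ hϖ1 hmax f hf hreg' hμ₀)
    (hB.span_topClass hϖ hϖ1 hmax f hf hreg' hμ₀).ge), Fintype.card_fin]
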